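/- **Setting.** Let $\Omega\subset\mathbb R^2$ be a bounded polygonal Lipschitz domain and $\mathcal T$ a conforming triangulation of $\Omega$ into closed triangles (two different triangles meet in the empty set, a common vertex or a common edge), with vertex set $\mathcal V(\mathcal T)$. Let $\gamma_{\mathcal T}:=\max_{K\in\mathcal T}h_K/\rho_K$ be the shape-regularity constant, where $h_K=\operatorname{diam}K$ and $\rho_K$ is the diameter of the largest ball inscribed in $K$, and let $\alpha_{\mathcal T}>0$ be the minimum over all boundary vertices $\mathbf z$ of the angle between the two boundary edges at $\mathbf z$ measured in the exterior of $\Omega$. For each vertex $\mathbf z$ fix a counterclockwise numbering $K_1,\dots,K_{N_{\mathbf z}}$ of the triangles that contain $\mathbf z$, successive triangles sharing an edge (cyclically, if $\mathbf z\in\Omega$), and let $\theta_j$ be the angle of $K_j$ at $\mathbf z$. Put $$\Theta(\mathbf z):=\begin{cases}\max_{1\le i\le N_{\mathbf z}}|\sin(\theta_i+\theta_{i+1})| & \mathbf z\in\Omega\quad(\theta_{N_{\mathbf z}+1}:=\theta_1),\\ \max_{1\le i\le N_{\mathbf z}-1}|\sin(\theta_i+\theta_{i+1})| & \mathbf z\in\partial\Omega,\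 N_{\mathbf z}>1,\\ 0 & \mathbf z\in\partial\Omega,\ N_{\mathbf z}=1,\end{cases}$$ and for $\eta\ge 0$ let $\mathcal C_{\mathcal T}(\eta):=\{\mathbf z\in\mathcal V(\mathcal T):\Theta(\mathbf z)\le\eta\}$. Let $\mathbb P_k(\mathcal T)$ be the space of $q\in L^2(\Omega)$ whose restriction to the interior of each triangle is a polynomial of degree at most $k$; for such $q$ put $A_{\mathcal T,\mathbf z}(q):=\sum_{\ell=1}^{N_{\mathbf z}}(-1)^\ell (q|_{K_\ell})(\mathbf z)$. Define $$\mathbf S_{k,0}(\mathcal T):=\big(\mathbb P_k(\mathcal T)\cap H^1_0(\Omega)\big)^2,$$ $$M_{\eta,k-1}(\mathcal T):=\Big\{q\in\mathbb P_{k-1}(\mathcal T):\int_\Omega q=0,\ A_{\mathcal T,\mathbf z}(q)=0\ \text{for all } \mathbf z\in\mathcal C_{\mathcal T}(\eta)\Big\},$$ $$\mathbf X_\eta(\mathcal T):=\{\mathbf v\in\mathbf S_{k,0}(\mathcal T): A_{\mathcal T,\mathbf z}(\operatorname{div}\mathbf v)=0\ \text{for all }\mathbf z\in\mathcal C_{\mathcal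 T}(\eta)\setminus\mathcal C_{\mathcal T}(0)\}.$$ **Lemma (divergence estimate).** There are a constant $C_{\operatorname{div}}>0$ that depends only on the shape regularity (an upper bound of $\gamma_{\mathcal T}$) and a constant $\eta_0>0$ that depends only on the shape regularity and on (a positive lower bound of) the minimal outer angle $\alpha_{\mathcal T}$ such that the following holds for all $\Omega$ and $\mathcal T$ as above, all $k\ge4$ and all $0\le\eta<\eta_0$. Every $\mathbf v_{\mathbf S}\in\mathbf S_{k,0}(\mathcal T)$ whose divergence is $L^2(\Omega)$-orthogonal to $M_{\eta,k-1}(\mathcal T)$ satisfies $$\|\operatorname{div}\mathbf v_{\mathbf S}\|_{L^2(\Omega)}\le C_{\operatorname{div}}\,\eta\,\min_{\mathbf w_{\mathbf S}\in\mathbf X_\eta(\mathcal T)}\|\nabla(\mathbf v_{\mathbf S}-\mathbf w_{\mathbf S})\|_{L^2(\Omega)},$$ where the minimum is attained. -/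

import Mathlib

open MeasureTheory Filter Topology
open scoped ContDiff ENNReal

noncomputable section

namespace PressureWired

/-- The Euclidean plane. -/
abbrev Plane : Type := EuclideanSpace ℝ (Fin 2)

/-- The canonical unit vectors of the plane. -/
def unitVec (i : Fin 2) : Plane := EuclideanSpace.single i 1

/-! ### Domains -/

/-- A bounded Lipschitz domain: a bounded, connected, nonempty open set which near each of its
boundary points is, in rotated Cartesian coordinates, the set below the graph of a Lipschitz
function. (Polygonality comes with the triangulation, see `Triangulation`.) -/
structure IsLipschitzDomain (Ω : Set Plane) : Prop where
  isOpen : IsOpen Ω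
  isConnected : IsConnected Ω
  isBounded : Bornology.IsBounded Ω
  locally_subgraph : ∀ x ∈ frontier Ω, ∃ U ∈ 𝓝 x, ∃ e : Plane ≃ₗᵢ[ℝ] Plane,
    ∃ L : NNReal, ∃ g : ℝ → ℝ, LipschitzWith L g ∧
      ∀ y ∈ U, (y ∈ Ω ↔ (e y) 1 < g ((e y) 0))

/-! ### The Sobolev space `H¹₀(Ω)` -/

/-- Smooth functions with compact support in `Ω`. -/
def IsTestFunction (Ω : Set Plane) (φ : Plane → ℝ) : Prop :=
  ContDiff ℝ ∞ φ ∧ HasCompactSupport φ ∧ tsupport φ ⊆ Ω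

/-- `g` is the weak gradient of `u` on `Ω`. -/
def HasWeakGradient (Ω : Set Plane) (u : Plane → ℝ) (g : Plane → Plane) : Prop :=
  ∀ φ : Plane → ℝ, IsTestFunction Ω φ → ∀ i : Fin 2,
    ∫ x in Ω, u x * fderiv ℝ φ x (unitVec i) = - ∫ x in Ω, g x i * φ x

/-- `u ∈ H¹₀(Ω)`: `u` lies in `H¹(Ω)` (it is square integrable with a square integrable weak
gradient `g`) and in the closure of the test functions for the `H¹(Ω)` norm. -/
def MemH10 (Ω : Set Plane) (u : Plane → ℝ) : Prop :=
  ∃ g : Plane → Plane,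
    MemLp u 2 (volume.restrict Ω) ∧ MemLp g 2 (volume.restrict Ω) ∧ HasWeakGradient Ω u g ∧
    ∀ ε : ℝ≥0∞, 0 < ε → ∃ φ : Plane → ℝ, IsTestFunction Ω φ ∧
      eLpNorm (fun x => u x - φ x) 2 (volume.restrict Ω) ^ 2
        + eLpNorm (fun x => g x - gradient φ x) 2 (volume.restrict Ω) ^ 2 < ε ^ 2

/-! ### Triangulations -/

/-- The closed triangle with the given vertices. -/
def hull (K : Finset Plane) : Set Plane := convexHull ℝ (K : Set Plane)

/-- A conforming triangulation of `Ω` into closed (nondegenerate) triangles. A triangle is given by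
the set of its three vertices. Conformity: the triangles `K`, `L` meet exactly in the hull of their
common vertices, i.e. for `K ≠ L` in the empty set, in a common vertex or in a common edge. -/
structure Triangulation (Ω : Set Plane) where
  cells : Finset (Finset Plane)
  card_eq : ∀ K ∈ cells, K.card = 3
  indep : ∀ K ∈ cells, AffineIndependent ℝ ((↑) : K → Plane)
  conforming : ∀ K ∈ cells, ∀ L ∈ cells,
    hull K ∩ hull L = convexHull ℝ ((K : Set Plane) ∩ (L : Set Plane))
  iUnion_eq : ⋃ K ∈ cells, hull K = closure Ω

/-- The diameter `ρ_K` of the largest ball inscribed in a triangle. -/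
def inscribedDiam (K : Finset Plane) : ℝ :=
  sSup {d : ℝ | 0 ≤ d ∧ ∃ c : Plane, Metric.closedBall c (d / 2) ⊆ hull K}

/-- The boundary value at `z` of a function given on the interior of `K`. If the function is a
polynomial there, this is the value at `z` of this polynomial. -/
def traceAt (q : Plane → ℝ) (K : Finset Plane) (z : Plane) : ℝ :=
  limUnder (𝓝[interior (hull K)] z) q

/-- The signed area `det (a, b)` of two vectors. -/
def cross (a b : Plane) : ℝ := a 0 * b 1 - a 1 * b 0

namespace Triangulation

variable {Ω : Set Plane}

/-- The shape-regularity constant, the maximum of `h_K / ρ_K` over all triangles. -/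
def shapeRegularity (T : Triangulation Ω) : ℝ :=
  ⨆ K : T.cells, Metric.diam (hull K.1) / inscribedDiam K.1

open Classical in
/-- The vertices of the triangulation. -/
def vertices (T : Triangulation Ω) : Finset Plane := T.cells.biUnion id

open Classical in
/-- The triangles with vertex `z`. -/
def patch (T : Triangulation Ω) (z : Plane) : Finset (Finset Plane) :=
  T.cells.filter (fun K => z ∈ K)

/-- The number `N_z` of triangles with vertex `z`. -/
def patchCard (T : Triangulation Ω) (z : Plane) : ℕ := (T.patch z).card

open Classical in
/-- A counterclockwise numbering of the triangles with vertex `z`: the triangle with (zero-based)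
number `j < N_z` has the vertices `z`, `p j`, `p (j + 1)` in counterclockwise order. Hence
triangles with successive numbers share the edge from `z` to `p (j + 1)`, and for an interior
vertex the last triangle shares an edge with the first. -/
structure Numbering (T : Triangulation Ω) (z : Plane) where
  p : ℕ → Plane
  bijOn : Set.BijOn (fun j => ({z, p j, p (j + 1)} : Finset Plane))
    {j | j < T.patchCard z} (T.patch z : Set (Finset Plane))
  ccw : ∀ j < T.patchCard z, 0 < cross (p j - z) (p (j + 1) - z)
  closed : z ∈ Ω → p (T.patchCard z) = p 0

namespace Numbering

variable {T : Triangulation Ω} {z : Plane}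

open Classical in
/-- The triangle with zero-based number `j`. -/
def cell (ν : T.Numbering z) (j : ℕ) : Finset Plane := {z, ν.p j, ν.p (j + 1)}

/-- The angle at `z` in the triangle with zero-based number `j`. -/
def theta (ν : T.Numbering z) (j : ℕ) : ℝ := EuclideanGeometry.angle (ν.p j) z (ν.p (j + 1))

/-- The angle at the boundary vertex `z` seen from the exterior of the domain. -/
def outerAngle (ν : T.Numbering z) : ℝ :=
  2 * Real.pi - ∑ j ∈ Finset.range (T.patchCard z), ν.theta j

open Classical in
/-- The local measure of singularity: the maximum of `|sin (θ + θ')|` over the pairs of angles at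
`z` in successive triangles, taken cyclically if `z` is an interior vertex. For a boundary vertex
with a single triangle it is the supremum over the empty family, which is `0`. -/
def singularity (ν : T.Numbering z) : ℝ :=
  if z ∈ Ω then
    ⨆ j : Fin (T.patchCard z), |Real.sin (ν.theta (j : ℕ) + ν.theta (((j : ℕ) + 1) % T.patchCard z))|
  else
    ⨆ j : Fin (T.patchCard z - 1), |Real.sin (ν.theta (j : ℕ) + ν.theta ((j : ℕ) + 1))|

/-- The functional `A_{T,z}`: the alternating sum of the values at `z`. With one-based numbers
`ℓ = j + 1` the signs are `(-1) ^ ℓ`. -/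
def altSum (ν : T.Numbering z) (q : Plane → ℝ) : ℝ :=
  ∑ j ∈ Finset.range (T.patchCard z), (-1 : ℝ) ^ (j + 1) * traceAt q (ν.cell j) z

end Numbering

/-- The minimal outer angle over all boundary vertices. -/
def minOuterAngle (T : Triangulation Ω) (ν : ∀ z : T.vertices, T.Numbering z) : ℝ :=
  ⨅ z : {z : T.vertices // (z : Plane) ∈ frontier Ω}, (ν z.1).outerAngle

/-- The set of `η`-critical vertices. -/
def critical (T : Triangulation Ω) (ν : ∀ z : T.vertices, T.Numbering z) (η : ℝ) :
    Set T.vertices :=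
  {z | (ν z).singularity ≤ η}

/-! ### Finite element spaces

Elements of `L²(Ω)` that are polynomial on each open triangle are represented by functions on the
plane that coincide with a polynomial everywhere on each open triangle. Their values elsewhere
(on the null set of all edges, and outside `Ω`) are irrelevant for everything below. -/

/-- Piecewise polynomials of degree at most `k`. -/
def piecewisePoly (T : Triangulation Ω) (k : ℕ) : Set (Plane → ℝ) :=
  {q | ∀ K ∈ T.cells, ∃ P : MvPolynomial (Fin 2) ℝ, P.totalDegree ≤ k ∧
    ∀ x ∈ interior (hull K), q x = MvPolynomial.eval (fun i => x i) P}

/-- The vector-valued space `S_{k,0}(T)²` with `S_{k,0}(T) = ℙ_k(T) ∩ H¹₀(Ω)`. -/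
def velocitySpace (T : Triangulation Ω) (k : ℕ) : Set (Plane → Plane) :=
  {v | ∀ i : Fin 2, (fun x => v x i) ∈ T.piecewisePoly k ∧ MemH10 Ω (fun x => v x i)}

/-- The space `M_{η,k}(T)` of pressures of degree at most `k`. -/
def pressureSpace (T : Triangulation Ω) (ν : ∀ z : T.vertices, T.Numbering z) (η : ℝ) (k : ℕ) :
    Set (Plane → ℝ) :=
  {q | q ∈ T.piecewisePoly k ∧ ∫ x in Ω, q x = 0 ∧ ∀ z ∈ T.critical ν η, (ν z).altSum q = 0}

end Triangulation

/-- The derivative `∂_j v_i`. For `v` in the velocity space this is the classical derivative of a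
polynomial on each open triangle, hence almost everywhere the weak derivative. -/
def partialDeriv (v : Plane → Plane) (i j : Fin 2) (x : Plane) : ℝ :=
  fderiv ℝ (fun y => v y i) x (unitVec j)

/-- The divergence. -/
def div (v : Plane → Plane) (x : Plane) : ℝ := ∑ i : Fin 2, partialDeriv v i i x

/-- The `L²(Ω)` norm. -/
def normL2 (Ω : Set Plane) (q : Plane → ℝ) : ℝ := Real.sqrt (∫ x in Ω, q x ^ 2)

/-- The `L²(Ω)` norm of the gradient of a vector field (with the Frobenius norm of matrices). -/
def normGradL2 (Ω : Set Plane) (v : Plane → Plane) : ℝ :=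
  Real.sqrt (∫ x in Ω, ∑ i : Fin 2, ∑ j : Fin 2, partialDeriv v i j x ^ 2)

/-- The space `X_η(T)` of all `v ∈ S_{k,0}(T)²` with `A_{T,z}(div v) = 0` for all vertices `z` that
are `η`-critical but not `0`-critical. -/
def Triangulation.wiredSpace {Ω : Set Plane} (T : Triangulation Ω)
    (ν : ∀ z : T.vertices, T.Numbering z) (η : ℝ) (k : ℕ) : Set (Plane → Plane) :=
  {v | v ∈ T.velocitySpace k ∧ ∀ z ∈ T.critical ν η \ T.critical ν 0, (ν z).altSum (div v) = 0}

end PressureWired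

end

/-!
The alternating sum of the divergence over the triangles at a nearly singular vertex is small, and
this is the only obstruction to using the divergence itself as a test function.

**The alternating sum.** Write the divergence at a vertex `z`, on each triangle of the patch, in
terms of the derivatives of `v` along the two edges at `z` (`div_eq_cross`). A field in the velocity
space has equal traces on both sides of an inner edge and vanishing trace on a boundary edge
(`Triangulation.trace_eq_on_edge`, a consequence of the weak differentiability of the extension by
zero). So the two contributions of an inner edge to the alternating sum come from the same
derivative, and their difference is that derivative times `sin (θ + θ')` times a factor controlled
by the shape regularity (`abs_edge_term_le`). At an interior vertex the signs match for the last
and the first triangle only if the number of triangles is even, and this holds as soon as `η` is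
small (`even_of_closed_chain`). The result is `Triangulation.Numbering.abs_altSum_div_le`; with
`η = 0` it shows that the alternating sum vanishes at exactly singular vertices.

**The bubbles.** For each `η`-critical vertex `z` there is a polynomial of degree `k - 1` on one
triangle of the patch which has mean zero, vanishes at the other vertices, has alternating sum one
at `z`, and whose `L²` norm is of the order `area ^ (1/2) / k ^ 2`
(`Triangulation.exists_vertex_bubble`). It is built from the reproducing kernel for the value at `0`
of polynomials on the unit interval with weight `r` (`exists_reproducing_poly`). The same kernel
gives the inverse inequality `Triangulation.cross_mul_sq_jacNorm_le` for point values, with the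
matching power of `k`, so that the final constant does not depend on `k`.

**The estimate.** The divergence minus the bubbles with the coefficients `A_z (div v)` is an
admissible pressure. Hence the square of the norm of `div v` is its product with the sum of the
bubbles; as each triangle carries at most three of them, it is bounded by the squares of
`A_z (div v)` times those of the norms of the bubbles (`Triangulation.integral_sq_div_le`). For `w`
in the wired space, `A_z (div v) = A_z (div (v - w))` unless `z` is exactly singular, where
`A_z (div v) = 0`. The alternating sum estimate and the inverse inequality bound the product at `z`
by the energy of `v - w` on the patch, and the patches overlap at most three times
(`Triangulation.normL2_div_le`). The minimum is attained because the gradients of the fields in the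
wired space form a finite-dimensional subspace of `L²(Ω)`
(`Triangulation.exists_isLeast_normGradL2`).
-/

noncomputable section

namespace PressureWired

/-! ### Extremal polynomials on the unit interval with weight `r` -/

/-- The value at `0` of the reproducing kernel `R` of polynomials of degree at most `m`, see
`exists_reproducing_poly`. -/
def kernelConst (m : ℕ) : ℝ := (((m : ℝ) + 1) * (m + 2)) ^ 2 / 2

/-- The polynomial `R` that reproduces the value at `0` in the weighted space `L²((0,1), r dr)`.
Its coefficients `ρ i` have to satisfy `∑ i, ρ i / (i + j + 2) = δ_{j0}` for `j ≤ m`; they are the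
residues in the partial fraction decomposition of the rational function of `j` with zeros
`1, …, m`, poles `-2, …, -(m + 2)` and value `1` at `0`. -/
theorem exists_reproducing_poly (m : ℕ) : ∃ R : Polynomial ℝ, R.natDegree ≤ m ∧
    R.eval 0 = kernelConst m ∧ ∀ P : Polynomial ℝ, P.natDegree ≤ m →
      ∫ r in (0 : ℝ)..1, P.eval r * R.eval r * r = P.eval 0 := by
  classical
  set s := Finset.range (m + 1) with hs
  set x : ℕ → ℝ := fun i => -((i : ℝ) + 2) with hx
  have hinj : Set.InjOn x s := by
    intro i _ j _ h
    simp only [hx] at h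
    exact_mod_cast (by linarith : (i : ℝ) = j)
  have hfac1 : ∀ n : ℕ, ∏ l ∈ Finset.range n, (0 - ((l : ℝ) + 1))
      = (-1) ^ n * (n.factorial : ℝ) := by
    intro n
    induction n with
    | zero => simp
    | succ n ih => rw [Finset.prod_range_succ, ih, Nat.factorial_succ]; push_cast; ring
  have hfac2 : ∀ n : ℕ, ∏ l ∈ Finset.range n, (0 - x l) = ((n + 1).factorial : ℝ) := by
    intro n
    induction n with
    | zero => simp
    | succ n ih =>
      rw [Finset.prod_range_succ, ih, Nat.factorial_succ (n + 1)]; simp only [hx]; push_cast; ring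
  have hfac3 : ∀ n : ℕ, ∏ l ∈ Finset.range n, (-2 - ((l : ℝ) + 1))
      = (-1) ^ n * ((n + 2).factorial : ℝ) / 2 := by
    intro n
    induction n with
    | zero => simp
    | succ n ih => rw [Finset.prod_range_succ, ih, Nat.factorial_succ (n + 2)]; push_cast; ring
  have hm0 : (m.factorial : ℝ) ≠ 0 := by exact_mod_cast m.factorial_ne_zero
  have hm1 : (-1 : ℝ) ^ m * (-1) ^ m = 1 := by rw [← mul_pow]; simp
  set κ : ℝ := (-1) ^ m * ((m + 2).factorial : ℝ) / m.factorial with hκ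
  -- the rational function is `N / nodal s x`, and Lagrange interpolation of `N` at the poles is its
  -- partial fraction decomposition
  set N : Polynomial ℝ := Polynomial.C κ * ∏ l ∈ Finset.range m,
      (Polynomial.X - Polynomial.C ((l : ℝ) + 1))
    with hN
  have hNev : ∀ t, N.eval t = κ * ∏ l ∈ Finset.range m, (t - ((l : ℝ) + 1)) := by
    intro t
    simp [hN, Polynomial.eval_prod]
  have hNdeg : N.degree < s.card := by
    have h1 : N.degree ≤ (m : ℕ) := by
      refine Polynomial.degree_le_of_natDegree_le ?_
      refine (Polynomial.natDegree_C_mul_le _ _).trans ?_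
      refine (Polynomial.natDegree_prod_le _ _).trans ?_
      simp only [Polynomial.natDegree_X_sub_C, Finset.sum_const, Finset.card_range, smul_eq_mul,
        mul_one, le_refl]
    refine h1.trans_lt ?_
    simp only [hs, Finset.card_range]
    exact_mod_cast Nat.lt_succ_self m
  have hint := Lagrange.eq_interpolate_of_eval_eq (r := fun i => N.eval (x i)) (f := N) hinj hNdeg
    (fun i _ => rfl)
  -- the residues
  set ρ : ℕ → ℝ := fun i => Lagrange.nodalWeight s x i * N.eval (x i) with hρ
  have hsum : ∀ j ∈ Finset.range (m + 1), ∑ i ∈ s, ρ i / ((i : ℝ) + j + 2)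
     = if j = 0 then 1 else 0 := by
    intro j hj
    have hne : ∀ i ∈ s, (j : ℝ) ≠ x i := by
      intro i _
      simp only [hx]
      have h1 : (0 : ℝ) ≤ i := Nat.cast_nonneg i
      have h2 : (0 : ℝ) ≤ j := Nat.cast_nonneg j
      linarith
    have h1 := Lagrange.eval_interpolate_not_at_node (fun i => N.eval (x i)) hne
    rw [← hint] at h1
    have h2 : ∑ i ∈ s, ρ i / ((i : ℝ) + j + 2)
        = ∑ i ∈ s, Lagrange.nodalWeight s x i * ((j : ℝ) - x i)⁻¹ * N.eval (x i) := by
      refine Finset.sum_congr rfl fun i _ => ?_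
      simp only [hρ, hx, div_eq_mul_inv]
      rw [show (j : ℝ) - -((i : ℝ) + 2) = i + j + 2 by ring]
      ring
    have h3 : (Lagrange.nodal s x).eval (j : ℝ) ≠ 0 := by
      rw [Lagrange.eval_nodal]
      exact Finset.prod_ne_zero_iff.2 fun i hi => sub_ne_zero.2 (hne i hi)
    rw [h2]
    rw [eq_comm, mul_comm] at h1
    rw [eq_div_of_mul_eq h3 h1, hNev]
    rcases Nat.eq_zero_or_pos j with rfl | hj0
    · rw [if_pos rfl, Lagrange.eval_nodal]
      have := hfac2 (m + 1)
      rw [← hs] at this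
      rw [Nat.cast_zero, this, hfac1, hκ]
      have h5 : ((m + 1 + 1).factorial : ℝ) ≠ 0 := by exact_mod_cast Nat.factorial_ne_zero _
      rw [div_eq_one_iff_eq h5]
      field_simp
      linear_combination hm1
    · rw [if_neg hj0.ne', Finset.prod_eq_zero (i := j - 1), mul_zero, zero_div]
      · rw [Finset.mem_range] at hj ⊢; omega
      · rw [Nat.cast_sub hj0]; simp
  -- integrating `r ^ (i + j + 1)` turns the linear system for `ρ` into the reproducing property
  refine ⟨∑ i ∈ s, Polynomial.C (ρ i) * Polynomial.X ^ i, ?_, ?_, ?_⟩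
  · refine Polynomial.natDegree_sum_le_of_forall_le _ _ fun i hi => ?_
    refine (Polynomial.natDegree_C_mul_X_pow_le _ _).trans ?_
    exact Nat.lt_succ_iff.1 (Finset.mem_range.1 hi)
  · have h0 : Lagrange.nodalWeight s x 0 = ((m.factorial : ℝ))⁻¹ := by
      have h1 : s.erase 0 = (Finset.range m).image (fun i => i + 1) := by
        ext i
        simp only [hs, Finset.mem_erase, Finset.mem_range, Finset.mem_image]
        constructor
        · rintro ⟨h1, h2⟩; exact ⟨i - 1, by omega, by omega⟩
        · rintro ⟨l, h1, rfl⟩; omega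
      rw [Lagrange.nodalWeight, h1, Finset.prod_image (by intro a _ b _ h; simpa using h),
        Finset.prod_inv_distrib]
      congr 1
      rw [← Finset.prod_range_add_one_eq_factorial]
      push_cast
      refine Finset.prod_congr rfl fun i _ => ?_
      simp only [hx]
      push_cast
      ring
    simp only [Polynomial.eval_finsetSum, Polynomial.eval_mul, Polynomial.eval_C,
      Polynomial.eval_pow, Polynomial.eval_X]
    rw [Finset.sum_eq_single 0]
    · simp only [hρ, h0, pow_zero, mul_one]
      rw [hNev, show x 0 = -2 by simp [hx], hfac3, hκ, kernelConst]
      have h5 : ((m + 2).factorial : ℝ) = (m + 2) * (m + 1) * m.factorial := by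
        rw [Nat.factorial_succ, Nat.factorial_succ]; push_cast; ring
      rw [h5]
      field_simp
      linear_combination hm1
    · intro i _ hi; simp [hi]
    · intro h; exact absurd (Finset.mem_range.2 (Nat.succ_pos m)) h
  · intro P hP
    have h1 : ∀ r : ℝ, P.eval r * (∑ i ∈ s, Polynomial.C (ρ i) * Polynomial.X ^ i).eval r * r
        = ∑ j ∈ Finset.range (m + 1), ∑ i ∈ s, P.coeff j * ρ i * r ^ (i + j + 1) := by
      intro r
      rw [Polynomial.eval_eq_sum_range' (Nat.lt_succ_of_le hP)]
      simp only [Polynomial.eval_finsetSum, Polynomial.eval_mul, Polynomial.eval_C,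
        Polynomial.eval_pow, Polynomial.eval_X]
      rw [Finset.sum_mul_sum, Finset.sum_mul]
      refine Finset.sum_congr rfl fun j _ => ?_
      rw [Finset.sum_mul]
      refine Finset.sum_congr rfl fun i _ => ?_
      ring
    simp_rw [h1]
    rw [intervalIntegral.integral_finsetSum
      (fun j _ => Continuous.intervalIntegrable (by fun_prop) _ _)]
    have h2 : ∀ j ∈ Finset.range (m + 1),
        ∫ r in (0 : ℝ)..1, ∑ i ∈ s, P.coeff j * ρ i * r ^ (i + j + 1)
          = P.coeff j * if j = 0 then 1 else 0 := by
      intro j hj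
      rw [intervalIntegral.integral_finsetSum
        (fun j _ => Continuous.intervalIntegrable (by fun_prop) _ _), ← hsum j hj, Finset.mul_sum]
      refine Finset.sum_congr rfl fun i _ => ?_
      rw [intervalIntegral.integral_const_mul, integral_pow]
      push_cast
      simp
      ring
    rw [Finset.sum_congr rfl h2]
    simp [Polynomial.coeff_zero_eq_eval_zero]

theorem kernelConst_pos (m : ℕ) : 0 < kernelConst m := by
  unfold kernelConst; positivity

/-- The inverse inequality for the value at an end point: the constant is the square of the
weighted norm of the reproducing polynomial. -/
theorem sq_eval_zero_le (n : ℕ) (P : Polynomial ℝ) (hP : P.natDegree ≤ n) :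
    P.eval 0 ^ 2 ≤ kernelConst n * ∫ r in (0 : ℝ)..1, P.eval r ^ 2 * r := by
  obtain ⟨R, hR, hR0, hRP⟩ := exists_reproducing_poly n
  set c := kernelConst n
  have hc : 0 < c := kernelConst_pos n
  -- the Cauchy-Schwarz inequality for `P` and `R`
  have h1 : ∫ r in (0 : ℝ)..1, (c * P.eval r - P.eval 0 * R.eval r) ^ 2 * r
      = c ^ 2 * (∫ r in (0 : ℝ)..1, P.eval r ^ 2 * r) - c * P.eval 0 ^ 2 := by
    have : ∀ r : ℝ, (c * P.eval r - P.eval 0 * R.eval r) ^ 2 * r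
        = c ^ 2 * (P.eval r ^ 2 * r) + (-(2 * c * P.eval 0) * (P.eval r * R.eval r * r)
          + P.eval 0 ^ 2 * (R.eval r * R.eval r * r)) := by intro r; ring
    simp_rw [this]
    rw [intervalIntegral.integral_add (Continuous.intervalIntegrable (by fun_prop) _ _)
      (Continuous.intervalIntegrable (by fun_prop) _ _),
      intervalIntegral.integral_add (Continuous.intervalIntegrable (by fun_prop) _ _)
      (Continuous.intervalIntegrable (by fun_prop) _ _)]
    simp only [intervalIntegral.integral_const_mul]
    rw [hRP P hP, hRP R hR, hR0]
    ring
  have h2 : 0 ≤ ∫ r in (0 : ℝ)..1, (c * P.eval r - P.eval 0 * R.eval r) ^ 2 * r :=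
    intervalIntegral.integral_nonneg zero_le_one fun r hr => mul_nonneg (sq_nonneg _) hr.1
  rw [h1] at h2
  nlinarith

/-- A polynomial of degree at most `n` with value `1` at `0`, value `0` at `1` and weighted mean
zero, whose weighted norm has the minimal order `n⁻²`: the factor `1 - r` times a normalized
difference of two reproducing polynomials, both of which have the same weighted integral against
`1 - r`. The factor `1 - r` gives the zero at `1` and does not increase the norm. -/
theorem exists_bubble_poly (n : ℕ) (hn : 3 ≤ n) : ∃ Q : Polynomial ℝ, Q.natDegree ≤ n ∧
    Q.eval 0 = 1 ∧ Q.eval 1 = 0 ∧ ∫ r in (0 : ℝ)..1, Q.eval r * r = 0 ∧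
    kernelConst n * ∫ r in (0 : ℝ)..1, Q.eval r ^ 2 * r ≤ 4 := by
  obtain ⟨R, hR, hR0, hRP⟩ := exists_reproducing_poly (n - 1)
  obtain ⟨S, hS, hS0, hSP⟩ := exists_reproducing_poly 1
  set c := kernelConst (n - 1) with hc
  set c₁ := kernelConst 1 with hc₁
  obtain ⟨m, rfl⟩ : ∃ m, n = m + 3 := ⟨n - 3, by omega⟩
  have hcval : c = (((m : ℝ) + 3) * (m + 4)) ^ 2 / 2 := by
    rw [hc, kernelConst]; simp only [show m + 3 - 1 = m + 2 by omega]; push_cast; ring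
  have hc₁val : c₁ = 18 := by rw [hc₁, kernelConst]; norm_num
  have hm : (0 : ℝ) ≤ m := Nat.cast_nonneg m
  have hratio : kernelConst (m + 3) ≤ 4 * (c - c₁) := by
    rw [hcval, hc₁val, kernelConst]; push_cast; nlinarith [pow_nonneg hm 2, pow_nonneg hm 3,
        pow_nonneg hm 4]
  have hpos : 0 < c - c₁ := by linarith [kernelConst_pos (m + 3)]
  set g := R - S with hg
  set L : Polynomial ℝ := 1 - Polynomial.X with hL
  have hLdeg : L.natDegree ≤ 1 := by
    rw [hL]; compute_degree
  have hgdeg : g.natDegree ≤ m + 3 - 1 :=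
    (Polynomial.natDegree_sub_le _ _).trans (max_le hR (hS.trans (by omega)))
  -- both parts of `g` reproduce the value at `0` of affine functions
  have hgP : ∀ P : Polynomial ℝ, P.natDegree ≤ 1 →
      ∫ r in (0 : ℝ)..1, P.eval r * g.eval r * r = 0 := by
    intro P hP
    have : ∀ r : ℝ, P.eval r * g.eval r * r
        = P.eval r * R.eval r * r - P.eval r * S.eval r * r := by
      intro r; simp only [hg, Polynomial.eval_sub]; ring
    simp_rw [this]
    rw [intervalIntegral.integral_sub (Continuous.intervalIntegrable (by fun_prop) _ _)
      (Continuous.intervalIntegrable (by fun_prop) _ _), hRP P (hP.trans (by omega)), hSP P hP,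
      sub_self]
  have hgg : ∫ r in (0 : ℝ)..1, g.eval r ^ 2 * r = c - c₁ := by
    have : ∀ r : ℝ, g.eval r ^ 2 * r = g.eval r * R.eval r * r - S.eval r * g.eval r * r := by
      intro r; simp only [hg, Polynomial.eval_sub]; ring
    simp_rw [this]
    rw [intervalIntegral.integral_sub (Continuous.intervalIntegrable (by fun_prop) _ _)
      (Continuous.intervalIntegrable (by fun_prop) _ _), hRP g hgdeg, hgP S hS, hg]
    simp [hR0, hS0]
  refine ⟨Polynomial.C (c - c₁)⁻¹ * (L * g), ?_, ?_, ?_, ?_, ?_⟩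
  · refine (Polynomial.natDegree_C_mul_le _ _).trans (Polynomial.natDegree_mul_le.trans ?_)
    omega
  · simp [hL, hg, hR0, hS0, inv_mul_cancel₀ hpos.ne']
  · simp [hL]
  · have : ∀ r : ℝ, (Polynomial.C (c - c₁)⁻¹ * (L * g)).eval r * r
        = (c - c₁)⁻¹ * (L.eval r * g.eval r * r) := by intro r; simp; ring
    simp_rw [this]
    rw [intervalIntegral.integral_const_mul, hgP L hLdeg, mul_zero]
  · have h1 : ∫ r in (0 : ℝ)..1, (Polynomial.C (c - c₁)⁻¹ * (L * g)).eval r ^ 2 * r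
        ≤ ∫ r in (0 : ℝ)..1, (c - c₁)⁻¹ ^ 2 * (g.eval r ^ 2 * r) := by
      refine intervalIntegral.integral_mono_on zero_le_one
        (Continuous.intervalIntegrable (by fun_prop) _ _)
        (Continuous.intervalIntegrable (by fun_prop) _ _) fun r hr => ?_
      have h2 : (1 - r) ^ 2 ≤ 1 := by nlinarith [hr.1, hr.2]
      simp only [hL, Polynomial.eval_mul, Polynomial.eval_C, Polynomial.eval_sub,
        Polynomial.eval_one, Polynomial.eval_X]
      have h3 : 0 ≤ (c - c₁)⁻¹ ^ 2 * (g.eval r ^ 2 * r) := by have := hr.1; positivity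
      nlinarith
    rw [intervalIntegral.integral_const_mul, hgg] at h1
    calc kernelConst (m + 3) * ∫ r in (0 : ℝ)..1, (Polynomial.C (c - c₁)⁻¹ * (L * g)).eval r ^ 2 * r
        ≤ 4 * (c - c₁) * ((c - c₁)⁻¹ ^ 2 * (c - c₁)) := by
          refine mul_le_mul hratio h1 ?_ (by positivity)
          exact intervalIntegral.integral_nonneg zero_le_one
            fun r hr => mul_nonneg (sq_nonneg _) hr.1
      _ = 4 := by field_simp

/-! ### Vectors and triangles in the plane -/

theorem cross_decomp (a b x : Plane) : cross a b • x = cross x b • a + cross a x • b := by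
  ext i
  fin_cases i <;> simp [cross] <;> ring

theorem cross_add_left (a b c : Plane) : cross (a + b) c = cross a c + cross b c := by
  simp only [cross, PiLp.add_apply]; ring

theorem cross_add_right (a b c : Plane) : cross a (b + c) = cross a b + cross a c := by
  simp only [cross, PiLp.add_apply]; ring

theorem cross_smul_left (r : ℝ) (a b : Plane) : cross (r • a) b = r * cross a b := by
  simp only [cross, PiLp.smul_apply, smul_eq_mul]; ring

theorem cross_smul_right (r : ℝ) (a b : Plane) : cross a (r • b) = r * cross a b := by
  simp only [cross, PiLp.smul_apply, smul_eq_mul]; ring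

theorem cross_self (a : Plane) : cross a a = 0 := by simp only [cross]; ring

theorem cross_swap (a b : Plane) : cross a b = -cross b a := by simp only [cross]; ring

@[fun_prop]
theorem continuous_cross {X : Type*} [TopologicalSpace X] {f g : X → Plane} (hf : Continuous f)
    (hg : Continuous g) : Continuous fun x => cross (f x) (g x) := by
  unfold PressureWired.cross; fun_prop

theorem norm_sq_plane (a : Plane) : ‖a‖ ^ 2 = a 0 ^ 2 + a 1 ^ 2 := by
  rw [EuclideanSpace.real_norm_sq_eq, Fin.sum_univ_two]

theorem inner_plane (a b : Plane) : inner ℝ a b = a 0 * b 0 + a 1 * b 1 := by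
  simp [PiLp.inner_apply, Fin.sum_univ_two]; ring

theorem abs_cross_le (a b : Plane) : |cross a b| ≤ ‖a‖ * ‖b‖ := by
  refine abs_le_of_sq_le_sq ?_ (by positivity)
  rw [mul_pow, norm_sq_plane, norm_sq_plane]
  simp only [cross]
  nlinarith [sq_nonneg (a 0 * b 0 + a 1 * b 1)]

/-- The quarter turn. -/
def rot (a : Plane) : Plane := !₂[-a 1, a 0]

theorem norm_rot (a : Plane) : ‖rot a‖ = ‖a‖ := by
  have : ‖rot a‖ ^ 2 = ‖a‖ ^ 2 := by
    rw [norm_sq_plane, norm_sq_plane]; simp [rot]; ring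
  exact (sq_eq_sq₀ (norm_nonneg _) (norm_nonneg _)).1 this

theorem cross_rot (a : Plane) : cross a (rot a) = ‖a‖ ^ 2 := by
  rw [norm_sq_plane]; simp [rot, cross]; ring

theorem ne_zero_of_cross_pos {a b : Plane} (h : 0 < cross a b) : a ≠ 0 ∧ b ≠ 0 := by
  constructor <;> rintro rfl <;> simp [cross] at h

theorem sin_angle_mul {a b : Plane} (h : 0 < cross a b) :
    Real.sin (InnerProductGeometry.angle a b) * (‖a‖ * ‖b‖) = cross a b := by
  rw [InnerProductGeometry.sin_angle_mul_norm_mul_norm]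
  rw [show inner ℝ a a * inner ℝ b b - inner ℝ a b * inner ℝ a b = cross a b ^ 2 by
    simp only [inner_plane, cross]; ring]
  exact Real.sqrt_sq h.le

theorem cos_angle_mul (a b : Plane) :
    Real.cos (InnerProductGeometry.angle a b) * (‖a‖ * ‖b‖) = a 0 * b 0 + a 1 * b 1 := by
  rw [InnerProductGeometry.cos_angle_mul_norm_mul_norm, inner_plane]

/-- The angles of two successive sectors add up. -/
theorem sin_angle_add_mul {a b c : Plane} (hab : 0 < cross a b) (hbc : 0 < cross b c) :
    Real.sin (InnerProductGeometry.angle a b + InnerProductGeometry.angle b c) * (‖a‖ * ‖c‖)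
      = cross a c := by
  have hb : ‖b‖ ^ 2 ≠ 0 := by simpa using (ne_zero_of_cross_pos hab).2
  have h1 := sin_angle_mul hab
  have h2 := sin_angle_mul hbc
  have h3 := cos_angle_mul a b
  have h4 := cos_angle_mul b c
  have h5 : cross a c * ‖b‖ ^ 2
      = cross a b * (b 0 * c 0 + b 1 * c 1) + (a 0 * b 0 + a 1 * b 1) * cross b c := by
    rw [norm_sq_plane]; simp only [cross]; ring
  apply mul_right_cancel₀ hb
  rw [h5, Real.sin_add, ← h1, ← h2, ← h3, ← h4]
  ring

theorem cos_angle_add_mul {a b c : Plane} (hab : 0 < cross a b) (hbc : 0 < cross b c) :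
    Real.cos (InnerProductGeometry.angle a b + InnerProductGeometry.angle b c) * (‖a‖ * ‖c‖)
      = a 0 * c 0 + a 1 * c 1 := by
  have hb : ‖b‖ ^ 2 ≠ 0 := by simpa using (ne_zero_of_cross_pos hab).2
  have h1 := sin_angle_mul hab
  have h2 := sin_angle_mul hbc
  have h3 := cos_angle_mul a b
  have h4 := cos_angle_mul b c
  have h5 : (a 0 * c 0 + a 1 * c 1) * ‖b‖ ^ 2
      = (a 0 * b 0 + a 1 * b 1) * (b 0 * c 0 + b 1 * c 1) - cross a b * cross b c := by
    rw [norm_sq_plane]; simp only [cross]; ring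
  apply mul_right_cancel₀ hb
  rw [h5, Real.cos_add, ← h1, ← h2, ← h3, ← h4]
  ring

/-- If the angles of two successive sectors are bounded away from `0` and `π` and the sine of their
sum is small, then their sum is close to `π`: the outer rays point in nearly opposite
directions. -/
theorem norm_unit_add_le {a b c : Plane} (hab : 0 < cross a b) (hbc : 0 < cross b c) {s η : ℝ}
    (hs : η < s) (hbs : s ≤ Real.sin (InnerProductGeometry.angle b c))
    (hη : |Real.sin (InnerProductGeometry.angle a b + InnerProductGeometry.angle b c)| ≤ η) :
    ‖‖c‖⁻¹ • c + ‖a‖⁻¹ • a‖ ≤ 2 * η := by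
  set α := InnerProductGeometry.angle a b
  set β := InnerProductGeometry.angle b c
  have ha : 0 < ‖a‖ := norm_pos_iff.2 (ne_zero_of_cross_pos hab).1
  have hb : 0 < ‖b‖ := norm_pos_iff.2 (ne_zero_of_cross_pos hab).2
  have hc : 0 < ‖c‖ := norm_pos_iff.2 (ne_zero_of_cross_pos hbc).2
  have hη0 : 0 ≤ η := (abs_nonneg _).trans hη
  have hsα : 0 < Real.sin α := by
    have := sin_angle_mul hab
    by_contra hneg
    push Not at hneg
    have : Real.sin α * (‖a‖ * ‖b‖) ≤ 0 := mul_nonpos_of_nonpos_of_nonneg hneg (by positivity)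
    linarith
  -- otherwise `sin β = cos α * sin (α + β) - sin α * cos (α + β)` would be at most `η`
  have hcos : Real.cos (α + β) < 0 := by
    have h1 : Real.sin α * Real.cos (α + β) = Real.cos α * Real.sin (α + β) - Real.sin β := by
      have := Real.sin_sub (α + β) α
      rw [add_sub_cancel_left] at this
      linarith
    have h2 : Real.cos α * Real.sin (α + β) ≤ η := by
      refine (le_abs_self _).trans ?_
      rw [abs_mul]
      calc |Real.cos α| * |Real.sin (α + β)| ≤ 1 * η :=
            mul_le_mul (Real.abs_cos_le_one _) hη (abs_nonneg _) zero_le_one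
        _ = η := one_mul _
    by_contra hneg
    push Not at hneg
    nlinarith [mul_nonneg hsα.le hneg]
  have hsq : Real.sin (α + β) ^ 2 ≤ η ^ 2 := by
    rw [← sq_abs]; exact pow_le_pow_left₀ (abs_nonneg _) hη 2
  have h1 : ‖‖c‖⁻¹ • c + ‖a‖⁻¹ • a‖ ^ 2 = 2 + 2 * Real.cos (α + β) := by
    have h2 := cos_angle_add_mul hab hbc
    have h3 : Real.cos (α + β) = (a 0 * c 0 + a 1 * c 1) / (‖a‖ * ‖c‖) := by
      rw [← h2]; field_simp; rfl
    have h4 := norm_sq_plane a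
    have h5 := norm_sq_plane c
    rw [h3, norm_sq_plane]
    simp only [PiLp.add_apply, PiLp.smul_apply, smul_eq_mul]
    field_simp
    linear_combination (-‖c‖ ^ 2) * h4 - ‖a‖ ^ 2 * h5
  refine abs_le_of_sq_le_sq' ?_ (by positivity) |>.2
  rw [h1]
  nlinarith [Real.sin_sq_add_cos_sq (α + β), Real.neg_one_le_cos (α + β)]

/-- The difference of the two divergence terms that belong to the edge `b` shared by two sectors,
where `w` is the derivative along this edge. The factor `cross a c` is small if the outer rays of
the two sectors are nearly parallel. -/
theorem cross_div_sub_cross_div {a b c : Plane} (hab : 0 < cross a b) (hbc : 0 < cross b c)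
    (w : Plane) :
    cross w c / cross b c - cross a w / cross a b
      = cross a c * cross w b / (cross a b * cross b c) := by
  field_simp
  simp only [cross]; ring

/-- The size of an edge term in units of the Jacobian, for which `F` stands. -/
theorem abs_edge_term_le {a b c : Plane} (hab : 0 < cross a b) (hbc : 0 < cross b c)
    {w : Plane} {γ F : ℝ} (h₁ : ‖a‖ * ‖b‖ ≤ γ * cross a b) (h₂ : ‖b‖ * ‖c‖ ≤ γ * cross b c)
    (hw : ‖w‖ ≤ F * ‖b‖) :
    |cross w c / cross b c - cross a w / cross a b|
      ≤ |Real.sin (InnerProductGeometry.angle a b + InnerProductGeometry.angle b c)|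
          * (γ ^ 2 * F) := by
  have ha : 0 < ‖a‖ := norm_pos_iff.2 (ne_zero_of_cross_pos hab).1
  have hb : 0 < ‖b‖ := norm_pos_iff.2 (ne_zero_of_cross_pos hab).2
  have hc : 0 < ‖c‖ := norm_pos_iff.2 (ne_zero_of_cross_pos hbc).2
  have hF : 0 ≤ F := nonneg_of_mul_nonneg_left ((norm_nonneg w).trans hw) hb
  have hγ : 0 < γ := by
    by_contra hneg
    push Not at hneg
    have := mul_nonpos_of_nonpos_of_nonneg hneg hab.le
    nlinarith [mul_pos ha hb]
  rw [cross_div_sub_cross_div hab hbc, ← sin_angle_add_mul hab hbc, abs_div, abs_mul, abs_mul,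
    abs_of_pos (mul_pos hab hbc), mul_assoc, mul_div_assoc, abs_of_pos (mul_pos ha hc)]
  refine mul_le_mul_of_nonneg_left ?_ (abs_nonneg _)
  rw [div_le_iff₀ (mul_pos hab hbc)]
  have h3 : |cross w b| ≤ F * ‖b‖ * ‖b‖ :=
    (abs_cross_le w b).trans (mul_le_mul_of_nonneg_right hw hb.le)
  calc ‖a‖ * ‖c‖ * |cross w b| ≤ ‖a‖ * ‖c‖ * (F * ‖b‖ * ‖b‖) := by gcongr
    _ = F * ((‖a‖ * ‖b‖) * (‖b‖ * ‖c‖)) := by ring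
    _ ≤ F * ((γ * cross a b) * (γ * cross b c)) := by gcongr
    _ = γ ^ 2 * F * (cross a b * cross b c) := by ring

open Classical in
/-- The closed triangle in terms of (unnormalized) barycentric coordinates. -/
theorem mem_hull_iff {z a b : Plane} (h : 0 < cross (a - z) (b - z)) (x : Plane) :
    x ∈ hull {z, a, b} ↔ 0 ≤ cross (a - z) (x - z) ∧ 0 ≤ cross (x - z) (b - z) ∧
      cross (a - z) (x - z) + cross (x - z) (b - z) ≤ cross (a - z) (b - z) := by
  have hcoe : (({z, a, b} : Finset Plane) : Set Plane) = {z, a, b} := by simp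
  rw [hull, hcoe]
  constructor
  · intro hx
    have hconv : Convex ℝ {x : Plane | 0 ≤ cross (a - z) (x - z) ∧ 0 ≤ cross (x - z) (b - z) ∧
        cross (a - z) (x - z) + cross (x - z) (b - z) ≤ cross (a - z) (b - z)} := by
      intro x hx y hy s t hs ht hst
      obtain ⟨h1, h2, h3⟩ := hx
      obtain ⟨h4, h5, h6⟩ := hy
      have e : s • x + t • y - z = s • (x - z) + t • (y - z) := by
        rw [eq_sub_of_add_eq hst]
        module
      simp only [Set.mem_ofPred_eq, e, cross_add_left, cross_add_right, cross_smul_left,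
        cross_smul_right]
      refine ⟨by positivity, by positivity, ?_⟩
      nlinarith [mul_le_mul_of_nonneg_left h3 hs, mul_le_mul_of_nonneg_left h6 ht]
    refine convexHull_min ?_ hconv hx
    rintro y (rfl | rfl | rfl)
    · simp [cross] at h ⊢; linarith
    · simp only [Set.mem_ofPred_eq, cross_self]; exact ⟨le_rfl, h.le, by linarith⟩
    · simp only [Set.mem_ofPred_eq, cross_self]; exact ⟨h.le, le_rfl, by linarith⟩
  · rintro ⟨h1, h2, h3⟩
    set D := cross (a - z) (b - z)
    set s := cross (x - z) (b - z) / D with hs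
    set t := cross (a - z) (x - z) / D with ht
    have hx : x = (1 - s - t) • z + s • a + t • b := by
      have h4 := cross_decomp (a - z) (b - z) (x - z)
      have h5 : x - z = s • (a - z) + t • (b - z) := by
        rw [hs, ht, div_eq_inv_mul, div_eq_inv_mul, mul_smul, mul_smul, ← smul_add, ← h4, smul_smul,
          inv_mul_cancel₀ h.ne', one_smul]
      rw [← sub_eq_zero] at h5 ⊢
      rw [← h5]; module
    have hs0 : 0 ≤ s := div_nonneg h2 h.le
    have ht0 : 0 ≤ t := div_nonneg h1 h.le
    have hst : s + t ≤ 1 := by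
      rw [hs, ht, ← add_div, div_le_one h]; linarith
    have := (convex_convexHull ℝ ({z, a, b} : Set Plane)).sum_mem (t := Finset.univ)
      (w := ![1 - s - t, s, t]) (z := ![z, a, b])
      (by intro i _; fin_cases i <;> simp <;> linarith) (by simp [Fin.sum_univ_three]; ring)
      (by intro i _; fin_cases i <;> apply subset_convexHull <;> simp)
    rw [hx]
    simpa [Fin.sum_univ_three] using this

/-- The open triangle with vertices `z`, `a`, `b`. -/
def openTri (z a b : Plane) : Set Plane :=
  {x | 0 < cross (a - z) (x - z) ∧ 0 < cross (x - z) (b - z) ∧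
    cross (a - z) (x - z) + cross (x - z) (b - z) < cross (a - z) (b - z)}

theorem isOpen_openTri (z a b : Plane) : IsOpen (openTri z a b) := by
  have h1 : IsOpen {x : Plane | 0 < cross (a - z) (x - z)} := isOpen_lt (by fun_prop) (by fun_prop)
  have h2 : IsOpen {x : Plane | 0 < cross (x - z) (b - z)} := isOpen_lt (by fun_prop) (by fun_prop)
  have h3 : IsOpen {x : Plane | cross (a - z) (x - z) + cross (x - z) (b - z)
      < cross (a - z) (b - z)} := isOpen_lt (by fun_prop) (by fun_prop)
  exact h1.inter (h2.inter h3)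

theorem exists_small_add_smul_mem {S : Set Plane} {x : Plane} (hx : x ∈ interior S) (v : Plane) :
    ∃ ε : ℝ, 0 < ε ∧ x + ε • v ∈ S := by
  have h1 : Tendsto (fun ε : ℝ => x + ε • v) (𝓝[>] 0) (𝓝 x) := by
    have : Continuous fun ε : ℝ => x + ε • v := by fun_prop
    simpa using (this.tendsto 0).mono_left nhdsWithin_le_nhds
  obtain ⟨ε, h2, h3⟩ := ((h1.eventually (mem_interior_iff_mem_nhds.1 hx)).and
    self_mem_nhdsWithin).exists
  exact ⟨ε, h3, h2⟩

open Classical in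
/-- Moving a point of the interior in the directions of the edges makes all three barycentric
coordinates strictly positive. -/
theorem interior_hull {z a b : Plane} (h : 0 < cross (a - z) (b - z)) :
    interior (hull {z, a, b}) = openTri z a b := by
  apply Set.Subset.antisymm
  · intro x hx
    have hmem := (mem_hull_iff h x).1 (interior_subset hx)
    have key : ∀ v, ∃ ε : ℝ, 0 < ε ∧ 0 ≤ cross (a - z) (x - z) + ε * cross (a - z) v ∧
        0 ≤ cross (x - z) (b - z) + ε * cross v (b - z) ∧
        cross (a - z) (x - z) + ε * cross (a - z) v + (cross (x - z) (b - z) + ε * cross v (b - z))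
          ≤ cross (a - z) (b - z) := by
      intro v
      obtain ⟨ε, h0, h1⟩ := exists_small_add_smul_mem hx v
      refine ⟨ε, h0, ?_⟩
      have := (mem_hull_iff h _).1 h1
      rwa [show x + ε • v - z = (x - z) + ε • v by module, cross_add_left, cross_add_right,
        cross_smul_left, cross_smul_right] at this
    refine ⟨?_, ?_, ?_⟩
    · obtain ⟨ε, h0, h1, -, -⟩ := key (-(b - z))
      have : cross (a - z) (-(b - z)) = -cross (a - z) (b - z) := by
          simp only [cross, PiLp.neg_apply]; ring
      rw [this] at h1
      nlinarith [mul_pos h0 h]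
    · obtain ⟨ε, h0, -, h1, -⟩ := key (-(a - z))
      have : cross (-(a - z)) (b - z) = -cross (a - z) (b - z) := by
          simp only [cross, PiLp.neg_apply]; ring
      rw [this] at h1
      nlinarith [mul_pos h0 h]
    · obtain ⟨ε, h0, -, -, h1⟩ := key (a - z)
      rw [cross_self] at h1
      nlinarith [mul_pos h0 h]
  · refine interior_maximal ?_ (isOpen_openTri z a b)
    rintro x ⟨h1, h2, h3⟩
    exact (mem_hull_iff h x).2 ⟨h1.le, h2.le, h3.le⟩

open Classical in
/-- A disc inside a triangle is not wider than the height of the triangle. -/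
theorem diam_mul_norm_le {z a b c : Plane} (h : 0 < cross (a - z) (b - z)) {d : ℝ} (hd : 0 ≤ d)
    (hc : Metric.closedBall c (d / 2) ⊆ hull {z, a, b}) :
    d * ‖a - z‖ ≤ cross (a - z) (b - z) := by
  have ha : 0 < ‖a - z‖ := norm_pos_iff.2 (ne_zero_of_cross_pos h).1
  -- the two points of the disc that are extremal in the direction normal to the side
  have hmem : ∀ s : ℝ, |s| = d / 2 → c + (s / ‖a - z‖) • rot (a - z) ∈ hull {z, a, b} := by
    intro s hs
    apply hc
    rw [Metric.mem_closedBall, dist_eq_norm, add_sub_cancel_left, norm_smul, norm_rot, norm_div,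
      norm_norm, div_mul_cancel₀ _ ha.ne', Real.norm_eq_abs, hs]
  have h1 := ((mem_hull_iff h _).1 (hmem (d / 2) (abs_of_nonneg (by linarith))))
  have h2 := ((mem_hull_iff h _).1 (hmem (-(d / 2))
    (by rw [abs_neg]; exact abs_of_nonneg (by linarith))))
  have e : ∀ s : ℝ, cross (a - z) (c + (s / ‖a - z‖) • rot (a - z) - z)
      = cross (a - z) (c - z) + s * ‖a - z‖ := by
    intro s
    rw [show c + (s / ‖a - z‖) • rot (a - z) - z = (c - z) + (s / ‖a - z‖) • rot (a - z) by module,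
      cross_add_right, cross_smul_right, cross_rot]
    field_simp
  rw [e] at h1 h2
  obtain ⟨-, h4, h5⟩ := h1
  obtain ⟨h6, -, -⟩ := h2
  nlinarith

theorem isCompact_hull (K : Finset Plane) : IsCompact (hull K) :=
  K.finite_toSet.isCompact_convexHull (𝕜 := ℝ)

open Classical in
/-- The sine of an angle of a triangle is at least the inverse of the shape-regularity constant. -/
theorem norm_mul_norm_le_of_shape {z a b : Plane} (h : 0 < cross (a - z) (b - z)) {γ : ℝ}
    (hγ : Metric.diam (hull {z, a, b}) / inscribedDiam {z, a, b} ≤ γ) :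
    ‖a - z‖ * ‖b - z‖ ≤ γ * cross (a - z) (b - z) := by
  have ha : 0 < ‖a - z‖ := norm_pos_iff.2 (ne_zero_of_cross_pos h).1
  have hb : 0 < ‖b - z‖ := norm_pos_iff.2 (ne_zero_of_cross_pos h).2
  have hbd : ∀ d ∈ {d : ℝ | 0 ≤ d ∧ ∃ c : Plane, Metric.closedBall c (d / 2) ⊆ hull {z, a, b}},
      d ≤ cross (a - z) (b - z) / ‖a - z‖ := by
    rintro d ⟨hd, c, hc⟩
    rw [le_div_iff₀ ha]
    exact diam_mul_norm_le h hd hc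
  have hle : inscribedDiam {z, a, b} ≤ cross (a - z) (b - z) / ‖a - z‖ := by
    apply Real.sSup_le hbd (by positivity)
  have hpos : 0 < inscribedDiam {z, a, b} := by
    set x : Plane := z + (4⁻¹ : ℝ) • (a - z) + (4⁻¹ : ℝ) • (b - z)
    have hx : x ∈ openTri z a b := by
      have e : x - z = (4⁻¹ : ℝ) • (a - z) + (4⁻¹ : ℝ) • (b - z) := by simp only [x]; module
      simp only [openTri, Set.mem_ofPred_eq, e, cross_add_left, cross_add_right, cross_smul_left,
        cross_smul_right, cross_self]
      refine ⟨by linarith, by linarith, by linarith⟩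
    rw [← interior_hull h, mem_interior_iff_mem_nhds] at hx
    obtain ⟨ε, hε, hball⟩ := Metric.nhds_basis_closedBall.mem_iff.1 hx
    have : 2 * ε ≤ inscribedDiam {z, a, b} := by
      refine le_csSup ⟨_, hbd⟩ ⟨by linarith, x, ?_⟩
      rwa [mul_div_cancel_left₀ _ two_ne_zero]
    linarith
  have hbz : ‖b - z‖ ≤ Metric.diam (hull {z, a, b}) := by
    rw [← dist_eq_norm]
    apply Metric.dist_le_diam_of_mem (isCompact_hull _).isBounded
    · apply subset_convexHull; simp
    · apply subset_convexHull; simp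
  have h1 : Metric.diam (hull {z, a, b}) ≤ γ * inscribedDiam {z, a, b} := (div_le_iff₀ hpos).1 hγ
  have hγ0 : 0 ≤ γ := le_trans (by positivity) hγ
  calc ‖a - z‖ * ‖b - z‖ ≤ ‖a - z‖ * (γ * (cross (a - z) (b - z) / ‖a - z‖)) := by
        refine mul_le_mul_of_nonneg_left ?_ ha.le
        exact (hbz.trans h1).trans (mul_le_mul_of_nonneg_left hle hγ0)
    _ = γ * cross (a - z) (b - z) := by field_simp

/-! ### Integration over a triangle -/

/-- Coordinates of a triangle that are singular at the vertex `z`: the parameter `p.1` chooses a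
point of the opposite side, and `p.2` a point of the segment from `z` to that point. -/
def duffy (z a b : Plane) (p : ℝ × ℝ) : Plane := z + p.2 • ((a - z) + p.1 • (b - a))

/-- The identification of the plane with `ℝ × ℝ`. -/
def planeEquiv : ℝ × ℝ ≃ᵐ Plane :=
  MeasurableEquiv.finTwoArrow.symm.trans (MeasurableEquiv.toLp 2 (Fin 2 → ℝ))

theorem measurePreserving_planeEquiv : MeasurePreserving planeEquiv :=
  (PiLp.volume_preserving_toLp (Fin 2)).comp (volume_preserving_finTwoArrow ℝ).symm

theorem cross_duffy (z a b : Plane) (p : ℝ × ℝ) :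
    cross (a - z) (duffy z a b p - z) = p.2 * p.1 * cross (a - z) (b - z) ∧
    cross (duffy z a b p - z) (b - z) = p.2 * (1 - p.1) * cross (a - z) (b - z) := by
  constructor <;>
  · simp only [duffy, cross, PiLp.sub_apply, PiLp.add_apply, PiLp.smul_apply, smul_eq_mul]; ring

/-- The integral over a triangle in the coordinates `duffy`, whose Jacobian determinant is `r` times
twice the area of the triangle. -/
theorem integral_openTri {z a b : Plane} (h : 0 < cross (a - z) (b - z)) {f : Plane → ℝ}
    (hf : Continuous f) :
    ∫ x in openTri z a b, f x = cross (a - z) (b - z) *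
      ∫ τ in (0 : ℝ)..1, ∫ r in (0 : ℝ)..1, f (duffy z a b (τ, r)) * r := by
  set D := cross (a - z) (b - z) with hD
  set G : ℝ × ℝ → ℝ × ℝ := fun p => (z 0 + p.2 * ((a 0 - z 0) + p.1 * (b 0 - a 0)),
    z 1 + p.2 * ((a 1 - z 1) + p.1 * (b 1 - a 1))) with hG
  have hEG : ∀ p, planeEquiv (G p) = duffy z a b p := by
    intro p
    ext i
    fin_cases i
    · change (G p).1 = _; simp [hG, duffy]; ring
    · change (G p).2 = _; simp [hG, duffy]; ring
  set S : Set (ℝ × ℝ) := Set.Ioo 0 1 ×ˢ Set.Ioo 0 1 with hS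
  -- the inverse map: `r` is the sum of the barycentric coordinates of `a` and `b`
  have himg : planeEquiv ⁻¹' (openTri z a b) = G '' S := by
    ext q
    rw [Set.mem_preimage, Set.mem_image]
    constructor
    · rintro ⟨h1, h2, h3⟩
      set x := planeEquiv q
      set r := (cross (a - z) (x - z) + cross (x - z) (b - z)) / D with hr
      have hr0 : 0 < r := div_pos (by linarith) h
      refine ⟨(cross (a - z) (x - z) / (r * D), r), ⟨⟨?_, ?_⟩, hr0, ?_⟩, ?_⟩
      · positivity
      · dsimp only
        rw [div_lt_one (by positivity), hr, div_mul_cancel₀ _ h.ne']; linarith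
      · dsimp only
        rw [hr, div_lt_one h]; exact h3
      · apply planeEquiv.injective
        rw [hEG]
        have h4 := cross_decomp (a - z) (b - z) (x - z)
        have h5 : cross (x - z) (b - z) = r * D - cross (a - z) (x - z) := by
          rw [hr, div_mul_cancel₀ _ h.ne']; ring
        rw [h5, ← hD] at h4
        have h6 : D • (duffy z a b (cross (a - z) (x - z) / (r * D), r) - z) = D • (x - z) := by
          rw [h4, duffy]
          dsimp only
          have h7 : D * r * (cross (a - z) (x - z) / (r * D)) = cross (a - z) (x - z) := by
            field_simp
          rw [add_sub_cancel_left, smul_add, smul_add, smul_smul, smul_smul, smul_smul,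
            h7]
          module
        have h8 := smul_right_injective Plane h.ne' h6
        exact sub_left_injective h8
    · rintro ⟨p, ⟨⟨h1, h2⟩, h3, h4⟩, rfl⟩
      rw [hEG]
      obtain ⟨h5, h6⟩ := cross_duffy z a b p
      refine ⟨?_, ?_, ?_⟩
      · rw [h5]; positivity
      · rw [h6]; have : 0 < 1 - p.1 := by linarith
        positivity
      · rw [h5, h6, ← hD]; nlinarith
  have hinj : Set.InjOn G S := by
    rintro p ⟨⟨h1, h2⟩, h3, h4⟩ q ⟨⟨h5, h6⟩, h7, h8⟩ hpq
    have e : duffy z a b p = duffy z a b q := by rw [← hEG, ← hEG, hpq]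
    obtain ⟨e1, e2⟩ := cross_duffy z a b p
    obtain ⟨e3, e4⟩ := cross_duffy z a b q
    rw [e, e3] at e1
    rw [e, e4] at e2
    have e5 := mul_right_cancel₀ h.ne' e1
    have e6 := mul_right_cancel₀ h.ne' e2
    have e7 : p.2 = q.2 := by linarith
    rw [e7] at e5
    exact Prod.ext (mul_left_cancel₀ h7.ne' e5).symm e7
  set G' : ℝ × ℝ → (ℝ × ℝ →L[ℝ] ℝ × ℝ) := fun p =>
    (Matrix.toLin (.finTwoProd ℝ) (.finTwoProd ℝ)
      !![p.2 * (b 0 - a 0), (a 0 - z 0) + p.1 * (b 0 - a 0);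
         p.2 * (b 1 - a 1), (a 1 - z 1) + p.1 * (b 1 - a 1)]).toContinuousLinearMap with hG'
  have hder : ∀ p ∈ S, HasFDerivWithinAt G (G' p) S p := by
    intro p _
    apply HasFDerivAt.hasFDerivWithinAt
    simp only [hG']
    rw [Matrix.toLin_finTwoProd_toContinuousLinearMap]
    have hc : ∀ i : Fin 2, HasFDerivAt (fun p : ℝ × ℝ =>
        z i + p.2 * ((a i - z i) + p.1 * (b i - a i)))
        ((p.2 * (b i - a i)) • ContinuousLinearMap.fst ℝ ℝ ℝ
          + ((a i - z i) + p.1 * (b i - a i)) • ContinuousLinearMap.snd ℝ ℝ ℝ) p := by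
      intro i
      have h1 : HasFDerivAt (fun p : ℝ × ℝ => p.1) (ContinuousLinearMap.fst ℝ ℝ ℝ) p :=
          hasFDerivAt_fst
      have h2 : HasFDerivAt (fun p : ℝ × ℝ => p.2) (ContinuousLinearMap.snd ℝ ℝ ℝ) p :=
          hasFDerivAt_snd
      refine ((h2.mul ((h1.mul_const (b i - a i)).const_add (a i - z i))).const_add
          (z i)).congr_fderiv ?_
      ext <;> simp
    exact (hc 0).prodMk (hc 1)
  have hdet : ∀ p ∈ S, |(G' p).det| = p.2 * D := by
    rintro p ⟨-, h3, -⟩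
    simp only [hG', LinearMap.det_toContinuousLinearMap, LinearMap.det_toLin,
      Matrix.det_fin_two_of]
    rw [show p.2 * (b 0 - a 0) * (a 1 - z 1 + p.1 * (b 1 - a 1)) -
      (a 0 - z 0 + p.1 * (b 0 - a 0)) * (p.2 * (b 1 - a 1)) = -(p.2 * D) by
        simp only [hD, cross, PiLp.sub_apply]; ring, abs_neg, abs_of_pos (by positivity)]
  have hSm : MeasurableSet S := measurableSet_Ioo.prod measurableSet_Ioo
  have hcont : Continuous fun p : ℝ × ℝ => f (duffy z a b p) * p.2 := by
    have : Continuous (duffy z a b) := by unfold duffy; fun_prop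
    fun_prop
  rw [← measurePreserving_planeEquiv.setIntegral_preimage_emb planeEquiv.measurableEmbedding, himg,
    integral_image_eq_integral_abs_det_fderiv_smul volume hSm hder hinj]
  have h9 : ∫ p in S, |(G' p).det| • f (planeEquiv (G p))
      = ∫ p in S, D * (f (duffy z a b p) * p.2) := by
    refine setIntegral_congr_fun hSm fun p hp => ?_
    simp only [hdet p hp, hEG, smul_eq_mul]; ring
  rw [h9, integral_const_mul, hS, Measure.volume_eq_prod, setIntegral_prod]
  · congr 1
    simp_rw [intervalIntegral.integral_of_le zero_le_one, integral_Ioc_eq_integral_Ioo]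
  · refine IntegrableOn.mono_set ?_ (Set.prod_mono Set.Ioo_subset_Icc_self Set.Ioo_subset_Icc_self)
    exact hcont.continuousOn.integrableOn_compact (isCompact_Icc.prod isCompact_Icc)

/-! ### Polynomials on triangles -/

/-- The function on the plane that is given by a polynomial. -/
def polyFun (P : MvPolynomial (Fin 2) ℝ) (x : Plane) : ℝ := MvPolynomial.eval (fun i => x i) P

theorem polyFun_add (P Q : MvPolynomial (Fin 2) ℝ) (x : Plane) :
    polyFun (P + Q) x = polyFun P x + polyFun Q x := by simp [polyFun]

theorem polyFun_sub (P Q : MvPolynomial (Fin 2) ℝ) (x : Plane) :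
    polyFun (P - Q) x = polyFun P x - polyFun Q x := by simp [polyFun]

theorem contDiff_polyFun (P : MvPolynomial (Fin 2) ℝ) : ContDiff ℝ ∞ (polyFun P) := by
  induction P using MvPolynomial.induction_on with
  | C r => 
    have : polyFun (MvPolynomial.C r) = fun _ => r := by ext x; simp [polyFun]
    rw [this]; exact contDiff_const
  | add P Q hP hQ =>
    have : polyFun (P + Q) = fun x => polyFun P x + polyFun Q x := funext (polyFun_add P Q)
    rw [this]; exact hP.add hQ
  | mul_X P i hP =>
    have : polyFun (P * MvPolynomial.X i) = fun x => polyFun P x * x i := by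
      ext x; simp [polyFun]
    rw [this]; fun_prop

@[fun_prop]
theorem continuous_polyFun (P : MvPolynomial (Fin 2) ℝ) : Continuous (polyFun P) :=
  (contDiff_polyFun P).continuous

@[fun_prop]
theorem differentiable_polyFun (P : MvPolynomial (Fin 2) ℝ) : Differentiable ℝ (polyFun P) :=
  (contDiff_polyFun P).differentiable (by simp)

theorem fderiv_polyFun (P : MvPolynomial (Fin 2) ℝ) (x : Plane) (i : Fin 2) :
    fderiv ℝ (polyFun P) x (unitVec i) = polyFun (MvPolynomial.pderiv i P) x := by
  induction P using MvPolynomial.induction_on with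
  | C r =>
    have : polyFun (MvPolynomial.C r) = fun _ => r := by ext x; simp [polyFun]
    rw [this]; simp [polyFun]
  | add P Q hP hQ =>
    have : polyFun (P + Q) = polyFun P + polyFun Q := funext (polyFun_add P Q)
    rw [this, fderiv_add (differentiable_polyFun P x) (differentiable_polyFun Q x), map_add,
      polyFun_add, add_apply, hP, hQ]
  | mul_X P j hP =>
    have : polyFun (P * MvPolynomial.X j) = fun x => polyFun P x * x j := by
      ext x; simp [polyFun]
    have hd : DifferentiableAt ℝ (fun x : Plane => x j) x := by fun_prop
    have hx : fderiv ℝ (fun x : Plane => x j) x (unitVec i) = if i = j then 1 else 0 := by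
      have : (fun x : Plane => x j) = (EuclideanSpace.proj j : Plane →L[ℝ] ℝ) := rfl
      rw [this, ContinuousLinearMap.fderiv]
      simp [unitVec, eq_comm]
    rw [this, fderiv_fun_mul (differentiable_polyFun P x) hd]
    simp only [add_apply, FunLike.coe_smul, Pi.smul_apply, hP, hx, smul_eq_mul]
    simp only [polyFun, Derivation.leibniz, MvPolynomial.pderiv_X, map_add, smul_eq_mul, map_mul,
      MvPolynomial.eval_X]
    by_cases hij : i = j
    · subst hij; simp
    · simp [hij, Ne.symm hij]

theorem totalDegree_pderiv_le (P : MvPolynomial (Fin 2) ℝ) (i : Fin 2) {k : ℕ}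
    (hP : P.totalDegree ≤ k) : (MvPolynomial.pderiv i P).totalDegree ≤ k - 1 := by
  classical
  rw [P.as_sum, map_sum]
  refine MvPolynomial.totalDegree_finsetSum_le fun s hs => ?_
  rw [MvPolynomial.pderiv_monomial]
  rcases Nat.eq_zero_or_pos (s i) with h0 | h0
  · simp [h0]
  · refine (MvPolynomial.totalDegree_monomial_le _ _).trans ?_
    have h1 := (MvPolynomial.le_totalDegree hs).trans hP
    rw [Finsupp.sum_fintype _ _ (fun _ => rfl), Fin.sum_univ_two] at h1 ⊢
    fin_cases i <;> simp at h0 ⊢ <;> omega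

open Classical in
/-- The inverse inequality for the value of a polynomial at a vertex of a triangle: the
one-dimensional inequality on the segments from the vertex, integrated over all of them. -/
theorem sq_polyFun_vertex_le {z a b : Plane} (h : 0 < cross (a - z) (b - z)) {n : ℕ}
    {P : MvPolynomial (Fin 2) ℝ} (hP : P.totalDegree ≤ n) :
    cross (a - z) (b - z) * polyFun P z ^ 2
      ≤ kernelConst n * ∫ x in openTri z a b, polyFun P x ^ 2 := by
  have hray : ∀ τ : ℝ, polyFun P z ^ 2
      ≤ kernelConst n * ∫ r in (0 : ℝ)..1, polyFun P (duffy z a b (τ, r)) ^ 2 * r := by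
    intro τ
    -- the restriction of `P` to the segment, as a polynomial in one variable
    set f : Fin 2 → Polynomial ℝ := fun i =>
      Polynomial.C (((a - z) + τ • (b - a)) i) * Polynomial.X + Polynomial.C (z i)
    set p : Polynomial ℝ := MvPolynomial.aeval f P
    have hdeg : p.natDegree ≤ n := by
      have := MvPolynomial.aeval_natDegree_le (n := 1) P hP f fun i =>
          Polynomial.natDegree_linear_le
      simpa using this
    have hev : ∀ r : ℝ, p.eval r = polyFun P (duffy z a b (τ, r)) := by
      intro r
      have h1 : p.eval r = MvPolynomial.eval (fun i => (f i).eval r) P := by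
        have := MvPolynomial.map_aeval f (Polynomial.evalRingHom r) P
        simp only [Polynomial.coe_evalRingHom] at this
        rw [this]
        have h2 : (Polynomial.evalRingHom r).comp (algebraMap ℝ (Polynomial ℝ)) = RingHom.id ℝ := by
          ext; simp
        rw [h2]; rfl
      rw [h1, polyFun]
      congr 2
      ext i
      simp [f, duffy]
      ring
    have := sq_eval_zero_le n p hdeg
    simp only [hev] at this
    simpa [duffy] using this
  rw [integral_openTri h (by fun_prop)]
  have hc : Continuous fun τ : ℝ => ∫ r in (0 : ℝ)..1, polyFun P (duffy z a b (τ, r)) ^ 2 * r := by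
    apply intervalIntegral.continuous_parametric_intervalIntegral_of_continuous'
    unfold duffy Function.uncurry
    fun_prop
  have h1 : polyFun P z ^ 2 ≤ kernelConst n * ∫ τ in (0 : ℝ)..1, ∫ r in (0 : ℝ)..1,
      polyFun P (duffy z a b (τ, r)) ^ 2 * r := by
    rw [← intervalIntegral.integral_const_mul]
    calc polyFun P z ^ 2 = ∫ _ in (0 : ℝ)..1, polyFun P z ^ 2 := by simp
      _ ≤ _ := intervalIntegral.integral_mono_on zero_le_one
        (by simp) ((hc.const_mul _).intervalIntegrable _ _) fun τ _ => hray τ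
  calc _ ≤ cross (a - z) (b - z) * _ := mul_le_mul_of_nonneg_left h1 h.le
    _ = _ := by ring

/-- A polynomial with value `1` at a vertex `z`, value `0` at the other vertices, and mean zero,
whose `L²` norm is, up to a constant, the smallest one allowed by the inverse inequality. -/
theorem exists_bubble {z a b : Plane} (h : 0 < cross (a - z) (b - z)) {n : ℕ} (hn : 3 ≤ n) :
    ∃ P : MvPolynomial (Fin 2) ℝ, P.totalDegree ≤ n ∧ polyFun P z = 1 ∧ polyFun P a = 0 ∧
      polyFun P b = 0 ∧ ∫ x in openTri z a b, polyFun P x = 0 ∧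
      kernelConst n * ∫ x in openTri z a b, polyFun P x ^ 2 ≤ 4 * cross (a - z) (b - z) := by
  obtain ⟨Q, hdeg, hQ0, hQ1, hQint, hQsq⟩ := exists_bubble_poly n hn
  set D := cross (a - z) (b - z) with hD
  -- the affine function that is `0` at `z` and `1` at `a` and `b`
  set ℓ : MvPolynomial (Fin 2) ℝ :=
    MvPolynomial.C (D⁻¹ * (a 1 - b 1)) * (-1) * (MvPolynomial.X 0 - MvPolynomial.C (z 0))
      + MvPolynomial.C (D⁻¹ * (a 0 - b 0)) * (MvPolynomial.X 1 - MvPolynomial.C (z 1)) with hℓ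
  have hℓev : ∀ x : Plane, polyFun ℓ x = D⁻¹ * (cross (a - z) (x - z) + cross (x - z) (b - z)) := by
    intro x
    simp [hℓ, polyFun, cross]
    ring
  have hev : ∀ x : Plane, polyFun (Polynomial.aeval ℓ Q) x = Q.eval (polyFun ℓ x) := by
    intro x
    simp only [polyFun]
    rw [Polynomial.aeval_def, Polynomial.hom_eval₂]
    have h2 : (MvPolynomial.eval fun i => x i).comp (algebraMap ℝ (MvPolynomial (Fin 2) ℝ))
        = RingHom.id ℝ := by ext; simp
    rw [h2]; rfl
  have hℓd : ∀ τ r : ℝ, polyFun ℓ (duffy z a b (τ, r)) = r := by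
    intro τ r
    obtain ⟨h1, h2⟩ := cross_duffy z a b (τ, r)
    rw [hℓev, h1, h2, ← hD]
    field_simp
    ring
  refine ⟨Polynomial.aeval ℓ Q, ?_, ?_, ?_, ?_, ?_, ?_⟩
  · have hℓdeg : ℓ.totalDegree ≤ 1 := by
      have h1 : ∀ (c : ℝ) (i : Fin 2),
          (MvPolynomial.X i - MvPolynomial.C c : MvPolynomial (Fin 2) ℝ).totalDegree ≤ 1 := by
        intro c i
        refine (MvPolynomial.totalDegree_sub _ _).trans ?_
        simp
      refine (MvPolynomial.totalDegree_add _ _).trans (max_le ?_ ?_)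
      · refine (MvPolynomial.totalDegree_mul _ _).trans ?_
        have : (MvPolynomial.C (D⁻¹ * (a 1 - b 1)) * (-1) : MvPolynomial (Fin 2) ℝ).totalDegree
            = 0 := by
          rw [show (-1 : MvPolynomial (Fin 2) ℝ) = MvPolynomial.C (-1) by simp,
              ← MvPolynomial.C_mul]
          exact MvPolynomial.totalDegree_C _
        rw [this, zero_add]
        exact h1 _ _
      · refine (MvPolynomial.totalDegree_mul _ _).trans ?_
        rw [MvPolynomial.totalDegree_C, zero_add]
        exact h1 _ _
    rw [Polynomial.aeval_eq_sum_range]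
    refine MvPolynomial.totalDegree_finsetSum_le fun i hi => ?_
    refine (MvPolynomial.totalDegree_smul_le _ _).trans
        ((MvPolynomial.totalDegree_pow _ _).trans ?_)
    have : i ≤ n := (Nat.lt_succ_iff.1 (Finset.mem_range.1 hi)).trans hdeg
    calc i * ℓ.totalDegree ≤ i * 1 := Nat.mul_le_mul_left _ hℓdeg
      _ ≤ n := by omega
  · rw [hev, hℓev, ← hQ0]; simp [cross]
  · rw [hev, hℓev, cross_self, zero_add, inv_mul_cancel₀ h.ne', hQ1]
  · rw [hev, hℓev, cross_self, add_zero, inv_mul_cancel₀ h.ne', hQ1]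
  · rw [integral_openTri h (by fun_prop)]
    simp only [hev, hℓd, hQint]
    simp
  · rw [integral_openTri h (by fun_prop)]
    simp only [hev, hℓd]
    simp only [intervalIntegral.integral_const, sub_zero, one_smul]
    calc _ = D * (kernelConst n * ∫ r in (0 : ℝ)..1, Q.eval r ^ 2 * r) := by ring
      _ ≤ D * 4 := mul_le_mul_of_nonneg_left hQsq h.le
      _ = _ := by ring

/-! ### Triangulations of Lipschitz domains -/

/-- A Lipschitz domain has no slits: near a boundary point, the points above the graph are exterior
points. -/
theorem IsLipschitzDomain.interior_closure {Ω : Set Plane} (hΩ : IsLipschitzDomain Ω) :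
    interior (closure Ω) = Ω := by
  refine Set.Subset.antisymm (fun x hx => ?_)
    (interior_maximal subset_closure hΩ.isOpen)
  by_contra hxΩ
  have hfr : x ∈ frontier Ω := by
    rw [frontier, hΩ.isOpen.interior_eq]
    exact ⟨interior_subset hx, hxΩ⟩
  obtain ⟨U, hU, e, L, g, hg, hUg⟩ := hΩ.locally_subgraph x hfr
  -- a point slightly above `x` is in the closure of the domain,
  -- but has a neighbourhood above the graph
  have hge : g ((e x) 0) ≤ (e x) 1 := by
    by_contra hlt
    push Not at hlt
    exact hxΩ ((hUg x (mem_of_mem_nhds hU)).2 hlt)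
  have hc : Continuous fun s : ℝ => x + s • e.symm (unitVec 1) := by fun_prop
  have h1 : Tendsto (fun s : ℝ => x + s • e.symm (unitVec 1)) (𝓝[>] 0) (𝓝 x) := by
    simpa using (hc.tendsto 0).mono_left nhdsWithin_le_nhds
  have hnear : interior U ∩ interior (closure Ω) ∈ 𝓝 x :=
    Filter.inter_mem (interior_mem_nhds.2 hU) (isOpen_interior.mem_nhds hx)
  obtain ⟨s, ⟨h2, h3⟩, hs⟩ := ((h1.eventually hnear).and self_mem_nhdsWithin).exists
  set y := x + s • e.symm (unitVec 1) with hy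
  have hey : e y = e x + s • unitVec 1 := by
    rw [hy, map_add, map_smul, e.apply_symm_apply]
  have hs0 : (0 : ℝ) < s := hs
  have habove : g ((e y) 0) < (e y) 1 := by
    rw [hey]
    simp [unitVec]
    linarith
  have hgc : Continuous fun w : Plane => g ((e w) 0) := hg.continuous.comp (by fun_prop)
  have hopen : IsOpen {w : Plane | g ((e w) 0) < (e w) 1} := isOpen_lt hgc (by fun_prop)
  have hnhds : interior U ∩ {w : Plane | g ((e w) 0) < (e w) 1} ∈ 𝓝 y :=
    Filter.inter_mem (isOpen_interior.mem_nhds h2) (hopen.mem_nhds habove)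
  obtain ⟨w, ⟨hw1, hw2⟩, hw3⟩ := mem_closure_iff_nhds.1 (interior_subset h3) _ hnhds
  have hw4 : (e w) 1 < g ((e w) 0) := (hUg w (interior_subset hw1)).1 hw3
  have hw5 : g ((e w) 0) < (e w) 1 := hw2
  linarith

namespace Triangulation

variable {Ω : Set Plane} (T : Triangulation Ω)

open Classical in
/-- The other two vertices of a triangle, in counterclockwise order. -/
theorem exists_ccw {K : Finset Plane} (hK : K ∈ T.cells) {z : Plane} (hz : z ∈ K) :
    ∃ a b, K = {z, a, b} ∧ 0 < cross (a - z) (b - z) := by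
  have hcard := T.card_eq K hK
  have h1 : (K.erase z).card = 2 := by rw [Finset.card_erase_of_mem hz, hcard]
  obtain ⟨a, b, hab, hKab⟩ := Finset.card_eq_two.1 h1
  have hK' : K = {z, a, b} := by rw [← Finset.insert_erase hz, hKab]
  have haz : a ≠ z := by
    have : a ∈ K.erase z := by rw [hKab]; simp
    exact (Finset.mem_erase.1 this).1
  have hbz : b ≠ z := by
    have : b ∈ K.erase z := by rw [hKab]; simp
    exact (Finset.mem_erase.1 this).1
  -- otherwise `b` lies on the line through `z` and `a`
  have hne : cross (a - z) (b - z) ≠ 0 := by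
    intro h0
    have hind := T.indep K hK
    have hmem : ∀ i : Fin 3, (![z, a, b] : Fin 3 → Plane) i ∈ K := by
      intro i; rw [hK']; fin_cases i <;> simp
    have hinj : Function.Injective fun i : Fin 3 =>
        (⟨(![z, a, b] : Fin 3 → Plane) i, hmem i⟩ : K) := by
      intro i j hij
      have hij' := congrArg Subtype.val hij
      fin_cases i <;> fin_cases j <;> simp_all
    have h2 := hind.comp_embedding ⟨_, hinj⟩
    have h3 : AffineIndependent ℝ (![z, a, b] : Fin 3 → Plane) := h2
    rw [affineIndependent_iff_not_collinear] at h3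
    apply h3
    rw [collinear_iff_of_mem (p₀ := z) (Set.mem_range.2 ⟨0, rfl⟩)]
    refine ⟨a - z, ?_⟩
    have hn : ‖a - z‖ ^ 2 ≠ 0 := by simpa [sub_eq_zero] using haz
    rintro p ⟨i, rfl⟩
    fin_cases i
    · exact ⟨0, by simp⟩
    · exact ⟨1, by simp⟩
    · refine ⟨inner ℝ (a - z) (b - z) / ‖a - z‖ ^ 2, ?_⟩
      have h4 : ‖a - z‖ ^ 2 • (b - z) = inner ℝ (a - z) (b - z) • (a - z) := by
        rw [norm_sq_plane, inner_plane]
        simp only [cross] at h0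
        ext i
        fin_cases i
        · simp at h0 ⊢; linear_combination (-(a 1 - z 1)) * h0
        · simp at h0 ⊢; linear_combination ((a 0 - z 0)) * h0
      have h5 : b - z = (inner ℝ (a - z) (b - z) / ‖a - z‖ ^ 2) • (a - z) := by
        rw [div_eq_inv_mul, mul_smul, ← h4, smul_smul, inv_mul_cancel₀ hn, one_smul]
      simp only [vadd_eq_add]
      rw [← h5]; simp
  rcases lt_or_gt_of_ne hne with h | h
  · refine ⟨b, a, ?_, ?_⟩
    · rw [hK', Finset.pair_comm]
    · rw [cross_swap]; linarith
  · exact ⟨a, b, hK', h⟩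

theorem nonempty_of_mem {K : Finset Plane} (hK : K ∈ T.cells) : K.Nonempty := by
  rw [← Finset.card_pos, T.card_eq K hK]; norm_num

theorem interior_hull_nonempty {K : Finset Plane} (hK : K ∈ T.cells) :
    (interior (hull K)).Nonempty := by
  classical
  obtain ⟨z, hz⟩ := T.nonempty_of_mem hK
  obtain ⟨a, b, rfl, h⟩ := T.exists_ccw hK hz
  rw [interior_hull h]
  refine ⟨z + (4⁻¹ : ℝ) • (a - z) + (4⁻¹ : ℝ) • (b - z), ?_⟩
  have e : z + (4⁻¹ : ℝ) • (a - z) + (4⁻¹ : ℝ) • (b - z) - z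
    = (4⁻¹ : ℝ) • (a - z) + (4⁻¹ : ℝ) • (b - z) := by module
  simp only [openTri, Set.mem_ofPred_eq, e, cross_add_left, cross_add_right, cross_smul_left,
    cross_smul_right, cross_self]
  refine ⟨by linarith, by linarith, by linarith⟩

theorem isClosed_hull (K : Finset Plane) : IsClosed (hull K) := (isCompact_hull K).isClosed

theorem closure_interior_hull {K : Finset Plane} (hK : K ∈ T.cells) :
    closure (interior (hull K)) = hull K := by
  have hconv : Convex ℝ (hull K) := convex_convexHull ℝ _
  rw [hconv.closure_interior_eq_closure_of_nonempty_interior (T.interior_hull_nonempty hK)]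
  exact (isClosed_hull K).closure_eq

/-- The boundary value of a function that is a polynomial inside the triangle. -/
theorem traceAt_eq {K : Finset Plane} (hK : K ∈ T.cells) {z : Plane} (hz : z ∈ K) {q : Plane → ℝ}
    {P : MvPolynomial (Fin 2) ℝ} (hq : ∀ x ∈ interior (hull K), q x = polyFun P x) :
    traceAt q K z = polyFun P z := by
  have hne : (𝓝[interior (hull K)] z).NeBot := by
    rw [← mem_closure_iff_nhdsWithin_neBot, T.closure_interior_hull hK]
    exact subset_convexHull ℝ _ hz
  apply Tendsto.limUnder_eq
  refine Tendsto.congr' ?_ ((continuous_polyFun P).tendsto z |>.mono_left nhdsWithin_le_nhds)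
  filter_upwards [self_mem_nhdsWithin] with x hx using (hq x hx).symm

open Classical in
/-- A common point of two triangles lies on the line opposite to a vertex `z` of the first that is
not a vertex of the second: by conformity, it is in the hull of the common vertices. -/
theorem mem_opposite_side {K L : Finset Plane} (hK : K ∈ T.cells) (hL : L ∈ T.cells)
    {z a b x : Plane} (hKz : K = {z, a, b}) (hzL : z ∉ L)
    (hxK : x ∈ hull K) (hxL : x ∈ hull L) :
    cross (a - z) (x - z) + cross (x - z) (b - z) = cross (a - z) (b - z) := by
  have hx : x ∈ convexHull ℝ ((K : Set Plane) ∩ (L : Set Plane)) := by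
    rw [← T.conforming K hK L hL]; exact ⟨hxK, hxL⟩
  have hconv : Convex ℝ {x : Plane |
      cross (a - z) (x - z) + cross (x - z) (b - z) = cross (a - z) (b - z)} := by
    intro x hx y hy s t hs ht hst
    have e : s • x + t • y - z = s • (x - z) + t • (y - z) := by
      rw [eq_sub_of_add_eq hst]
      module
    simp only [Set.mem_ofPred_eq] at hx hy
    simp only [Set.mem_ofPred_eq, e, cross_add_left, cross_add_right, cross_smul_left,
      cross_smul_right]
    linear_combination s * hx + t * hy + cross (a - z) (b - z) * hst
  refine convexHull_min ?_ hconv hx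
  rintro y ⟨hyK, hyL⟩
  rw [hKz] at hyK
  have hyK' : y = z ∨ y = a ∨ y = b := by simpa using hyK
  rcases hyK' with rfl | rfl | rfl
  · exact absurd hyL hzL
  · simp only [Set.mem_ofPred_eq, cross_self, zero_add]
  · simp only [Set.mem_ofPred_eq, cross_self, add_zero]

theorem disjoint_interior_hull {K L : Finset Plane} (hK : K ∈ T.cells) (hL : L ∈ T.cells)
    (hKL : K ≠ L) : Disjoint (interior (hull K)) (hull L) := by
  classical
  rw [Set.disjoint_left]
  intro x hxK hxL
  obtain ⟨z, hzK, hzL⟩ : ∃ z ∈ K, z ∉ L := by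
    by_contra hcon
    push Not at hcon
    exact hKL (Finset.eq_of_subset_of_card_le hcon (by rw [T.card_eq K hK, T.card_eq L hL]))
  obtain ⟨a, b, hKz, h⟩ := T.exists_ccw hK hzK
  have h1 := T.mem_opposite_side hK hL hKz hzL (interior_subset hxK) hxL
  rw [hKz, interior_hull h] at hxK
  exact absurd h1 hxK.2.2.ne

theorem pairwise_disjoint_interior :
    (T.cells : Set (Finset Plane)).Pairwise (Function.onFun Disjoint fun K => interior (hull K)) :=
  fun _ hK _ hL hKL => (T.disjoint_interior_hull hK hL hKL).mono_right interior_subset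

variable {T}

theorem interior_hull_subset (hΩ : IsLipschitzDomain Ω) {K : Finset Plane} (hK : K ∈ T.cells) :
    interior (hull K) ⊆ Ω := by
  rw [← hΩ.interior_closure, ← T.iUnion_eq]
  exact interior_mono (Set.subset_biUnion_of_mem (u := fun K => hull K) hK)

theorem ae_eq_iUnion_interior (hΩ : IsLipschitzDomain Ω) :
    Ω =ᵐ[volume] ⋃ K ∈ T.cells, interior (hull K) := by
  have hnull : volume (⋃ K ∈ T.cells, frontier (hull K)) = 0 := by
    refine (measure_biUnion_null_iff T.cells.countable_toSet).2 fun K _ => ?_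
    exact (convex_convexHull ℝ (K : Set Plane)).addHaar_frontier volume
  have hae : ∀ᵐ x ∂(volume : Measure Plane), x ∉ ⋃ K ∈ T.cells, frontier (hull K) :=
    measure_eq_zero_iff_ae_notMem.1 hnull
  filter_upwards [hae] with x hx
  apply propext
  change x ∈ Ω ↔ x ∈ ⋃ K ∈ T.cells, interior (hull K)
  constructor
  · intro hxΩ
    have h1 : x ∈ ⋃ K ∈ T.cells, hull K := by rw [T.iUnion_eq]; exact subset_closure hxΩ
    simp only [Set.mem_iUnion, exists_prop] at h1 hx ⊢
    obtain ⟨K, hK, hxK⟩ := h1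
    refine ⟨K, hK, ?_⟩
    by_contra hcon
    exact hx ⟨K, hK, subset_closure hxK, hcon⟩
  · intro h1
    simp only [Set.mem_iUnion, exists_prop] at h1
    obtain ⟨K, hK, hxK⟩ := h1
    exact interior_hull_subset hΩ hK hxK

/-- Integrals over the domain are sums of integrals over the open triangles. -/
theorem integral_eq_sum (hΩ : IsLipschitzDomain Ω) {f : Plane → ℝ}
    (hf : ∀ K ∈ T.cells, IntegrableOn f (interior (hull K))) :
    ∫ x in Ω, f x = ∑ K ∈ T.cells, ∫ x in interior (hull K), f x := by
  rw [setIntegral_congr_set (ae_eq_iUnion_interior (T := T) hΩ)]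
  exact integral_biUnion_finset _ (fun K _ => isOpen_interior.measurableSet)
    T.pairwise_disjoint_interior hf

theorem integrableOn_domain (hΩ : IsLipschitzDomain Ω) {f : Plane → ℝ}
    (hf : ∀ K ∈ T.cells, IntegrableOn f (interior (hull K))) : IntegrableOn f Ω := by
  rw [integrableOn_congr_set_ae (ae_eq_iUnion_interior (T := T) hΩ),
    integrableOn_finset_iUnion]
  exact hf

theorem integrableOn_interior_of_eq {K : Finset Plane} {f g : Plane → ℝ} (hg : Continuous g)
    (hfg : ∀ x ∈ interior (hull K), f x = g x) : IntegrableOn f (interior (hull K)) := by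
  refine (integrableOn_congr_fun hfg isOpen_interior.measurableSet).2 ?_
  exact (hg.continuousOn.integrableOn_compact (isCompact_hull K)).mono_set interior_subset

/-! ### Edges -/

open Classical in
/-- The triangle `K` has the edge from `z` to `p` and lies to its left. -/
def IsLeft (K : Finset Plane) (z p : Plane) : Prop :=
  ∃ a, K = {z, p, a} ∧ 0 < cross (p - z) (a - z)

theorem IsLeft.left_mem {K : Finset Plane} {z p : Plane} (h : IsLeft K z p) : z ∈ K := by
  obtain ⟨a, rfl, -⟩ := h; simp

theorem IsLeft.right_mem {K : Finset Plane} {z p : Plane} (h : IsLeft K z p) : p ∈ K := by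
  obtain ⟨a, rfl, -⟩ := h; simp

theorem isLeft_or_isLeft (hK : K ∈ T.cells) {z p : Plane} (hz : z ∈ K) (hp : p ∈ K) (hzp : p ≠ z) :
    IsLeft K z p ∨ IsLeft K p z := by
  classical
  obtain ⟨a, b, rfl, h⟩ := T.exists_ccw hK hz
  have hp' : p = a ∨ p = b := by simpa [hzp] using hp
  rcases hp' with rfl | rfl
  · exact Or.inl ⟨b, rfl, h⟩
  · refine Or.inr ⟨a, ?_, ?_⟩
    · ext x; simp; tauto
    · have : cross (z - p) (a - p) = cross (a - z) (p - z) := by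
        simp only [cross, PiLp.sub_apply]; ring
      rwa [this]

/-- Near an inner point of an edge, a triangle to the left of the edge is a half plane. -/
theorem IsLeft.eventually_mem {K : Finset Plane} {z p : Plane} (h : IsLeft K z p) {s : ℝ}
    (hs0 : 0 < s) (hs1 : s < 1) :
    ∀ᶠ x in 𝓝 (z + s • (p - z)), x ∈ interior (hull K) ↔ 0 < cross (p - z) (x - z) := by
  obtain ⟨a, rfl, h⟩ := h
  have h1 : ∀ᶠ x in 𝓝 (z + s • (p - z)), 0 < cross (x - z) (a - z) := by
    have : Continuous fun x => cross (x - z) (a - z) := by fun_prop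
    refine (this.tendsto _).eventually_const_lt ?_
    rw [add_sub_cancel_left, cross_smul_left]
    positivity
  have h2 : ∀ᶠ x in 𝓝 (z + s • (p - z)),
      cross (p - z) (x - z) + cross (x - z) (a - z) < cross (p - z) (a - z) := by
    have : Continuous fun x => cross (p - z) (x - z) + cross (x - z) (a - z) := by fun_prop
    refine (this.tendsto _).eventually_lt_const ?_
    rw [add_sub_cancel_left, cross_smul_left, cross_smul_right, cross_self]
    nlinarith
  filter_upwards [h1, h2] with x h3 h4
  rw [interior_hull h]
  exact ⟨fun h5 => h5.1, fun h5 => ⟨h5, h3, h4⟩⟩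

theorem IsLeft.ne {K : Finset Plane} {z p : Plane} (h : IsLeft K z p) : p ≠ z := by
  obtain ⟨a, -, h⟩ := h
  rintro rfl
  simp [cross] at h

/-- A given side of an edge belongs to at most one triangle. -/
theorem IsLeft.unique {K L : Finset Plane} (hK : K ∈ T.cells) (hL : L ∈ T.cells) {z p : Plane}
    (h₁ : IsLeft K z p) (h₂ : IsLeft L z p) : K = L := by
  by_contra hKL
  have h3 := (h₁.eventually_mem (s := 1 / 2) (by norm_num) (by norm_num)).and
    (h₂.eventually_mem (s := 1 / 2) (by norm_num) (by norm_num))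
  obtain ⟨ε, hε, h4, h5⟩ := exists_small_add_smul_mem (mem_interior_iff_mem_nhds.2 h3) (rot (p - z))
  have hpos : 0 < cross (p - z) (z + (1 / 2 : ℝ) • (p - z) + ε • rot (p - z) - z) := by
    rw [show z + (1 / 2 : ℝ) • (p - z) + ε • rot (p - z) - z
      = (1 / 2 : ℝ) • (p - z) + ε • rot (p - z) by module, cross_add_right, cross_smul_right,
      cross_smul_right, cross_self, cross_rot]
    have : 0 < ‖p - z‖ := norm_pos_iff.2 (sub_ne_zero.2 h₁.ne)
    positivity
  exact Set.disjoint_left.1 (T.disjoint_interior_hull hK hL hKL) (h4.2 hpos)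
    (interior_subset (h5.2 hpos))

/-- A triangle that contains an inner point of an edge contains the edge. -/
theorem mem_of_mem_edge {K L : Finset Plane} (hK : K ∈ T.cells) (hL : L ∈ T.cells) {z p : Plane}
    (hz : z ∈ K) (hp : p ∈ K) (hzp : p ≠ z) {s : ℝ} (hs0 : 0 < s) (hs1 : s < 1)
    (hx : z + s • (p - z) ∈ hull L) : z ∈ L ∧ p ∈ L := by
  classical
  have key : ∀ z p : Plane, z ∈ K → p ∈ K → p ≠ z → ∀ s : ℝ, 0 < s → s < 1 →
      z + s • (p - z) ∈ hull L → z ∈ L := by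
    intro z p hz hp hzp s hs0 hs1 hx
    by_contra hzL
    obtain ⟨a, b, hKz, h⟩ := T.exists_ccw hK hz
    have hxK : z + s • (p - z) ∈ hull K := by
      have := (convex_convexHull ℝ (K : Set Plane)).add_smul_sub_mem
        (subset_convexHull ℝ _ hz) (subset_convexHull ℝ _ hp) ⟨hs0.le, hs1.le⟩
      exact this
    have h1 := T.mem_opposite_side hK hL hKz hzL hxK hx
    rw [add_sub_cancel_left, cross_smul_left, cross_smul_right] at h1
    have hp' : p = a ∨ p = b := by simpa [hKz, hzp] using hp
    rcases hp' with rfl | rfl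
    · rw [cross_self] at h1; nlinarith
    · rw [cross_self] at h1; nlinarith
  refine ⟨key z p hz hp hzp s hs0 hs1 hx,
      key p z hp hz hzp.symm (1 - s) (by linarith) (by linarith) ?_⟩
  convert hx using 1
  module

theorem eventually_mem_edge {K : Finset Plane} (hK : K ∈ T.cells) {z p : Plane}
    (hz : z ∈ K) (hp : p ∈ K) (hzp : p ≠ z) {s : ℝ} (hs0 : 0 < s) (hs1 : s < 1) :
    ∀ᶠ x in 𝓝 (z + s • (p - z)), ∀ L ∈ T.cells, x ∈ hull L → z ∈ L ∧ p ∈ L := by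
  rw [Finset.eventually_all]
  intro L hL
  by_cases hx : z + s • (p - z) ∈ hull L
  · exact Eventually.of_forall fun _ _ => mem_of_mem_edge hK hL hz hp hzp hs0 hs1 hx
  · filter_upwards [(isClosed_hull L).isOpen_compl.mem_nhds hx] with x h1 h2
    exact absurd h2 h1

end Triangulation

/-! ### Functions in `H¹₀` that are polynomial on each triangle -/

theorem integral_mul_fderiv {f φ : Plane → ℝ} (hf : ContDiff ℝ ∞ f) (hφ : ContDiff ℝ ∞ φ)
    (hc : HasCompactSupport φ) (v : Plane) :
    ∫ x, f x * fderiv ℝ φ x v = -∫ x, fderiv ℝ f x v * φ x := by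
  have hf' : Continuous fun x => fderiv ℝ f x v := by
    have := hf.continuous_fderiv (by simp)
    fun_prop
  have hφ' : Continuous fun x => fderiv ℝ φ x v := by
    have := hφ.continuous_fderiv (by simp)
    fun_prop
  refine integral_mul_fderiv_eq_neg_fderiv_mul_of_integrable ?_ ?_ ?_
    (fun x _ => hf.differentiable (by simp) x) (fun x _ => hφ.differentiable (by simp) x)
  · exact (hf'.mul hφ.continuous).integrable_of_hasCompactSupport hc.mul_left
  · exact (hf.continuous.mul hφ').integrable_of_hasCompactSupport (hc.fderiv_apply ℝ v).mul_left
  · exact (hf.continuous.mul hφ.continuous).integrable_of_hasCompactSupport hc.mul_left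

theorem gradient_apply (φ : Plane → ℝ) (x : Plane) (i : Fin 2) :
    gradient φ x i = fderiv ℝ φ x (unitVec i) := by
  have h : inner ℝ (gradient φ x) (unitVec i) = fderiv ℝ φ x (unitVec i) := by
    simp [gradient]
  rw [← h, unitVec, EuclideanSpace.inner_single_right]
  simp

/-- The extension by zero of a function in `H¹₀(Ω)` is weakly differentiable on the whole plane:
the test function `φ` need not vanish outside `Ω`. -/
theorem exists_weakGradient_extension {Ω : Set Plane} (hΩ : IsLipschitzDomain Ω) {u : Plane → ℝ}
    (hu : MemH10 Ω u) : ∃ g : Plane → Plane, MemLp u 2 (volume.restrict Ω) ∧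
      MemLp g 2 (volume.restrict Ω) ∧ HasWeakGradient Ω u g ∧
      ∀ φ : Plane → ℝ, ContDiff ℝ ∞ φ → HasCompactSupport φ → ∀ i : Fin 2,
        ∫ x in Ω, (u x * fderiv ℝ φ x (unitVec i) + g x i * φ x) = 0 := by
  obtain ⟨g, hu2, hg2, hw, happ⟩ := hu
  refine ⟨g, hu2, hg2, hw, fun φ hφ hφc i => ?_⟩
  have hfin : volume Ω < ⊤ := hΩ.isBounded.measure_lt_top
  have : IsFiniteMeasure (volume.restrict Ω) := ⟨by rwa [Measure.restrict_apply_univ]⟩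
  have hφ' : Continuous fun x => fderiv ℝ φ x (unitVec i) := by
    have := hφ.continuous_fderiv (by simp)
    fun_prop
  obtain ⟨M₁, hM₁⟩ := hφc.exists_bound_of_continuous hφ.continuous
  obtain ⟨M₂, hM₂⟩ := (hφc.fderiv_apply ℝ (unitVec i)).exists_bound_of_continuous hφ'
  set M : ℝ := max M₁ M₂
  set V : ℝ≥0∞ := volume.restrict Ω Set.univ ^ (1 / (1 : ℝ≥0∞).toReal - 1 / (2 : ℝ≥0∞).toReal)
  have hV : V ≠ ⊤ := by
    apply ENNReal.rpow_ne_top_of_nonneg (by norm_num)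
    exact measure_ne_top _ _
  -- approximate `u` by test functions; the error is at most a multiple of the `H¹` distance
  have key : ∀ ε : ℝ≥0∞, 0 < ε →
      ‖∫ x in Ω, (u x * fderiv ℝ φ x (unitVec i) + g x i * φ x)‖ₑ
        ≤ ENNReal.ofReal M * (2 * V) * ε := by
    intro ε hε
    obtain ⟨ψ, ⟨hψ, hψc, hψΩ⟩, hlt⟩ := happ ε hε
    have hψ' : ∀ j, Continuous fun x => fderiv ℝ ψ x (unitVec j) := by
      intro j
      have := hψ.continuous_fderiv (by simp)
      fun_prop
    have hgrad : Continuous (gradient ψ) := by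
      have := hψ.continuous_fderiv (by simp)
      unfold gradient
      fun_prop
    -- the identity holds for test functions in place of `u`
    have hzero : ∫ x in Ω, (ψ x * fderiv ℝ φ x (unitVec i) + gradient ψ x i * φ x) = 0 := by
      rw [setIntegral_eq_integral_of_forall_compl_eq_zero]
      · have h1 : Integrable fun x => ψ x * fderiv ℝ φ x (unitVec i) :=
          (hψ.continuous.mul hφ').integrable_of_hasCompactSupport hψc.mul_right
        have h2 : Integrable fun x => gradient ψ x i * φ x := by
          simp only [gradient_apply]
          exact ((hψ' i).mul hφ.continuous).integrable_of_hasCompactSupport hφc.mul_left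
        rw [integral_add h1 h2, integral_mul_fderiv hψ hφ hφc]
        simp only [gradient_apply]
        ring
      · intro x hx
        have hx' : x ∉ tsupport ψ := fun h => hx (hψΩ h)
        have h1 : ψ x = 0 := image_eq_zero_of_notMem_tsupport hx'
        have h2 : fderiv ℝ ψ x = 0 := by
          have := mt (fun h => tsupport_fderiv_subset ℝ h) hx'
          exact image_eq_zero_of_notMem_tsupport this
        rw [gradient_apply, h1, h2]
        simp
    have hbψ : MemLp ψ 2 (volume.restrict Ω) :=
      (hψ.continuous.memLp_of_hasCompactSupport hψc).restrict Ω
    have hgc : HasCompactSupport (gradient ψ) := by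
      refine (hψc.fderiv ℝ).comp_left (g := (InnerProductSpace.toDual ℝ Plane).symm) ?_
      simp
    have hbg : MemLp (gradient ψ) 2 (volume.restrict Ω) :=
      (hgrad.memLp_of_hasCompactSupport hgc).restrict Ω
    have hint1 : MemLp (fun x => u x - ψ x) 1 (volume.restrict Ω) :=
      (hu2.sub hbψ).mono_exponent (by norm_num)
    have hint2 : MemLp (fun x => g x - gradient ψ x) 1 (volume.restrict Ω) :=
      (hg2.sub hbg).mono_exponent (by norm_num)
    have hA : eLpNorm (fun x => u x - ψ x) 2 (volume.restrict Ω) ≤ ε := by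
      by_contra hcon
      push Not at hcon
      have := pow_le_pow_left₀ (zero_le) hcon.le 2
      exact absurd (this.trans le_self_add) (not_le.2 hlt)
    have hB : eLpNorm (fun x => g x - gradient ψ x) 2 (volume.restrict Ω) ≤ ε := by
      by_contra hcon
      push Not at hcon
      have := pow_le_pow_left₀ (zero_le) hcon.le 2
      exact absurd (this.trans le_add_self) (not_le.2 hlt)
    have hA1 := eLpNorm_le_eLpNorm_mul_rpow_measure_univ (p := 1) (q := 2) (by norm_num) hint1.1
    have hB1 := eLpNorm_le_eLpNorm_mul_rpow_measure_univ (p := 1) (q := 2) (by norm_num) hint2.1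
    rw [eLpNorm_one_eq_lintegral_enorm] at hA1 hB1
    have hgi : MemLp (fun x => g x i) 2 (volume.restrict Ω) := by
      refine hg2.of_le ?_ (Eventually.of_forall fun x => ?_)
      · have hc : Continuous fun y : Plane => y i := by fun_prop
        exact hc.comp_aestronglyMeasurable hg2.1
      · exact PiLp.norm_apply_le _ i
    have hφL : MemLp φ 2 (volume.restrict Ω) :=
      (hφ.continuous.memLp_of_hasCompactSupport hφc).restrict Ω
    have hφL' : MemLp (fun x => fderiv ℝ φ x (unitVec i)) 2 (volume.restrict Ω) :=
      (hφ'.memLp_of_hasCompactSupport (hφc.fderiv_apply ℝ (unitVec i))).restrict Ω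
    have hdiff : ∫ x in Ω, (u x * fderiv ℝ φ x (unitVec i) + g x i * φ x)
        = ∫ x in Ω, ((u x - ψ x) * fderiv ℝ φ x (unitVec i) + (g x - gradient ψ x) i * φ x) := by
      rw [← sub_zero (∫ x in Ω, (u x * fderiv ℝ φ x (unitVec i) + g x i * φ x)), ← hzero,
        ← integral_sub]
      · congr 1; ext x; simp only [PiLp.sub_apply]; ring
      · exact (hu2.integrable_mul hφL').add (hgi.integrable_mul hφL)
      · refine (hbψ.integrable_mul hφL').add (MemLp.integrable_mul (p := 2) (q := 2) ?_ hφL)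
        simp only [gradient_apply]
        exact ((hψ' i).memLp_of_hasCompactSupport (hψc.fderiv_apply ℝ (unitVec i))).restrict Ω
    rw [hdiff]
    calc ‖∫ x in Ω, ((u x - ψ x) * fderiv ℝ φ x (unitVec i) + (g x - gradient ψ x) i * φ x)‖ₑ
        ≤ ∫⁻ x in Ω, ‖(u x - ψ x) * fderiv ℝ φ x (unitVec i) + (g x - gradient ψ x) i * φ x‖ₑ :=
          enorm_integral_le_lintegral_enorm _
      _ ≤ ∫⁻ x in Ω, ENNReal.ofReal M * (‖u x - ψ x‖ₑ + ‖g x - gradient ψ x‖ₑ) := by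
          refine lintegral_mono fun x => ?_
          refine (enorm_add_le _ _).trans ?_
          rw [mul_add, enorm_mul, enorm_mul, mul_comm, mul_comm (‖(g x - gradient ψ x) i‖ₑ)]
          have e1 : ‖fderiv ℝ φ x (unitVec i)‖ₑ ≤ ENNReal.ofReal M := by
            rw [← ofReal_norm]
            exact ENNReal.ofReal_le_ofReal ((hM₂ x).trans (le_max_right _ _))
          have e2 : ‖φ x‖ₑ ≤ ENNReal.ofReal M := by
            rw [← ofReal_norm]
            exact ENNReal.ofReal_le_ofReal ((hM₁ x).trans (le_max_left _ _))
          have e3 : ‖(g x - gradient ψ x) i‖ₑ ≤ ‖g x - gradient ψ x‖ₑ := by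
            rw [← ofReal_norm, ← ofReal_norm]
            exact ENNReal.ofReal_le_ofReal (PiLp.norm_apply_le _ i)
          gcongr
      _ = ENNReal.ofReal M
          * ((∫⁻ x in Ω, ‖u x - ψ x‖ₑ) + (∫⁻ x in Ω, ‖g x - gradient ψ x‖ₑ)) := by
          rw [lintegral_const_mul' _ _ ENNReal.ofReal_ne_top, lintegral_add_left' hint1.1.enorm]
      _ ≤ ENNReal.ofReal M * (ε * V + ε * V) := by
          gcongr
          · exact hA1.trans (mul_le_mul_left hA _)
          · exact hB1.trans (mul_le_mul_left hB _)
      _ = ENNReal.ofReal M * (2 * V) * ε := by ring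
  have hlim : Tendsto (fun ε : ℝ≥0∞ => ENNReal.ofReal M * (2 * V) * ε) (𝓝[>] 0)
      (𝓝 (ENNReal.ofReal M * (2 * V) * 0)) := by
    refine (ENNReal.Tendsto.const_mul tendsto_id (Or.inr ?_)).mono_left nhdsWithin_le_nhds
    exact ENNReal.mul_ne_top ENNReal.ofReal_ne_top (ENNReal.mul_ne_top (by norm_num) hV)
  have hle := ge_of_tendsto hlim (by filter_upwards [self_mem_nhdsWithin] with ε hε using key ε hε)
  rw [mul_zero, nonpos_iff_eq_zero, enorm_eq_zero] at hle
  exact hle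

namespace Triangulation

variable {Ω : Set Plane} {T : Triangulation Ω}

/-- For a function in `H¹₀(Ω)` that is given by polynomials on the open triangles, the boundary
contributions of the individual triangles cancel. -/
theorem sum_integral_fderiv_mul (hΩ : IsLipschitzDomain Ω) {u : Plane → ℝ} (hu : MemH10 Ω u)
    {P : Finset Plane → MvPolynomial (Fin 2) ℝ}
    (hP : ∀ K ∈ T.cells, ∀ x ∈ interior (hull K), u x = polyFun (P K) x)
    {φ : Plane → ℝ} (hφ : ContDiff ℝ ∞ φ) (hφc : HasCompactSupport φ) (i : Fin 2) :
    ∑ K ∈ T.cells, ∫ x in interior (hull K),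
      fderiv ℝ (fun y => polyFun (P K) y * φ y) x (unitVec i) = 0 := by
  obtain ⟨g, hu2, hg2, hw, hext⟩ := exists_weakGradient_extension hΩ hu
  have hfin : volume Ω < ⊤ := hΩ.isBounded.measure_lt_top
  have : IsFiniteMeasure (volume.restrict Ω) := ⟨by rwa [Measure.restrict_apply_univ]⟩
  have hgi : MemLp (fun x => g x i) 2 (volume.restrict Ω) := by
    refine hg2.of_le ?_ (Eventually.of_forall fun x => ?_)
    · have hc : Continuous fun y : Plane => y i := by fun_prop
      exact hc.comp_aestronglyMeasurable hg2.1
    · exact PiLp.norm_apply_le _ i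
  have hgint : IntegrableOn (fun x => g x i) Ω := hgi.integrable (by norm_num)
  -- the weak gradient is the classical one inside each triangle
  have hae : ∀ K ∈ T.cells, ∀ᵐ x ∂volume, x ∈ interior (hull K) →
      g x i = polyFun (MvPolynomial.pderiv i (P K)) x := by
    intro K hK
    have hsub := interior_hull_subset hΩ hK
    have h1 : ∀ᵐ x ∂volume, x ∈ interior (hull K) →
        g x i - polyFun (MvPolynomial.pderiv i (P K)) x = 0 := by
      apply isOpen_interior.ae_eq_zero_of_integral_contDiff_smul_eq_zero
      · refine LocallyIntegrableOn.sub ?_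
            ((continuous_polyFun _).locallyIntegrable.locallyIntegrableOn _)
        exact (hgint.mono_set hsub).locallyIntegrableOn
      · intro χ hχ hχc hχs
        have hχ' : Continuous fun x => fderiv ℝ χ x (unitVec i) := by
          have := hχ.continuous_fderiv (by simp)
          fun_prop
        have h0 : ∀ x, x ∉ interior (hull K) → χ x = 0 := fun x hx =>
          image_eq_zero_of_notMem_tsupport fun h => hx (hχs h)
        have h0' : ∀ x, x ∉ interior (hull K) → fderiv ℝ χ x (unitVec i) = 0 := fun x hx => by
          have : fderiv ℝ χ x = 0 :=
            image_eq_zero_of_notMem_tsupport fun h => hx (hχs (tsupport_fderiv_subset ℝ h))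
          rw [this]; rfl
        have h2 := hw χ ⟨hχ, hχc, hχs.trans hsub⟩ i
        rw [setIntegral_eq_of_subset_of_forall_sdiff_eq_zero (s := interior (hull K))
          hΩ.isOpen.measurableSet hsub (fun x hx => by rw [h0' x hx.2, mul_zero]),
          setIntegral_eq_of_subset_of_forall_sdiff_eq_zero (s := interior (hull K))
          hΩ.isOpen.measurableSet hsub (fun x hx => by rw [h0 x hx.2, mul_zero]),
          setIntegral_congr_fun (g := fun x => polyFun (P K) x * fderiv ℝ χ x (unitVec i))
            isOpen_interior.measurableSet (fun x hx => by simp only [hP K hK x hx]),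
          setIntegral_eq_integral_of_forall_compl_eq_zero (fun x hx => by rw [h0' x hx, mul_zero]),
          setIntegral_eq_integral_of_forall_compl_eq_zero (fun x hx => by rw [h0 x hx, mul_zero]),
          integral_mul_fderiv (contDiff_polyFun _) hχ hχc] at h2
        simp only [fderiv_polyFun, neg_inj, smul_eq_mul] at h2 ⊢
        have h3 : (fun x => χ x * (g x i - polyFun (MvPolynomial.pderiv i (P K)) x))
            = fun x => g x i * χ x - polyFun (MvPolynomial.pderiv i (P K)) x * χ x := by
          ext x; ring
        rw [h3, integral_sub, h2, sub_self]
        · have hb := hχc.exists_bound_of_continuous hχ.continuous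
          obtain ⟨M, hM⟩ := hb
          have h4 : IntegrableOn (fun x => g x i * χ x) (interior (hull K)) :=
            (hgint.mono_set hsub).mul_bdd (c := M) hχ.continuous.aestronglyMeasurable
              (Eventually.of_forall hM)
          refine (integrableOn_iff_integrable_of_support_subset ?_).1 h4
          intro x hx
          by_contra hcon
          exact hx (by simp only [h0 x hcon, mul_zero])
        · exact ((continuous_polyFun _).mul hχ.continuous).integrable_of_hasCompactSupport
            hχc.mul_left
    filter_upwards [h1] with x hx hxK using sub_eq_zero.1 (hx hxK)
  have hφ' : Continuous fun x => fderiv ℝ φ x (unitVec i) := by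
    have := hφ.continuous_fderiv (by simp)
    fun_prop
  have hfd : ∀ K, ∀ x, fderiv ℝ (fun y => polyFun (P K) y * φ y) x (unitVec i)
      = polyFun (P K) x * fderiv ℝ φ x (unitVec i)
        + polyFun (MvPolynomial.pderiv i (P K)) x * φ x := by
    intro K x
    rw [fderiv_fun_mul (differentiable_polyFun _ x) (hφ.differentiable (by simp) x),
        ← fderiv_polyFun]
    simp [mul_comm]
  have hcongr : ∀ K ∈ T.cells, ∀ᵐ x ∂volume, x ∈ interior (hull K) →
      u x * fderiv ℝ φ x (unitVec i) + g x i * φ x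
        = fderiv ℝ (fun y => polyFun (P K) y * φ y) x (unitVec i) := by
    intro K hK
    filter_upwards [hae K hK] with x hx hxK
    rw [hfd, hx hxK, hP K hK x hxK]
  rw [← hext φ hφ hφc i, integral_eq_sum (T := T) hΩ]
  · refine Finset.sum_congr rfl fun K hK => (setIntegral_congr_ae isOpen_interior.measurableSet ?_)
    filter_upwards [hcongr K hK] with x hx hxK using (hx hxK).symm
  · intro K hK
    have h5 : IntegrableOn (fun x => fderiv ℝ (fun y => polyFun (P K) y * φ y) x (unitVec i))
        (interior (hull K)) := by
      refine integrableOn_interior_of_eq (g := fun x => polyFun (P K) x * fderiv ℝ φ x (unitVec i)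
        + polyFun (MvPolynomial.pderiv i (P K)) x * φ x) ?_ fun x _ => hfd K x
      exact ((continuous_polyFun _).mul hφ').add ((continuous_polyFun _).mul hφ.continuous)
    refine IntegrableOn.congr_fun_ae h5 ?_
    rw [EventuallyEq, ae_restrict_iff' isOpen_interior.measurableSet]
    filter_upwards [hcongr K hK] with x hx hxK using (hx hxK).symm

end Triangulation

/-! ### Traces on edges -/

theorem plane_eq_sum_unitVec (v : Plane) : v = v 0 • unitVec 0 + v 1 • unitVec 1 := by
  ext i; fin_cases i <;> simp [unitVec]

/-- Near a boundary point of a half plane there is a smooth bump with a partial derivative whose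
integral over the half plane does not vanish. Otherwise, translating a bump out of the half plane
would not change its integral over the half plane. -/
theorem exists_integral_halfPlane_fderiv_ne_zero {e z x₀ : Plane} (he : e ≠ 0)
    (hx₀ : cross e (x₀ - z) = 0) {r : ℝ} (hr : 0 < r) :
    ∃ ψ : Plane → ℝ, ContDiff ℝ ∞ ψ ∧ HasCompactSupport ψ ∧ tsupport ψ ⊆ Metric.ball x₀ r ∧
      ∃ i : Fin 2, ∫ x in {x : Plane | 0 < cross e (x - z)}, fderiv ℝ ψ x (unitVec i) ≠ 0 := by
  by_contra hcon
  push Not at hcon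
  have hen : 0 < ‖e‖ := norm_pos_iff.2 he
  set H : Set Plane := {x | 0 < cross e (x - z)} with hH
  have hHo : IsOpen H := isOpen_lt (by fun_prop) (by fun_prop)
  set ρ := r / 4 with hρ
  have hρ0 : 0 < ρ := by positivity
  set d : Plane := ‖e‖⁻¹ • rot e with hd
  have hdn : ‖d‖ = 1 := by
    rw [hd, norm_smul, norm_inv, norm_norm, norm_rot, inv_mul_cancel₀ hen.ne']
  let bump : ContDiffBump x₀ := ⟨ρ / 2, ρ, by positivity, by linarith⟩
  have hbs : ContDiff ℝ ∞ bump := bump.contDiff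
  have hfc : Continuous (fderiv ℝ bump) := hbs.continuous_fderiv (by simp)
  set B := Metric.closedBall x₀ r with hB
  have hts : ∀ t : ℝ, tsupport (fun x => bump (x + t • d)) ⊆ Metric.closedBall (x₀ - t • d) ρ := by
    intro t
    refine closure_minimal (fun x hx => ?_) Metric.isClosed_closedBall
    have : x + t • d ∈ Function.support bump := hx
    rw [bump.support_eq, Metric.mem_ball, dist_eq_norm] at this
    rw [Metric.mem_closedBall, dist_eq_norm]
    have h2 : x - (x₀ - t • d) = x + t • d - x₀ := by abel
    rw [h2]; exact this.le
  have hball : ∀ t ∈ Set.Icc 0 ρ, Metric.closedBall (x₀ - t • d) ρ ⊆ Metric.ball x₀ r := by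
    intro t ht x hx
    rw [Metric.mem_closedBall, dist_eq_norm] at hx
    rw [Metric.mem_ball, dist_eq_norm]
    have h1 : x - x₀ = (x - (x₀ - t • d)) - t • d := by abel
    have h2 : ‖t • d‖ ≤ ρ := by
      rw [norm_smul, hdn, mul_one, Real.norm_eq_abs, abs_of_nonneg ht.1]; exact ht.2
    calc ‖x - x₀‖ ≤ ‖x - (x₀ - t • d)‖ + ‖t • d‖ := by rw [h1]; exact norm_sub_le _ _
      _ < r := by linarith
  -- the integral of the translated bump; its derivative is an integral as in the claim
  set f : ℝ → ℝ := fun t => ∫ x in H ∩ B, bump (x + t • d) with hf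
  have hfin : IsFiniteMeasure (volume.restrict (H ∩ B)) := by
    refine ⟨?_⟩
    rw [Measure.restrict_apply_univ]
    exact (measure_mono Set.inter_subset_right).trans_lt Metric.isBounded_closedBall.measure_lt_top
  obtain ⟨M, hM⟩ := (bump.hasCompactSupport.fderiv ℝ).exists_bound_of_continuous hfc
  have hcd : ∀ x : Plane, ∀ t : ℝ, HasDerivAt (fun t : ℝ => bump (x + t • d))
      (fderiv ℝ bump (x + t • d) d) t := by
    intro x t
    have h1 : HasFDerivAt bump (fderiv ℝ bump (x + t • d)) (x + t • d) :=
      (hbs.differentiable (by simp) _).hasFDerivAt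
    have h2 : HasDerivAt (fun t : ℝ => x + t • d) d t := by
      simpa using ((hasDerivAt_id t).smul_const d).const_add x
    exact HasFDerivAt.comp_hasDerivAt (l := fun x => bump x) (f := fun t : ℝ => x + t • d) t h1 h2
  have hderiv : ∀ t, HasDerivAt f (∫ x in H ∩ B, fderiv ℝ bump (x + t • d) d) t := by
    intro t
    refine (hasDerivAt_integral_of_dominated_loc_of_deriv_le (μ := volume.restrict (H ∩ B))
      (F := fun t x => bump (x + t • d)) (F' := fun t x => fderiv ℝ bump (x + t • d) d)
      (bound := fun _ => M) (s := Set.univ) univ_mem ?_ ?_ ?_ ?_ (integrable_const M) ?_).2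
    · refine Eventually.of_forall fun s => ?_
      exact (bump.continuous.comp (by fun_prop)).aestronglyMeasurable
    · refine Integrable.of_bound (C := 1) ?_ (Eventually.of_forall fun x => ?_)
      · exact (bump.continuous.comp (by fun_prop)).aestronglyMeasurable
      · rw [Real.norm_eq_abs, abs_of_nonneg bump.nonneg]; exact bump.le_one
    · have : Continuous fun x => fderiv ℝ bump (x + t • d) d := by fun_prop
      exact this.aestronglyMeasurable
    · refine Eventually.of_forall fun x s _ => ?_
      refine (ContinuousLinearMap.le_opNorm _ _).trans ?_
      rw [hdn, mul_one]; exact hM _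
    · exact Eventually.of_forall fun x s _ => hcd x s
  have hzero : ∀ t ∈ Set.Icc 0 ρ, ∫ x in H ∩ B, fderiv ℝ bump (x + t • d) d = 0 := by
    intro t ht
    set ψ : Plane → ℝ := fun x => bump (x + t • d) with hψ
    have hψs : ContDiff ℝ ∞ ψ := hbs.comp (by fun_prop)
    have hψt : tsupport ψ ⊆ Metric.ball x₀ r := (hts t).trans (hball t ht)
    have hψc : HasCompactSupport ψ :=
      (isCompact_closedBall _ _).of_isClosed_subset (isClosed_tsupport _) (hts t)
    have hfψ : ∀ x, fderiv ℝ bump (x + t • d) = fderiv ℝ ψ x := by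
      intro x; rw [hψ, fderiv_comp_add_right]
    have hψ' : Continuous (fderiv ℝ ψ) := hψs.continuous_fderiv (by simp)
    have hint : ∀ i, IntegrableOn (fun x => fderiv ℝ ψ x (unitVec i)) H := by
      intro i
      have : Continuous fun x => fderiv ℝ ψ x (unitVec i) := by fun_prop
      exact (this.integrable_of_hasCompactSupport (hψc.fderiv_apply ℝ _)).integrableOn
    have h1 : ∫ x in H ∩ B, fderiv ℝ ψ x d = ∫ x in H, fderiv ℝ ψ x d := by
      symm
      refine setIntegral_eq_of_subset_of_forall_sdiff_eq_zero hHo.measurableSet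
        Set.inter_subset_left fun x hx => ?_
      have hxB : x ∉ B := fun h => hx.2 ⟨hx.1, h⟩
      have : fderiv ℝ ψ x = 0 := image_eq_zero_of_notMem_tsupport fun h =>
        hxB (Metric.ball_subset_closedBall (hψt (tsupport_fderiv_subset ℝ h)))
      rw [this]; rfl
    simp only [hfψ]
    rw [h1]
    have h2 : ∀ x, fderiv ℝ ψ x d = d 0 * fderiv ℝ ψ x (unitVec 0)
        + d 1 * fderiv ℝ ψ x (unitVec 1) := by
      intro x
      conv_lhs => rw [plane_eq_sum_unitVec d]
      simp
    simp only [h2]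
    rw [integral_add ((hint 0).const_mul _) ((hint 1).const_mul _), integral_const_mul,
      integral_const_mul, hcon ψ hψs hψc hψt 0, hcon ψ hψs hψc hψt 1]
    simp
  have hconst : f ρ = f 0 := by
    refine constant_of_has_deriv_right_zero (a := 0) (b := ρ) ?_ ?_ ρ ⟨hρ0.le, le_rfl⟩
    · exact fun t _ => (hderiv t).continuousAt.continuousWithinAt
    · intro t ht
      have := (hderiv t).hasDerivWithinAt (s := Set.Ici t)
      rwa [hzero t ⟨ht.1, ht.2.le⟩] at this
  -- after the full translation, the bump has left the half plane
  have hfρ : f ρ = 0 := by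
    refine setIntegral_eq_zero_of_forall_eq_zero fun x hx => ?_
    by_contra hne
    have hmem : x + ρ • d ∈ Function.support bump := hne
    rw [bump.support_eq, Metric.mem_ball, dist_eq_norm] at hmem
    have h1 : 0 < cross e (x - z) := hx.1
    have h2 : cross e (x + ρ • d - x₀) = cross e (x - z) + ρ * ‖e‖ := by
      have : x + ρ • d - x₀ = (x - z) + (ρ * ‖e‖⁻¹) • rot e + (-1 : ℝ) • (x₀ - z) := by
        rw [hd, smul_smul]; module
      rw [this, cross_add_right, cross_add_right, cross_smul_right, cross_smul_right,
          hx₀, cross_rot]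
      field_simp
      ring
    have h3 := (le_abs_self _).trans (abs_cross_le e (x + ρ • d - x₀))
    rw [h2] at h3
    have h4 : ‖e‖ * ‖x + ρ • d - x₀‖ < ‖e‖ * ρ := mul_lt_mul_of_pos_left hmem hen
    linarith
  have hf0 : 0 < f 0 := by
    have h1 : IntegrableOn (fun x => bump (x + (0 : ℝ) • d)) (H ∩ B) := by
      refine Integrable.of_bound (C := 1) ?_ (Eventually.of_forall fun x => ?_)
      · exact (bump.continuous.comp (by fun_prop)).aestronglyMeasurable
      · rw [Real.norm_eq_abs, abs_of_nonneg bump.nonneg]; exact bump.le_one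
    rw [hf]
    refine (setIntegral_pos_iff_support_of_nonneg_ae
      (Eventually.of_forall fun x => bump.nonneg) h1).2 ?_
    have hsub : Metric.ball x₀ ρ ∩ H ⊆ Function.support (fun x => bump (x + (0 : ℝ) • d))
        ∩ (H ∩ B) := by
      rintro x ⟨hx1, hx2⟩
      refine ⟨?_, hx2, ?_⟩
      · have : x ∈ Function.support bump := by rw [bump.support_eq]; exact hx1
        simpa using this
      · exact Metric.closedBall_subset_closedBall (by linarith) (Metric.ball_subset_closedBall hx1)
    refine lt_of_lt_of_le ?_ (measure_mono hsub)
    refine (Metric.isOpen_ball.inter hHo).measure_pos _ ?_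
    refine ⟨x₀ + (ρ / 2) • d, ?_, ?_⟩
    · rw [Metric.mem_ball, dist_eq_norm, add_sub_cancel_left, norm_smul, hdn, mul_one,
        Real.norm_eq_abs, abs_of_pos (by linarith)]
      linarith
    · change 0 < cross e (x₀ + (ρ / 2) • d - z)
      have : x₀ + (ρ / 2) • d - z = (x₀ - z) + (ρ / 2 * ‖e‖⁻¹) • rot e := by
        rw [hd, smul_smul]; module
      rw [this, cross_add_right, hx₀, cross_smul_right, cross_rot]
      positivity
  linarith

/-- A polynomial whose products with test functions satisfy integration by parts over a half plane
without boundary term vanishes on the boundary line: if it did not, every test function near the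
given point of the line would be such a product. -/
theorem polyFun_eq_zero_of_halfPlane {e z x₀ : Plane} (he : e ≠ 0) (hx₀ : cross e (x₀ - z) = 0)
    (Q : MvPolynomial (Fin 2) ℝ)
    (h : ∀ᶠ r in 𝓝[>] (0 : ℝ), ∀ φ : Plane → ℝ, ContDiff ℝ ∞ φ → HasCompactSupport φ →
      tsupport φ ⊆ Metric.ball x₀ r → ∀ i : Fin 2, ∫ x in {x : Plane | 0 < cross e (x - z)},
        fderiv ℝ (fun y => polyFun Q y * φ y) x (unitVec i) = 0) :
    polyFun Q x₀ = 0 := by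
  by_contra hne
  have hopen : IsOpen {x | polyFun Q x ≠ 0} := isOpen_ne_fun (continuous_polyFun Q) continuous_const
  obtain ⟨r', hr', hsub⟩ := Metric.isOpen_iff.1 hopen x₀ hne
  obtain ⟨r, ⟨hr, hrr'⟩, hr0⟩ := ((h.and (Ioo_mem_nhdsGT hr')).and self_mem_nhdsWithin).exists
  obtain ⟨ψ, hψ, hψc, hψs, i, hi⟩ := exists_integral_halfPlane_fderiv_ne_zero he hx₀ (r := r) hr0
  have hne' : ∀ x ∈ tsupport ψ, polyFun Q x ≠ 0 := fun x hx =>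
    hsub (Metric.ball_subset_ball hrr'.2.le (hψs hx))
  have hsupp : tsupport (fun x => ψ x / polyFun Q x) ⊆ tsupport ψ := by
    refine closure_mono fun x hx => ?_
    intro h0
    exact hx (by simp only [h0, zero_div])
  have hsm : ContDiff ℝ ∞ fun x => ψ x / polyFun Q x := by
    rw [contDiff_iff_contDiffAt]
    intro x
    by_cases hx : x ∈ tsupport ψ
    · exact hψ.contDiffAt.div (contDiff_polyFun Q).contDiffAt (hne' x hx)
    · have : (fun x => ψ x / polyFun Q x) =ᶠ[𝓝 x] fun _ => 0 := by
        filter_upwards [(isClosed_tsupport ψ).isOpen_compl.mem_nhds hx] with y hy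
        rw [image_eq_zero_of_notMem_tsupport hy, zero_div]
      exact contDiffAt_const.congr_of_eventuallyEq this
  apply hi
  have := hr (fun x => ψ x / polyFun Q x) hsm
    (hψc.of_isClosed_subset (isClosed_tsupport _) hsupp) (hsupp.trans hψs) i
  have heq : (fun y => polyFun Q y * (ψ y / polyFun Q y)) = ψ := by
    ext y
    by_cases hy : y ∈ tsupport ψ
    · exact mul_div_cancel₀ _ (hne' y hy)
    · rw [image_eq_zero_of_notMem_tsupport hy]; simp
  rwa [heq] at this

/-- A polynomial that vanishes on an edge has a vanishing derivative along the edge. -/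
theorem fderiv_polyFun_eq_zero_of_edge {Q : MvPolynomial (Fin 2) ℝ} {z p : Plane}
    (h : ∀ s : ℝ, 0 < s → s < 1 → polyFun Q (z + s • (p - z)) = 0) :
    fderiv ℝ (polyFun Q) z (p - z) = 0 := by
  have h1 : HasDerivAt (fun s : ℝ => polyFun Q (z + s • (p - z)))
      (fderiv ℝ (polyFun Q) z (p - z)) 0 := by
    have h2 : HasDerivAt (fun s : ℝ => z + s • (p - z)) (p - z) 0 := by
      simpa using ((hasDerivAt_id (0 : ℝ)).smul_const (p - z)).const_add z
    have h3 : HasFDerivAt (polyFun Q) (fderiv ℝ (polyFun Q) z) (z + (0 : ℝ) • (p - z)) := by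
      simpa using (differentiable_polyFun Q z).hasFDerivAt
    exact h3.comp_hasDerivAt 0 h2
  have hc : Continuous fun s : ℝ => polyFun Q (z + s • (p - z)) := by fun_prop
  have h0 : polyFun Q (z + (0 : ℝ) • (p - z)) = 0 := by
    have hlim := (hc.tendsto 0).mono_left (nhdsWithin_le_nhds (s := Set.Ioi 0))
    refine tendsto_nhds_unique hlim (tendsto_const_nhds.congr' ?_)
    filter_upwards [Ioo_mem_nhdsGT (zero_lt_one (α := ℝ))] with s hs using (h s hs.1 hs.2).symm
  have h4 : HasDerivWithinAt (fun s : ℝ => polyFun Q (z + s • (p - z))) 0 (Set.Ioi 0) 0 := by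
    refine (hasDerivWithinAt_const (0 : ℝ) (Set.Ioi 0) (0 : ℝ)).congr_of_eventuallyEq ?_ h0
    filter_upwards [Ioo_mem_nhdsGT (zero_lt_one (α := ℝ))] with s hs using h s hs.1 hs.2
  exact (uniqueDiffWithinAt_Ioi 0).eq_deriv _ h1.hasDerivWithinAt h4

namespace Triangulation

variable {Ω : Set Plane} {T : Triangulation Ω}

theorem IsLeft.not_isLeft_swap {K : Finset Plane} {z p : Plane} (h : IsLeft K z p) :
    ¬ IsLeft K p z := by
  intro h'
  have h1 := (h.eventually_mem (s := 1 / 2) (by norm_num) (by norm_num))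
  have h2 := (h'.eventually_mem (s := 1 / 2) (by norm_num) (by norm_num))
  rw [show p + (1 / 2 : ℝ) • (z - p) = z + (1 / 2 : ℝ) • (p - z) by module] at h2
  obtain ⟨ε, hε, h4, h5⟩ := exists_small_add_smul_mem (mem_interior_iff_mem_nhds.2 (h1.and h2))
      (rot (p - z))
  have hpos : 0 < cross (p - z) (z + (1 / 2 : ℝ) • (p - z) + ε • rot (p - z) - z) := by
    rw [show z + (1 / 2 : ℝ) • (p - z) + ε • rot (p - z) - z
      = (1 / 2 : ℝ) • (p - z) + ε • rot (p - z) by module, cross_add_right, cross_smul_right,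
      cross_smul_right, cross_self, cross_rot]
    have : 0 < ‖p - z‖ := norm_pos_iff.2 (sub_ne_zero.2 h.ne)
    positivity
  have h6 := h5.1 (h4.2 hpos)
  have : cross (z - p) (z + (1 / 2 : ℝ) • (p - z) + ε • rot (p - z) - p)
    = -cross (p - z) (z + (1 / 2 : ℝ) • (p - z) + ε • rot (p - z) - z) := by
    simp only [cross, PiLp.sub_apply]; ring
  linarith

theorem fderiv_apply_eq_zero_of_notMem_tsupport {φ : Plane → ℝ} {Q : MvPolynomial (Fin 2) ℝ}
    {x : Plane} (hx : x ∉ tsupport φ) (v : Plane) :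
    fderiv ℝ (fun y => polyFun Q y * φ y) x v = 0 := by
  have h1 : fderiv ℝ (fun y => polyFun Q y * φ y) x = 0 := by
    refine image_eq_zero_of_notMem_tsupport fun h => hx ?_
    exact closure_mono (Function.support_mul_subset_right _ _) (tsupport_fderiv_subset ℝ h)
  rw [h1]; rfl

/-- The trace of a piecewise polynomial function in `H¹₀(Ω)` on an edge does not depend on the side.
Here `R` is the polynomial on the right of the edge, or zero if there is no triangle. -/
theorem trace_eq_on_edge (hΩ : IsLipschitzDomain Ω) {u : Plane → ℝ} (hu : MemH10 Ω u)
    {P : Finset Plane → MvPolynomial (Fin 2) ℝ}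
    (hP : ∀ K ∈ T.cells, ∀ x ∈ interior (hull K), u x = polyFun (P K) x)
    {K : Finset Plane} (hK : K ∈ T.cells) {z p : Plane} (hKl : IsLeft K z p)
    {R : MvPolynomial (Fin 2) ℝ} (hR : ∀ L ∈ T.cells, IsLeft L p z → P L = R)
    (hR' : (∀ L ∈ T.cells, ¬ IsLeft L p z) → R = 0) {s : ℝ} (hs0 : 0 < s) (hs1 : s < 1) :
    polyFun (P K) (z + s • (p - z)) = polyFun R (z + s • (p - z)) := by
  set x₀ := z + s • (p - z) with hx₀
  have hzp := hKl.ne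
  rw [← sub_eq_zero, ← polyFun_sub]
  refine polyFun_eq_zero_of_halfPlane (e := p - z) (z := z) (sub_ne_zero.2 hzp) ?_ _ ?_
  · rw [hx₀, add_sub_cancel_left, cross_smul_right, cross_self, mul_zero]
  have hKloc := hKl.eventually_mem hs0 hs1
  have hedge := eventually_mem_edge hK hKl.left_mem hKl.right_mem hzp hs0 hs1
  have hright : ∀ᶠ x in 𝓝 x₀, ∀ L ∈ T.cells, IsLeft L p z →
      (x ∈ interior (hull L) ↔ cross (p - z) (x - z) < 0) := by
    rw [Finset.eventually_all]
    intro L hL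
    by_cases hLl : IsLeft L p z
    · have := hLl.eventually_mem (s := 1 - s) (by linarith) (by linarith)
      rw [show p + (1 - s) • (z - p) = x₀ by rw [hx₀]; module] at this
      filter_upwards [this] with x hx _
      rw [hx]
      have : cross (z - p) (x - p) = -cross (p - z) (x - z) := by
        simp only [cross, PiLp.sub_apply]; ring
      rw [this, neg_pos]
    · exact Eventually.of_forall fun _ h => absurd h hLl
  -- in a small disc, `K` is the left half disc and a triangle to the right is the right half disc
  obtain ⟨r₀, hr₀, hloc⟩ := Metric.eventually_nhds_iff_ball.1 (hKloc.and (hedge.and hright))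
  filter_upwards [Ioo_mem_nhdsGT hr₀] with r hr φ hφ hφc hφs i
  have hφs' : ∀ x ∈ tsupport φ, x ∈ Metric.ball x₀ r₀ := fun x hx =>
    Metric.ball_subset_ball hr.2.le (hφs hx)
  set F : MvPolynomial (Fin 2) ℝ → Plane → ℝ := fun Q x =>
    fderiv ℝ (fun y => polyFun Q y * φ y) x (unitVec i) with hF
  have hF0 : ∀ Q x, x ∉ tsupport φ → F Q x = 0 := fun Q x hx =>
    fderiv_apply_eq_zero_of_notMem_tsupport hx _
  have hFc : ∀ Q, Continuous (F Q) := by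
    intro Q
    have h1 : ContDiff ℝ ∞ fun y => polyFun Q y * φ y := (contDiff_polyFun Q).mul hφ
    have := h1.continuous_fderiv (by simp)
    simp only [hF]
    fun_prop
  have hFi : ∀ Q, Integrable (F Q) := by
    intro Q
    refine (hFc Q).integrable_of_hasCompactSupport ?_
    exact HasCompactSupport.fderiv_apply ℝ hφc.mul_left _
  have hFR : ∫ x, F R x = 0 := by
    have h1 : ContDiff ℝ ∞ fun y => polyFun R y * φ y := (contDiff_polyFun R).mul hφ
    have h2 := integral_mul_fderiv (f := fun _ => 1) contDiff_const h1 hφc.mul_left (unitVec i)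
    simpa [hF] using h2
  set H : Set Plane := {x | 0 < cross (p - z) (x - z)} with hH
  set H' : Set Plane := {x | cross (p - z) (x - z) < 0} with hH'
  have hHo : IsOpen H := isOpen_lt (by fun_prop) (by fun_prop)
  have hHo' : IsOpen H' := isOpen_lt (by fun_prop) (by fun_prop)
  -- sets that agree on the support of the test function give the same integral
  have hset : ∀ (Q : MvPolynomial (Fin 2) ℝ) (A B : Set Plane), MeasurableSet A → MeasurableSet B →
      (∀ x ∈ Metric.ball x₀ r₀, x ∈ A ↔ x ∈ B) → ∫ x in A, F Q x = ∫ x in B, F Q x := by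
    intro Q A B hA hB hAB
    rw [← integral_indicator hA, ← integral_indicator hB]
    congr 1
    ext x
    by_cases hx : x ∈ tsupport φ
    · by_cases hxA : x ∈ A
      · rw [Set.indicator_of_mem hxA, Set.indicator_of_mem ((hAB x (hφs' x hx)).1 hxA)]
      · rw [Set.indicator_of_notMem hxA,
          Set.indicator_of_notMem (mt (hAB x (hφs' x hx)).2 hxA)]
    · by_cases hxA : x ∈ A <;> by_cases hxB : x ∈ B <;> simp [hxA, hxB, hF0 Q x hx]
  have hsum := sum_integral_fderiv_mul hΩ hu hP hφ hφc i
  change ∑ L ∈ T.cells, ∫ x in interior (hull L), F (P L) x = 0 at hsum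
  have hKint : ∫ x in interior (hull K), F (P K) x = ∫ x in H, F (P K) x :=
    hset _ _ _ isOpen_interior.measurableSet hHo.measurableSet fun x hx => (hloc x hx).1
  -- all other triangles stay away from the edge
  have hother : ∀ L ∈ T.cells, ¬ IsLeft L z p → ¬ IsLeft L p z →
      ∫ x in interior (hull L), F (P L) x = 0 := by
    intro L hL h1 h2
    refine setIntegral_eq_zero_of_forall_eq_zero fun x hx => hF0 _ _ fun hxt => ?_
    obtain ⟨hz, hp⟩ := (hloc x (hφs' x hxt)).2.1 L hL (interior_subset hx)
    exact (isLeft_or_isLeft hL hz hp hzp).elim h1 h2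
  have hRint : ∑ L ∈ T.cells.erase K, ∫ x in interior (hull L), F (P L) x = ∫ x in H', F R x := by
    by_cases hex : ∃ L ∈ T.cells, IsLeft L p z
    · obtain ⟨L, hL, hLl⟩ := hex
      have hLK : L ≠ K := by rintro rfl; exact hKl.not_isLeft_swap hLl
      rw [Finset.sum_eq_single_of_mem L (Finset.mem_erase.2 ⟨hLK, hL⟩), hR L hL hLl]
      · exact hset _ _ _ isOpen_interior.measurableSet hHo'.measurableSet
          fun x hx => (hloc x hx).2.2 L hL hLl
      · intro L' hL' hne
        obtain ⟨h1, h2⟩ := Finset.mem_erase.1 hL'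
        exact hother L' h2 (fun h => h1 (h.unique h2 hK hKl)) (fun h => hne (h.unique h2 hL hLl))
    · push Not at hex
      rw [hR' hex, Finset.sum_eq_zero]
      · simp [hF, polyFun]
      · intro L' hL'
        obtain ⟨h1, h2⟩ := Finset.mem_erase.1 hL'
        exact hother L' h2 (fun h => h1 (h.unique h2 hK hKl)) (hex L' h2)
  rw [← Finset.add_sum_erase _ _ hK, hKint, hRint] at hsum
  -- the boundary line is a null set
  have hline : volume {x : Plane | cross (p - z) (x - z) = 0} = 0 := by
    have hconv : Convex ℝ H := by
      intro x hx y hy a b ha hb hab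
      have e : a • x + b • y - z = a • (x - z) + b • (y - z) := by
        rw [eq_sub_of_add_eq hab]; module
      simp only [hH, Set.mem_ofPred_eq] at hx hy ⊢
      rw [e, cross_add_right, cross_smul_right, cross_smul_right]
      rcases ha.eq_or_lt with rfl | ha
      · rw [zero_add] at hab; rw [hab]; linarith
      · nlinarith [mul_pos ha hx, mul_nonneg hb hy.le]
    refine measure_mono_null (fun x hx => ?_) (hconv.addHaar_frontier volume)
    simp only [Set.mem_ofPred_eq] at hx
    refine ⟨?_, ?_⟩
    · have hc : Continuous fun t : ℝ => x + t • rot (p - z) := by fun_prop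
      have hlim : Tendsto (fun t : ℝ => x + t • rot (p - z)) (𝓝[>] 0) (𝓝 x) := by
        simpa using (hc.tendsto 0).mono_left nhdsWithin_le_nhds
      refine mem_closure_of_tendsto hlim ?_
      filter_upwards [self_mem_nhdsWithin] with t ht
      have ht0 : (0 : ℝ) < t := ht
      change 0 < cross (p - z) (x + t • rot (p - z) - z)
      rw [show x + t • rot (p - z) - z = (x - z) + t • rot (p - z) by module, cross_add_right,
        cross_smul_right, hx, cross_rot]
      have : 0 < ‖p - z‖ := norm_pos_iff.2 (sub_ne_zero.2 hzp)
      positivity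
    · rw [hHo.interior_eq]
      intro hxH
      have : 0 < cross (p - z) (x - z) := hxH
      linarith
  -- replace the integral over the right half plane by one over the left
  have hsplit : (∫ x in H, F R x) + (∫ x in H', F R x) = 0 := by
    have hcompl : H' =ᵐ[volume] (Hᶜ : Set Plane) := by
      filter_upwards [measure_eq_zero_iff_ae_notMem.1 hline] with x hx
      apply propext
      change cross (p - z) (x - z) < 0 ↔ ¬ (0 < cross (p - z) (x - z))
      rw [not_lt]
      exact ⟨le_of_lt, fun h => lt_of_le_of_ne h hx⟩
    rw [setIntegral_congr_set hcompl, integral_add_compl hHo.measurableSet (hFi R), hFR]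
  have hFsub : ∀ x, fderiv ℝ (fun y => polyFun (P K - R) y * φ y) x (unitVec i)
      = F (P K) x - F R x := by
    intro x
    have h1 : (fun y => polyFun (P K - R) y * φ y)
        = fun y => polyFun (P K) y * φ y - polyFun R y * φ y := by
      ext y; rw [polyFun_sub]; ring
    have hd : DifferentiableAt ℝ φ x := hφ.differentiable (by simp) x
    rw [h1, fderiv_fun_sub ((differentiable_polyFun _ x).fun_mul hd)
      ((differentiable_polyFun _ x).fun_mul hd)]
    rfl
  simp only [hFsub]
  rw [integral_sub (hFi _).integrableOn (hFi _).integrableOn]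
  linarith

end Triangulation

/-! ### The triangles at a vertex -/

/-- Around an inner ray, two successive sectors cover a neighbourhood. -/
theorem eventually_mem_sectors {a b c x : Plane} (hab : 0 < cross a b) (hbc : 0 < cross b c)
    {t : ℝ} (ht : 0 < t) (hx : x = t • b) :
    ∀ᶠ y in 𝓝 x, (0 ≤ cross a y ∧ 0 ≤ cross y b) ∨ (0 ≤ cross b y ∧ 0 ≤ cross y c) := by
  have h1 : ∀ᶠ y in 𝓝 x, 0 < cross a y := by
    have hc : Continuous fun y => cross a y := by fun_prop
    refine (hc.tendsto x).eventually_const_lt ?_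
    rw [hx, cross_smul_right]; positivity
  have h2 : ∀ᶠ y in 𝓝 x, 0 < cross y c := by
    have hc : Continuous fun y => cross y c := by fun_prop
    refine (hc.tendsto x).eventually_const_lt ?_
    rw [hx, cross_smul_left]; positivity
  filter_upwards [h1, h2] with y h3 h4
  rcases le_total 0 (cross b y) with h | h
  · exact Or.inr ⟨h, h4.le⟩
  · refine Or.inl ⟨h3.le, ?_⟩
    rw [cross_swap]; linarith

/-- A closed chain of counterclockwise sectors covers the plane: the union of the sectors without
the apex is open and closed in the punctured plane, which is connected. -/
theorem exists_sector_of_closed_chain {a : ℕ → Plane} {N : ℕ} (hN : 0 < N)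
    (ha : ∀ j < N, 0 < cross (a j) (a (j + 1))) (hclosed : a N = a 0) (x : Plane) :
    ∃ j < N, 0 ≤ cross (a j) x ∧ 0 ≤ cross x (a (j + 1)) := by
  set S : Set Plane := {x | ∃ j < N, 0 ≤ cross (a j) x ∧ 0 ≤ cross x (a (j + 1))} with hS
  have hSc : IsClosed S := by
    have : S = ⋃ j ∈ Finset.range N, {x | 0 ≤ cross (a j) x} ∩ {x | 0 ≤ cross x (a (j + 1))} := by
      ext x; simp [hS]; tauto
    rw [this]
    refine isClosed_biUnion_finset fun j _ => IsClosed.inter ?_ ?_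
    · exact isClosed_le (by fun_prop) (by fun_prop)
    · exact isClosed_le (by fun_prop) (by fun_prop)
  have hray : ∀ j ≤ N, ∀ t : ℝ, 0 < t → t • a j ∈ interior S := by
    -- by closedness of the chain, each ray has a predecessor and a successor
    have key : ∀ i j, i < N → j < N → a (i + 1) = a j → ∀ t : ℝ, 0 < t → t • a j ∈ interior S := by
      intro i j hi hj hij t ht
      rw [mem_interior_iff_mem_nhds]
      have h1 : 0 < cross (a i) (a j) := by rw [← hij]; exact ha i hi
      filter_upwards [eventually_mem_sectors h1 (ha j hj) ht rfl] with y hy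
      rcases hy with ⟨h2, h3⟩ | ⟨h2, h3⟩
      · exact ⟨i, hi, h2, by rwa [hij]⟩
      · exact ⟨j, hj, h2, h3⟩
    intro j hj t ht
    rcases Nat.eq_zero_or_pos j with rfl | h0
    · exact key (N - 1) 0 (by omega) hN (by rw [Nat.sub_add_cancel hN, hclosed]) t ht
    · rcases hj.eq_or_lt with rfl | hj
      · rw [hclosed]
        exact key (j - 1) 0 (by omega) hN (by rw [Nat.sub_add_cancel hN, hclosed]) t ht
      · exact key (j - 1) j (by omega) hj (by rw [Nat.sub_add_cancel h0]) t ht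
  -- a point of a sector is on one of its two rays or inside the sector
  have hint : ∀ x ∈ S, x ≠ 0 → x ∈ interior S := by
    rintro x ⟨j, hj, h1, h2⟩ hx
    have hD := ha j hj
    have hdec := cross_decomp (a j) (a (j + 1)) x
    have hxe : x = (cross (a j) (a (j + 1)))⁻¹
        • (cross x (a (j + 1)) • a j + cross (a j) x • a (j + 1)) := by
      rw [← hdec, smul_smul, inv_mul_cancel₀ hD.ne', one_smul]
    rcases h1.eq_or_lt with h1 | h1
    · rw [← h1, zero_smul, add_zero, smul_smul] at hxe
      have h3 : 0 < cross x (a (j + 1)) := by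
        refine lt_of_le_of_ne h2 fun h => hx ?_
        rw [hxe, ← h]; simp
      rw [hxe]
      exact hray j hj.le _ (by positivity)
    · rcases h2.eq_or_lt with h2 | h2
      · rw [← h2, zero_smul, zero_add, smul_smul] at hxe
        rw [hxe]
        exact hray (j + 1) hj _ (by positivity)
      · rw [mem_interior_iff_mem_nhds]
        have o1 : IsOpen {y : Plane | 0 < cross (a j) y} := isOpen_lt (by fun_prop) (by fun_prop)
        have o2 : IsOpen {y : Plane | 0 < cross y (a (j + 1))} :=
            isOpen_lt (by fun_prop) (by fun_prop)
        filter_upwards [o1.mem_nhds h1, o2.mem_nhds h2] with y h3 h4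
        exact ⟨j, hj, le_of_lt h3, le_of_lt h4⟩
  have hconn : IsPreconnected ({0}ᶜ : Set Plane) := by
    refine (isConnected_compl_singleton_of_one_lt_rank ?_ 0).isPreconnected
    rw [← Module.finrank_eq_rank]
    simp
  have hsub : ({0}ᶜ : Set Plane) ⊆ interior S := by
    refine hconn.subset_left_of_subset_union isOpen_interior hSc.isOpen_compl ?_ ?_ ?_
    · exact Set.disjoint_left.2 fun y h1 h2 => h2 (interior_subset h1)
    · intro y hy
      by_cases h : y ∈ S
      · exact Or.inl (hint y h hy)
      · exact Or.inr h
    · have h0 := (ne_zero_of_cross_pos (ha 0 hN)).1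
      refine ⟨a 0, h0, ?_⟩
      simpa using hray 0 hN.le 1 one_pos
  by_cases hx : x = 0
  · exact ⟨0, hN, by simp [hx, cross]⟩
  · have : x ∈ S := interior_subset (hsub hx)
    exact this

namespace Triangulation

variable {Ω : Set Plane} {T : Triangulation Ω}

theorem shape_le {γ : ℝ} (hγ : T.shapeRegularity ≤ γ) {K : Finset Plane} (hK : K ∈ T.cells) :
    Metric.diam (hull K) / inscribedDiam K ≤ γ := by
  refine le_trans ?_ hγ
  exact le_ciSup (f := fun K : T.cells => Metric.diam (hull K.1) / inscribedDiam K.1)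
    (Set.finite_range _).bddAbove ⟨K, hK⟩

namespace Numbering

variable {z : Plane} (ν : T.Numbering z)

theorem cell_mem_patch {j : ℕ} (hj : j < T.patchCard z) : ν.cell j ∈ T.patch z := by
  have := ν.bijOn.mapsTo hj
  exact this

theorem cell_mem {j : ℕ} (hj : j < T.patchCard z) : ν.cell j ∈ T.cells := by
  classical
  have := ν.cell_mem_patch hj
  rw [patch, Finset.mem_filter] at this
  exact this.1

theorem cell_inj {i j : ℕ} (hi : i < T.patchCard z) (hj : j < T.patchCard z)
    (h : ν.cell i = ν.cell j) : i = j := ν.bijOn.injOn hi hj h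

theorem exists_cell {K : Finset Plane} (hK : K ∈ T.cells) (hz : z ∈ K) :
    ∃ j < T.patchCard z, ν.cell j = K := by
  classical
  have h1 : K ∈ (T.patch z : Set (Finset Plane)) := by
    rw [Finset.mem_coe, patch, Finset.mem_filter]; exact ⟨hK, hz⟩
  exact ν.bijOn.surjOn h1

theorem mem_cell (j : ℕ) : z ∈ ν.cell j := by simp [cell]

theorem isLeft_cell {j : ℕ} (hj : j < T.patchCard z) : IsLeft (ν.cell j) z (ν.p j) :=
  ⟨ν.p (j + 1), rfl, ν.ccw j hj⟩

theorem isLeft_cell_swap {j : ℕ} (hj : j < T.patchCard z) : IsLeft (ν.cell j) (ν.p (j + 1)) z := by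
  classical
  refine ⟨ν.p j, ?_, ?_⟩
  · ext x; simp only [cell, Finset.mem_insert, Finset.mem_singleton]; tauto
  · have := ν.ccw j hj
    have h : cross (z - ν.p (j + 1)) (ν.p j - ν.p (j + 1))
        = cross (ν.p j - z) (ν.p (j + 1) - z) := by
      simp only [cross, PiLp.sub_apply]; ring
    rwa [h]

theorem patchCard_pos (hz : z ∈ T.vertices) : 0 < T.patchCard z := by
  classical
  rw [vertices, Finset.mem_biUnion] at hz
  obtain ⟨K, hK, hzK⟩ := hz
  rw [patchCard, Finset.card_pos]
  refine ⟨K, ?_⟩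
  rw [patch, Finset.mem_filter]
  exact ⟨hK, hzK⟩

theorem norm_mul_norm_le {γ : ℝ} (hγ : T.shapeRegularity ≤ γ) {j : ℕ} (hj : j < T.patchCard z) :
    ‖ν.p j - z‖ * ‖ν.p (j + 1) - z‖ ≤ γ * cross (ν.p j - z) (ν.p (j + 1) - z) :=
  norm_mul_norm_le_of_shape (ν.ccw j hj) (shape_le hγ (ν.cell_mem hj))

/-- At a vertex outside the open domain the chain of triangles does not close up. -/
theorem last_ne_first (hΩ : IsLipschitzDomain Ω) (hN : 0 < T.patchCard z) (hz : z ∉ Ω) :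
    ν.p (T.patchCard z) ≠ ν.p 0 := by
  classical
  intro hclosed
  apply hz
  rw [← hΩ.interior_closure, mem_interior_iff_mem_nhds]
  have hsmall : ∀ᶠ x in 𝓝 z, ∀ j ∈ Finset.range (T.patchCard z),
      cross (ν.p j - z) (x - z) + cross (x - z) (ν.p (j + 1) - z)
        < cross (ν.p j - z) (ν.p (j + 1) - z) := by
    rw [Finset.eventually_all]
    intro j hj
    have hc : Continuous fun x => cross (ν.p j - z) (x - z) + cross (x - z) (ν.p (j + 1) - z) := by
      fun_prop
    refine (hc.tendsto z).eventually_lt_const ?_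
    simpa [cross] using ν.ccw j (Finset.mem_range.1 hj)
  filter_upwards [hsmall] with x hx
  obtain ⟨j, hj, h1, h2⟩ := exists_sector_of_closed_chain (a := fun j => ν.p j - z) hN ν.ccw
    (by simp only [hclosed]) (x - z)
  rw [← T.iUnion_eq]
  refine Set.mem_biUnion (ν.cell_mem hj) ?_
  exact (mem_hull_iff (ν.ccw j hj) x).2 ⟨h1, h2, (hx j (Finset.mem_range.2 hj)).le⟩

/-- The first edge at a boundary vertex is a boundary edge. -/
theorem not_isLeft_first (hΩ : IsLipschitzDomain Ω) (hN : 0 < T.patchCard z) (hz : z ∉ Ω)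
    {L : Finset Plane} (hL : L ∈ T.cells) : ¬ IsLeft L (ν.p 0) z := by
  classical
  intro h
  obtain ⟨i, hi, rfl⟩ := ν.exists_cell hL h.right_mem
  have hmem : ν.p 0 = z ∨ ν.p 0 = ν.p i ∨ ν.p 0 = ν.p (i + 1) := by simpa [cell] using h.left_mem
  rcases hmem with h0 | h0 | h0
  · exact h.ne h0.symm
  · rw [h0] at h
    exact (ν.isLeft_cell hi).not_isLeft_swap h
  · rcases Nat.lt_or_ge (i + 1) (T.patchCard z) with h1 | h1
    · have h2 := ν.isLeft_cell h1
      rw [← h0] at h2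
      have := ν.cell_inj h1 hN (h2.unique (ν.cell_mem h1) (ν.cell_mem hN) (ν.isLeft_cell hN))
      omega
    · have : i + 1 = T.patchCard z := by omega
      exact ν.last_ne_first hΩ hN hz (by rw [← this, h0])

/-- The last edge at a boundary vertex is a boundary edge. -/
theorem not_isLeft_last (hΩ : IsLipschitzDomain Ω) (hN : 0 < T.patchCard z) (hz : z ∉ Ω)
    {L : Finset Plane} (hL : L ∈ T.cells) : ¬ IsLeft L z (ν.p (T.patchCard z)) := by
  classical
  intro h
  obtain ⟨i, hi, rfl⟩ := ν.exists_cell hL h.left_mem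
  have hmem : ν.p (T.patchCard z) = z ∨ ν.p (T.patchCard z) = ν.p i
    ∨ ν.p (T.patchCard z) = ν.p (i + 1) := by simpa [cell] using h.right_mem
  have hlast := ν.isLeft_cell_swap (j := T.patchCard z - 1) (by omega)
  rw [Nat.sub_add_cancel hN] at hlast
  rcases hmem with h0 | h0 | h0
  · exact h.ne h0
  · rcases Nat.eq_zero_or_pos i with rfl | h1
    · exact ν.last_ne_first hΩ hN hz h0
    · have h2 := ν.isLeft_cell_swap (j := i - 1) (by omega)
      rw [Nat.sub_add_cancel h1, ← h0] at h2
      have := ν.cell_inj (by omega) (by omega)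
        (h2.unique (ν.cell_mem (by omega)) (ν.cell_mem (by omega)) hlast)
      omega
  · rw [h0] at h
    exact h.not_isLeft_swap (ν.isLeft_cell_swap hi)

theorem one_le_of_shape (ν : T.Numbering z) {γ : ℝ} (hγ : T.shapeRegularity ≤ γ)
    (hN : 0 < T.patchCard z) : 1 ≤ γ := by
  have h1 := ν.norm_mul_norm_le hγ hN
  have h2 := ν.ccw 0 hN
  have h3 := (le_abs_self _).trans (abs_cross_le (ν.p 0 - z) (ν.p (0 + 1) - z))
  by_contra hcon
  push Not at hcon
  nlinarith

/-- The number of triangles at a vertex is bounded: in a small disc of radius `2 r` around the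
vertex, each of them contains a disc of radius `r / (4 γ)`. -/
theorem patchCard_le (ν : T.Numbering z) {γ : ℝ} (hγ : T.shapeRegularity ≤ γ)
    (hN : 0 < T.patchCard z) :
    (T.patchCard z : ℝ) ≤ 64 * γ ^ 2 := by
  classical
  have hγ1 : 1 ≤ γ := ν.one_le_of_shape hγ hN
  have hγ0 : 0 < γ := by linarith
  set N := T.patchCard z with hNdef
  have hpos : ∀ j < N, 0 < ‖ν.p j - z‖ ∧ 0 < ‖ν.p (j + 1) - z‖ := fun j hj =>
    ⟨norm_pos_iff.2 (ne_zero_of_cross_pos (ν.ccw j hj)).1,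
      norm_pos_iff.2 (ne_zero_of_cross_pos (ν.ccw j hj)).2⟩
  have hr : ∀ᶠ r : ℝ in 𝓝[>] 0, ∀ j ∈ Finset.range N,
      r < ‖ν.p j - z‖ / 2 ∧ r < ‖ν.p (j + 1) - z‖ / 2 := by
    rw [Finset.eventually_all]
    intro j hj
    obtain ⟨h1, h2⟩ := hpos j (Finset.mem_range.1 hj)
    filter_upwards [Ioo_mem_nhdsGT (half_pos h1), Ioo_mem_nhdsGT (half_pos h2)] with r h3 h4
      using ⟨h3.2, h4.2⟩
  obtain ⟨r, hr, hr0⟩ := (hr.and self_mem_nhdsWithin).exists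
  have hr0 : 0 < r := hr0
  -- the centres of the small discs lie on the bisectors of the angles
  set c : ℕ → Plane := fun j => z + ((r / 2 * ‖ν.p j - z‖⁻¹) • (ν.p j - z)
    + (r / 2 * ‖ν.p (j + 1) - z‖⁻¹) • (ν.p (j + 1) - z)) with hc
  set ρ := r / (4 * γ) with hρ
  have hρ0 : 0 < ρ := by positivity
  have hρr : ρ ≤ r := by
    rw [hρ, div_le_iff₀ (by positivity)]; nlinarith
  have hin : ∀ j < N, Metric.ball (c j) ρ ⊆ interior (hull (ν.cell j)) := by
    intro j hj x hx
    obtain ⟨ha, hb⟩ := hpos j hj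
    obtain ⟨hra, hrb⟩ := hr j (Finset.mem_range.2 hj)
    have hD := ν.ccw j hj
    have hsh := ν.norm_mul_norm_le hγ hj
    rw [cell, interior_hull hD]
    rw [Metric.mem_ball, dist_eq_norm] at hx
    set a := ν.p j - z
    set b := ν.p (j + 1) - z
    set D := cross a b
    set δ := x - c j
    have hxz : x - z = (r / 2 * ‖a‖⁻¹) • a + (r / 2 * ‖b‖⁻¹) • b + δ := by
      simp only [δ, hc]; abel
    have e1 : cross a (x - z) = r / 2 * ‖b‖⁻¹ * D + cross a δ := by
      rw [hxz, cross_add_right, cross_add_right, cross_smul_right, cross_smul_right, cross_self]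
      ring
    have e2 : cross (x - z) b = r / 2 * ‖a‖⁻¹ * D + cross δ b := by
      rw [hxz, cross_add_left, cross_add_left, cross_smul_left, cross_smul_left, cross_self]; ring
    have d1 : |cross a δ| < ‖a‖ * ρ :=
      (abs_cross_le a δ).trans_lt (mul_lt_mul_of_pos_left hx ha)
    have d2 : |cross δ b| < ‖b‖ * ρ :=
      (abs_cross_le δ b).trans_lt (by rw [mul_comm]; exact mul_lt_mul_of_pos_left hx hb)
    -- the shape regularity in the form in which it is used
    have s1 : ‖a‖ * ρ ≤ r / 4 * ‖b‖⁻¹ * D := by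
      rw [hρ, ← sub_nonneg]
      have : r / 4 * ‖b‖⁻¹ * D - ‖a‖ * (r / (4 * γ))
        = r / (4 * γ * ‖b‖) * (γ * D - ‖a‖ * ‖b‖) := by field_simp
      rw [this]
      exact mul_nonneg (by positivity) (sub_nonneg.2 hsh)
    have s2 : ‖b‖ * ρ ≤ r / 4 * ‖a‖⁻¹ * D := by
      rw [hρ, ← sub_nonneg]
      have : r / 4 * ‖a‖⁻¹ * D - ‖b‖ * (r / (4 * γ))
        = r / (4 * γ * ‖a‖) * (γ * D - ‖a‖ * ‖b‖) := by field_simp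
      rw [this]
      exact mul_nonneg (by positivity) (sub_nonneg.2 hsh)
    have t1 : r * ‖b‖⁻¹ < 1 / 2 := by
      rw [← div_eq_mul_inv, div_lt_iff₀ hb]; linarith
    have t2 : r * ‖a‖⁻¹ < 1 / 2 := by
      rw [← div_eq_mul_inv, div_lt_iff₀ ha]; linarith
    have q1 : 0 < r / 4 * ‖b‖⁻¹ * D := by positivity
    have q2 : 0 < r / 4 * ‖a‖⁻¹ * D := by positivity
    have u1 : r / 4 * ‖b‖⁻¹ * D < D / 8 := by nlinarith
    have u2 : r / 4 * ‖a‖⁻¹ * D < D / 8 := by nlinarith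
    rw [abs_lt] at d1 d2
    refine ⟨?_, ?_, ?_⟩
    · change 0 < cross a (x - z); rw [e1]; linarith
    · change 0 < cross (x - z) b; rw [e2]; linarith
    · change cross a (x - z) + cross (x - z) b < D; rw [e1, e2]; linarith
  have hsub : ∀ j < N, Metric.ball (c j) ρ ⊆ Metric.ball z (2 * r) := by
    intro j hj x hx
    obtain ⟨ha, hb⟩ := hpos j hj
    rw [Metric.mem_ball, dist_eq_norm] at hx ⊢
    have h1 : ‖c j - z‖ ≤ r := by
      simp only [hc, add_sub_cancel_left]
      refine (norm_add_le _ _).trans ?_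
      rw [norm_smul, norm_smul, norm_mul, norm_mul, norm_inv, norm_inv, norm_norm, norm_norm,
        mul_assoc, mul_assoc, inv_mul_cancel₀ ha.ne', inv_mul_cancel₀ hb.ne', Real.norm_eq_abs,
        abs_of_pos (half_pos hr0)]
      linarith
    calc ‖x - z‖ = ‖(x - c j) + (c j - z)‖ := by congr 1; abel
      _ ≤ ‖x - c j‖ + ‖c j - z‖ := norm_add_le _ _
      _ < 2 * r := by linarith
  have hdisj : (Finset.range N : Set ℕ).PairwiseDisjoint fun j => Metric.ball (c j) ρ := by
    intro i hi j hj hij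
    have hi' : i < N := Finset.mem_range.1 hi
    have hj' : j < N := Finset.mem_range.1 hj
    have hne : ν.cell i ≠ ν.cell j := fun h => hij (ν.cell_inj hi' hj' h)
    exact ((T.disjoint_interior_hull (ν.cell_mem hi') (ν.cell_mem hj') hne).mono_right
      interior_subset).mono (hin i hi') (hin j hj')
  have hvol : ∑ j ∈ Finset.range N, volume (Metric.ball (c j) ρ)
      ≤ volume (Metric.ball z (2 * r)) := by
    rw [← measure_biUnion_finset hdisj fun j _ => measurableSet_ball]
    exact measure_mono (Set.iUnion₂_subset fun j hj => hsub j (Finset.mem_range.1 hj))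
  set V := volume (Metric.ball (0 : Plane) 1)
  have hV0 : V ≠ 0 := (Metric.measure_ball_pos volume (0 : Plane) one_pos).ne'
  have hVt : V ≠ ⊤ := Metric.isBounded_ball.measure_lt_top.ne
  have hball : ∀ (y : Plane) (s : ℝ), 0 < s → volume (Metric.ball y s)
      = ENNReal.ofReal (s ^ 2) * V := by
    intro y s hs
    have := Measure.addHaar_ball volume y hs.le
    rwa [finrank_euclideanSpace, Fintype.card_fin] at this
  simp only [hball _ ρ hρ0, hball z (2 * r) (by positivity), Finset.sum_const, Finset.card_range,
    nsmul_eq_mul] at hvol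
  rw [← mul_assoc, ENNReal.mul_le_mul_iff_left hV0 hVt, ← ENNReal.ofReal_natCast,
    ← ENNReal.ofReal_mul (by positivity), ENNReal.ofReal_le_ofReal_iff (by positivity), hρ] at hvol
  have h2 : (N : ℝ) * (r / (4 * γ)) ^ 2 = (N : ℝ) * (r ^ 2 / (16 * γ ^ 2)) := by
    rw [div_pow]; ring
  rw [h2, mul_div_assoc', div_le_iff₀ (by positivity)] at hvol
  have hr2 : 0 < r ^ 2 := by positivity
  nlinarith

end Numbering

end Triangulation

/-! ### The alternating sum of the divergence at a vertex -/

/-- The Jacobian at `z` of the vector field with polynomial components `P i`. -/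
def jac (P : Fin 2 → MvPolynomial (Fin 2) ℝ) (z : Plane) (d : Plane) : Plane :=
  !₂[fderiv ℝ (polyFun (P 0)) z d, fderiv ℝ (polyFun (P 1)) z d]

/-- The Frobenius norm of the Jacobian. -/
def jacNorm (P : Fin 2 → MvPolynomial (Fin 2) ℝ) (z : Plane) : ℝ :=
  Real.sqrt (∑ i : Fin 2, ∑ j : Fin 2, polyFun (MvPolynomial.pderiv j (P i)) z ^ 2)

theorem fderiv_polyFun_apply (P : MvPolynomial (Fin 2) ℝ) (z d : Plane) :
    fderiv ℝ (polyFun P) z d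
      = d 0 * polyFun (MvPolynomial.pderiv 0 P) z + d 1 * polyFun (MvPolynomial.pderiv 1 P) z := by
  conv_lhs => rw [show d = d 0 • unitVec 0 + d 1 • unitVec 1 from plane_eq_sum_unitVec d]
  rw [map_add, map_smul, map_smul, fderiv_polyFun, fderiv_polyFun, smul_eq_mul, smul_eq_mul]

theorem norm_jac_le (P : Fin 2 → MvPolynomial (Fin 2) ℝ) (z d : Plane) :
    ‖jac P z d‖ ≤ jacNorm P z * ‖d‖ := by
  have hsq : jacNorm P z ^ 2 = ∑ i : Fin 2, ∑ j : Fin 2,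
      polyFun (MvPolynomial.pderiv j (P i)) z ^ 2 :=
    Real.sq_sqrt (by positivity)
  have h : ‖jac P z d‖ ^ 2 ≤ (jacNorm P z * ‖d‖) ^ 2 := by
    rw [mul_pow, hsq, norm_sq_plane, norm_sq_plane]
    simp only [jac, fderiv_polyFun_apply, Fin.sum_univ_two]
    simp only [Matrix.cons_val_zero, Matrix.cons_val_one]
    set p := polyFun (MvPolynomial.pderiv 0 (P 0)) z
    set q := polyFun (MvPolynomial.pderiv 1 (P 0)) z
    set r := polyFun (MvPolynomial.pderiv 0 (P 1)) z
    set s := polyFun (MvPolynomial.pderiv 1 (P 1)) z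
    nlinarith [sq_nonneg (d 1 * p - d 0 * q), sq_nonneg (d 1 * r - d 0 * s)]
  exact (abs_le_of_sq_le_sq' h (mul_nonneg (Real.sqrt_nonneg _) (norm_nonneg _))).2

/-- The divergence in terms of the directional derivatives in two directions. -/
theorem div_eq_cross (P : Fin 2 → MvPolynomial (Fin 2) ℝ) (z : Plane) {a b : Plane}
    (h : 0 < cross a b) :
    ∑ i : Fin 2, polyFun (MvPolynomial.pderiv i (P i)) z
      = cross (jac P z a) b / cross a b + cross a (jac P z b) / cross a b := by
  rw [← add_div, eq_div_iff h.ne']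
  simp only [jac, cross, fderiv_polyFun_apply, Fin.sum_univ_two, PiLp.toLp_apply,
    Matrix.cons_val_zero, Matrix.cons_val_one]
  ring

/-- Summation by parts: the terms of successive triangles that belong to the same edge are put
together. -/
theorem sum_alternating_shift (f g : ℕ → ℝ) (n : ℕ) :
    ∑ j ∈ Finset.range (n + 1), (-1 : ℝ) ^ (j + 1) * (f j + g j)
      = -f 0 + (-1) ^ (n + 1) * g n + ∑ j ∈ Finset.range n, (-1 : ℝ) ^ j * (f (j + 1) - g j) := by
  induction n with
  | zero => simp; ring
  | succ n ih => rw [Finset.sum_range_succ, ih, Finset.sum_range_succ _ n]; ring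

/-- A chain of `N` sectors around a vertex, all pairs of which have an angle sum close to `π`, has
an even number of sectors if it closes up: every second ray nearly reverses its direction, so that
going around twice with `N` odd would reverse the direction of the initial ray. -/
theorem even_of_closed_chain {a : ℕ → Plane} {N : ℕ} (hN : 0 < N)
    (ha : ∀ j < N, 0 < cross (a j) (a (j + 1))) (hclosed : a N = a 0) {γ η : ℝ} (hγ : 0 < γ)
    (hsh : ∀ j < N, ‖a j‖ * ‖a (j + 1)‖ ≤ γ * cross (a j) (a (j + 1)))
    (hη : η * γ < 1) (hNη : N * η < 1)
    (hsing : ∀ j < N, |Real.sin (InnerProductGeometry.angle (a j) (a (j + 1))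
      + InnerProductGeometry.angle (a ((j + 1) % N)) (a ((j + 1) % N + 1)))| ≤ η) :
    Even N := by
  by_contra hodd
  rw [Nat.not_even_iff_odd] at hodd
  set b : ℕ → Plane := fun j => a (j % N) with hb
  have hb1 : ∀ j, a (j % N + 1) = b (j + 1) := by
    intro j
    simp only [hb]
    have hlt := Nat.mod_lt j hN
    have hmod : (j + 1) % N = (j % N + 1) % N := by simp
    rw [hmod]
    rcases Nat.lt_or_ge (j % N + 1) N with h | h
    · rw [Nat.mod_eq_of_lt h]
    · rw [show j % N + 1 = N by omega, Nat.mod_self, hclosed]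
  have hpos : ∀ j, 0 < cross (b j) (b (j + 1)) := by
    intro j; rw [← hb1]; exact ha _ (Nat.mod_lt j hN)
  have hstep : ∀ j, ‖‖b (j + 2)‖⁻¹ • b (j + 2) + ‖b j‖⁻¹ • b j‖ ≤ 2 * η := by
    intro j
    have h1 := hsing _ (Nat.mod_lt j hN)
    have h2 : (j % N + 1) % N = (j + 1) % N := by simp
    rw [h2, hb1, hb1] at h1
    refine norm_unit_add_le (hpos j) (hpos (j + 1)) (s := γ⁻¹) ?_ ?_ h1
    · rw [← one_div, lt_div_iff₀ hγ]; exact hη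
    · have h3 := sin_angle_mul (hpos (j + 1))
      have h4 := hsh _ (Nat.mod_lt (j + 1) hN)
      rw [hb1] at h4
      change ‖b (j + 1)‖ * _ ≤ γ * cross (b (j + 1)) _ at h4
      rw [← h3] at h4
      have h5 : 0 < ‖b (j + 1)‖ * ‖b (j + 1 + 1)‖ :=
        mul_pos (norm_pos_iff.2 (ne_zero_of_cross_pos (hpos (j + 1))).1)
          (norm_pos_iff.2 (ne_zero_of_cross_pos (hpos (j + 1))).2)
      rw [inv_le_iff_one_le_mul₀' hγ]
      by_contra hcon
      push Not at hcon
      nlinarith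
  -- after `i` double steps the direction is `(-1) ^ i` times the initial one, up to `2 i η`
  have hiter : ∀ i : ℕ, ‖‖b (2 * i)‖⁻¹ • b (2 * i) - (-1 : ℝ) ^ i • (‖b 0‖⁻¹ • b 0)‖
      ≤ 2 * i * η := by
    intro i
    induction i with
    | zero => simp
    | succ i ih =>
      have e : ‖b (2 * (i + 1))‖⁻¹ • b (2 * (i + 1)) - (-1 : ℝ) ^ (i + 1) • (‖b 0‖⁻¹ • b 0)
          = (‖b (2 * i + 2)‖⁻¹ • b (2 * i + 2) + ‖b (2 * i)‖⁻¹ • b (2 * i))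
            - (‖b (2 * i)‖⁻¹ • b (2 * i) - (-1 : ℝ) ^ i • (‖b 0‖⁻¹ • b 0)) := by
        rw [pow_succ, show 2 * (i + 1) = 2 * i + 2 by ring]; module
      rw [e]
      refine (norm_sub_le _ _).trans ?_
      have := hstep (2 * i)
      push_cast
      linarith
  have h1 := hiter N
  have h2 : b (2 * N) = b 0 := by simp [hb]
  rw [h2, hodd.neg_one_pow] at h1
  have hb0 : 0 < ‖b 0‖ := norm_pos_iff.2 (ne_zero_of_cross_pos (hpos 0)).1
  have h3 : ‖‖b 0‖⁻¹ • b 0 - (-1 : ℝ) • (‖b 0‖⁻¹ • b 0)‖ = 2 := by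
    rw [show ‖b 0‖⁻¹ • b 0 - (-1 : ℝ) • (‖b 0‖⁻¹ • b 0) = (2 * ‖b 0‖⁻¹) • b 0 by module, norm_smul,
      norm_mul, norm_inv, norm_norm, mul_assoc, inv_mul_cancel₀ hb0.ne']
    norm_num
  rw [h3] at h1
  linarith

namespace Triangulation

variable {Ω : Set Plane} {T : Triangulation Ω}

namespace Numbering

variable {z : Plane} (ν : T.Numbering z)

theorem abs_sin_le_singularity_of_mem (hz : z ∈ Ω) {j : ℕ} (hj : j < T.patchCard z) :
    |Real.sin (ν.theta j + ν.theta ((j + 1) % T.patchCard z))| ≤ ν.singularity := by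
  rw [singularity, if_pos hz]
  exact le_ciSup (f := fun j : Fin (T.patchCard z) =>
    |Real.sin (ν.theta (j : ℕ) + ν.theta (((j : ℕ) + 1) % T.patchCard z))|)
    (Set.finite_range _).bddAbove ⟨j, hj⟩

theorem abs_sin_le_singularity_of_notMem (hz : z ∉ Ω) {j : ℕ} (hj : j < T.patchCard z - 1) :
    |Real.sin (ν.theta j + ν.theta (j + 1))| ≤ ν.singularity := by
  rw [singularity, if_neg hz]
  exact le_ciSup (f := fun j : Fin (T.patchCard z - 1) =>
    |Real.sin (ν.theta (j : ℕ) + ν.theta ((j : ℕ) + 1))|)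
    (Set.finite_range _).bddAbove ⟨j, hj⟩

theorem altSum_eq (q : Plane → ℝ) {P : Finset Plane → MvPolynomial (Fin 2) ℝ}
    (hP : ∀ K ∈ T.cells, ∀ x ∈ interior (hull K), q x = polyFun (P K) x) :
    ν.altSum q = ∑ j ∈ Finset.range (T.patchCard z),
        (-1 : ℝ) ^ (j + 1) * polyFun (P (ν.cell j)) z := by
  refine Finset.sum_congr rfl fun j hj => ?_
  have hj' := ν.cell_mem (Finset.mem_range.1 hj)
  rw [T.traceAt_eq hj' (ν.mem_cell j) (hP _ hj')]

variable {P : Fin 2 → Finset Plane → MvPolynomial (Fin 2) ℝ} {v : Plane → Plane}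

/-- The derivative along an inner edge does not depend on the side. -/
theorem jac_eq_of_edge (hΩ : IsLipschitzDomain Ω) (hv : ∀ i, MemH10 Ω fun x => v x i)
    (hP : ∀ i, ∀ K ∈ T.cells, ∀ x ∈ interior (hull K), v x i = polyFun (P i K) x)
    {K L : Finset Plane} (hK : K ∈ T.cells) (hL : L ∈ T.cells) {p : Plane}
    (hKl : IsLeft K z p) (hLl : IsLeft L p z) :
    jac (fun i => P i K) z (p - z) = jac (fun i => P i L) z (p - z) := by
  have h : ∀ i, fderiv ℝ (polyFun (P i K)) z (p - z) = fderiv ℝ (polyFun (P i L)) z (p - z) := by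
    intro i
    have h1 : fderiv ℝ (polyFun (P i K - P i L)) z (p - z) = 0 := by
      apply fderiv_polyFun_eq_zero_of_edge
      intro s hs0 hs1
      rw [polyFun_sub, sub_eq_zero]
      exact trace_eq_on_edge hΩ (hv i) (hP i) hK hKl
        (fun L' hL' h => by rw [h.unique hL' hL hLl]) (fun h => absurd hLl (h L hL)) hs0 hs1
    rw [fderiv_polyFun_apply, map_sub, map_sub, polyFun_sub, polyFun_sub] at h1
    rw [fderiv_polyFun_apply, fderiv_polyFun_apply]
    linarith
  simp only [jac, h]

/-- The derivative along a boundary edge vanishes. -/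
theorem jac_eq_zero_of_boundary (hΩ : IsLipschitzDomain Ω) (hv : ∀ i, MemH10 Ω fun x => v x i)
    (hP : ∀ i, ∀ K ∈ T.cells, ∀ x ∈ interior (hull K), v x i = polyFun (P i K) x)
    {K : Finset Plane} (hK : K ∈ T.cells) {p : Plane}
    (hKl : (IsLeft K z p ∧ ∀ L ∈ T.cells, ¬ IsLeft L p z) ∨
      (IsLeft K p z ∧ ∀ L ∈ T.cells, ¬ IsLeft L z p)) :
    jac (fun i => P i K) z (p - z) = 0 := by
  have h : ∀ i, fderiv ℝ (polyFun (P i K)) z (p - z) = 0 := by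
    intro i
    apply fderiv_polyFun_eq_zero_of_edge
    intro s hs0 hs1
    have h0 : ∀ x, polyFun 0 x = 0 := fun x => by simp [polyFun]
    rcases hKl with ⟨h1, h2⟩ | ⟨h1, h2⟩
    · rw [trace_eq_on_edge hΩ (hv i) (hP i) hK h1 (R := 0) (fun L hL h => absurd h (h2 L hL))
        (fun _ => rfl) hs0 hs1, h0]
    · have := trace_eq_on_edge hΩ (hv i) (hP i) hK h1 (R := 0) (fun L hL h => absurd h (h2 L hL))
        (fun _ => rfl) (s := 1 - s) (by linarith) (by linarith)
      rw [h0] at this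
      rw [← this]
      congr 1
      module
  simp only [jac, h]
  ext i; fin_cases i <;> simp

/-- At a nearly singular vertex, the alternating sum of the divergence is small: in terms of the
derivatives along the edges, the contributions of each edge from its two sides nearly cancel. -/
theorem abs_altSum_div_le (hΩ : IsLipschitzDomain Ω) (hv : ∀ i, MemH10 Ω fun x => v x i)
    (hP : ∀ i, ∀ K ∈ T.cells, ∀ x ∈ interior (hull K), v x i = polyFun (P i K) x)
    (hz : z ∈ T.vertices) {γ η : ℝ} (hγ : T.shapeRegularity ≤ γ) (hη0 : 0 ≤ η) (hη₁ : η * γ < 1)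
    (hη₂ : 64 * γ ^ 2 * η < 1) (hs : ν.singularity ≤ η) :
    |∑ j ∈ Finset.range (T.patchCard z), (-1 : ℝ) ^ (j + 1) *
        ∑ i : Fin 2, polyFun (MvPolynomial.pderiv i (P i (ν.cell j))) z|
      ≤ η * γ ^ 2 * ∑ j ∈ Finset.range (T.patchCard z), jacNorm (fun i => P i (ν.cell j)) z := by
  have hN := patchCard_pos hz
  have hγ1 := ν.one_le_of_shape hγ hN
  have hcard := ν.patchCard_le hγ hN
  set N := T.patchCard z with hNdef
  set a : ℕ → Plane := fun j => ν.p j - z with ha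
  set J : ℕ → Plane → Plane := fun j => jac (fun i => P i (ν.cell j)) z with hJ
  set F : ℕ → ℝ := fun j => jacNorm (fun i => P i (ν.cell j)) z with hF
  have hF0 : ∀ j, 0 ≤ F j := fun j => Real.sqrt_nonneg _
  have hccw : ∀ j < N, 0 < cross (a j) (a (j + 1)) := ν.ccw
  have hsh : ∀ j < N, ‖a j‖ * ‖a (j + 1)‖ ≤ γ * cross (a j) (a (j + 1)) :=
    fun j hj => ν.norm_mul_norm_le hγ hj
  -- the contributions of the first and of the second edge of the triangle `j`
  set f : ℕ → ℝ := fun j => cross (J j (a j)) (a (j + 1)) / cross (a j) (a (j + 1)) with hf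
  set g : ℕ → ℝ := fun j => cross (a j) (J j (a (j + 1))) / cross (a j) (a (j + 1)) with hg
  have hsum : ∑ j ∈ Finset.range N, (-1 : ℝ) ^ (j + 1) *
        ∑ i : Fin 2, polyFun (MvPolynomial.pderiv i (P i (ν.cell j))) z
      = ∑ j ∈ Finset.range N, (-1 : ℝ) ^ (j + 1) * (f j + g j) := by
    refine Finset.sum_congr rfl fun j hj => ?_
    rw [div_eq_cross (fun i => P i (ν.cell j)) z (hccw j (Finset.mem_range.1 hj))]
  -- the contributions of the inner edge between the triangles `i` and `j`
  have hedge : ∀ i j, i < N → j < N → ν.p (i + 1) = ν.p j →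
      |Real.sin (ν.theta i + ν.theta j)| ≤ η → |f j - g i| ≤ η * γ ^ 2 * F i := by
    intro i j hi hj hij hsin
    have hij' : a (i + 1) = a j := by simp only [ha, hij]
    have hjac : J j (a j) = J i (a j) := by
      refine jac_eq_of_edge hΩ hv hP (ν.cell_mem hj) (ν.cell_mem hi) (ν.isLeft_cell hj) ?_
      rw [← hij]; exact ν.isLeft_cell_swap hi
    have h1 := hccw i hi
    have h2 := hsh i hi
    simp only [hf, hg]
    rw [hij'] at h1 h2 ⊢
    rw [hjac]
    refine (abs_edge_term_le h1 (hccw j hj) h2 (hsh j hj)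
      (norm_jac_le (fun k => P k (ν.cell i)) z (a j))).trans ?_
    have h3 : InnerProductGeometry.angle (a i) (a j) = ν.theta i := by rw [← hij']; rfl
    rw [h3, mul_assoc]
    exact mul_le_mul_of_nonneg_right hsin (mul_nonneg (sq_nonneg _) (hF0 i))
  obtain ⟨n, hn⟩ : ∃ n, N = n + 1 := ⟨N - 1, by omega⟩
  rw [hsum, hn, sum_alternating_shift]
  by_cases hzΩ : z ∈ Ω
  · have hclosed : ν.p N = ν.p 0 := ν.closed hzΩ
    have heven : Even N := by
      refine even_of_closed_chain hN hccw (by simp only [ha, hclosed]) (by linarith) hsh hη₁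
        ?_ fun j hj => ?_
      · calc (N : ℝ) * η ≤ 64 * γ ^ 2 * η := mul_le_mul_of_nonneg_right hcard hη0
          _ < 1 := hη₂
      · exact (ν.abs_sin_le_singularity_of_mem hzΩ hj).trans hs
    have hinner : ∀ j ∈ Finset.range n, |(-1 : ℝ) ^ j * (f (j + 1) - g j)| ≤ η * γ ^ 2 * F j := by
      intro j hj
      have hj' := Finset.mem_range.1 hj
      rw [abs_mul, abs_pow, abs_neg, abs_one, one_pow, one_mul]
      refine hedge j (j + 1) (by omega) (by omega) rfl ?_
      have := ν.abs_sin_le_singularity_of_mem hzΩ (j := j) (by omega)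
      rw [Nat.mod_eq_of_lt (by omega)] at this
      exact this.trans hs
    -- the edge shared by the last and the first triangle; its terms have opposite signs by parity
    have hlast : |f 0 - g n| ≤ η * γ ^ 2 * F n := by
      refine hedge n 0 (by omega) (by omega) (by rw [← hn, hclosed]) ?_
      have := ν.abs_sin_le_singularity_of_mem hzΩ (j := n) (by omega)
      rw [← hNdef, hn, Nat.mod_self] at this
      exact this.trans hs
    rw [← hn, heven.neg_one_pow, hn, Finset.sum_range_succ, mul_add, Finset.mul_sum]
    calc |-f 0 + 1 * g n + ∑ j ∈ Finset.range n, (-1 : ℝ) ^ j * (f (j + 1) - g j)|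
        ≤ |-f 0 + 1 * g n| + |∑ j ∈ Finset.range n, (-1 : ℝ) ^ j * (f (j + 1) - g j)| :=
            abs_add_le _ _
      _ ≤ η * γ ^ 2 * F n + ∑ j ∈ Finset.range n, η * γ ^ 2 * F j := by
          refine add_le_add ?_ ((Finset.abs_sum_le_sum_abs _ _).trans (Finset.sum_le_sum hinner))
          rwa [show -f 0 + 1 * g n = -(f 0 - g n) by ring, abs_neg]
      _ = _ := add_comm _ _
  -- at a boundary vertex, the terms of the first and the last edge vanish
  · have hf0 : f 0 = 0 := by
      have : J 0 (a 0) = 0 := jac_eq_zero_of_boundary hΩ hv hP (ν.cell_mem hN)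
        (Or.inl ⟨ν.isLeft_cell hN, fun L hL => ν.not_isLeft_first hΩ hN hzΩ hL⟩)
      simp only [hf, this]
      simp [cross]
    have hgn : g n = 0 := by
      have h1 := ν.isLeft_cell_swap (j := n) (by omega)
      have : J n (a (n + 1)) = 0 := jac_eq_zero_of_boundary hΩ hv hP (ν.cell_mem (by omega))
        (Or.inr ⟨h1, fun L hL => by
          have := ν.not_isLeft_last hΩ hN hzΩ hL
          rwa [← hNdef, hn] at this⟩)
      simp only [hg, this]
      simp [cross]
    have hinner : ∀ j ∈ Finset.range n, |(-1 : ℝ) ^ j * (f (j + 1) - g j)| ≤ η * γ ^ 2 * F j := by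
      intro j hj
      have hj' := Finset.mem_range.1 hj
      rw [abs_mul, abs_pow, abs_neg, abs_one, one_pow, one_mul]
      refine hedge j (j + 1) (by omega) (by omega) rfl ?_
      exact (ν.abs_sin_le_singularity_of_notMem hzΩ (by omega)).trans hs
    rw [hf0, hgn, mul_zero, neg_zero, zero_add, zero_add, Finset.sum_range_succ, mul_add,
      Finset.mul_sum]
    refine ((Finset.abs_sum_le_sum_abs _ _).trans (Finset.sum_le_sum hinner)).trans ?_
    have : 0 ≤ η * γ ^ 2 * F n := mul_nonneg (mul_nonneg hη0 (sq_nonneg _)) (hF0 n)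
    linarith

end Numbering

end Triangulation

/-! ### The space `H¹₀` and the velocity space are linear -/

/-- The approximation property of `H¹₀(Ω)` with separate bounds for the function and its
gradient. -/
theorem memH10_iff {Ω : Set Plane} {u : Plane → ℝ} : MemH10 Ω u ↔ ∃ g : Plane → Plane,
    MemLp u 2 (volume.restrict Ω) ∧ MemLp g 2 (volume.restrict Ω) ∧ HasWeakGradient Ω u g ∧
    ∀ δ : ℝ, 0 < δ → ∃ φ : Plane → ℝ, IsTestFunction Ω φ ∧
      eLpNorm (fun x => u x - φ x) 2 (volume.restrict Ω) ≤ ENNReal.ofReal δ ∧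
      eLpNorm (fun x => g x - gradient φ x) 2 (volume.restrict Ω) ≤ ENNReal.ofReal δ := by
  constructor
  · rintro ⟨g, h1, h2, h3, h4⟩
    refine ⟨g, h1, h2, h3, fun δ hδ => ?_⟩
    obtain ⟨φ, hφ, hlt⟩ := h4 (ENNReal.ofReal δ) (ENNReal.ofReal_pos.2 hδ)
    refine ⟨φ, hφ, ?_, ?_⟩
    · by_contra hcon
      push Not at hcon
      have := pow_le_pow_left₀ zero_le hcon.le 2
      exact absurd (this.trans le_self_add) (not_le.2 hlt)
    · by_contra hcon
      push Not at hcon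
      have := pow_le_pow_left₀ zero_le hcon.le 2
      exact absurd (this.trans le_add_self) (not_le.2 hlt)
  · rintro ⟨g, h1, h2, h3, h4⟩
    refine ⟨g, h1, h2, h3, fun ε hε => ?_⟩
    obtain ⟨δ, hδ, hδε⟩ : ∃ δ : ℝ, 0 < δ ∧ ENNReal.ofReal (2 * δ) < ε := by
      obtain ⟨r, hr0, hr⟩ := ENNReal.lt_iff_exists_nnreal_btwn.1 hε
      have hr0' : (0 : ℝ) < r := by exact_mod_cast hr0
      refine ⟨r / 2, by positivity, ?_⟩
      rw [mul_div_cancel₀ _ two_ne_zero, ENNReal.ofReal_coe_nnreal]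
      exact hr
    obtain ⟨φ, hφ, hA, hB⟩ := h4 δ hδ
    refine ⟨φ, hφ, ?_⟩
    calc _ ≤ ENNReal.ofReal δ ^ 2 + ENNReal.ofReal δ ^ 2 :=
          add_le_add (pow_le_pow_left₀ zero_le hA 2) (pow_le_pow_left₀ zero_le hB 2)
      _ ≤ ENNReal.ofReal (2 * δ) ^ 2 := by
          rw [← ENNReal.ofReal_pow hδ.le, ← ENNReal.ofReal_add (by positivity) (by positivity),
            ← ENNReal.ofReal_pow (by positivity)]
          apply ENNReal.ofReal_le_ofReal
          nlinarith
      _ < ε ^ 2 := by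
          exact ENNReal.pow_lt_pow_left two_ne_zero hδε

theorem IsTestFunction.add_smul {Ω : Set Plane} {φ ψ : Plane → ℝ} (hφ : IsTestFunction Ω φ)
    (hψ : IsTestFunction Ω ψ) (c : ℝ) : IsTestFunction Ω (fun x => φ x + c * ψ x) := by
  have hsub : tsupport (fun x => φ x + c * ψ x) ⊆ tsupport φ ∪ tsupport ψ := by
    refine closure_minimal (fun x hx => ?_) ((isClosed_tsupport φ).union (isClosed_tsupport ψ))
    by_contra hcon
    rw [Set.mem_union, not_or] at hcon
    apply hx
    simp [image_eq_zero_of_notMem_tsupport hcon.1, image_eq_zero_of_notMem_tsupport hcon.2]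
  refine ⟨hφ.1.add (contDiff_const.mul hψ.1), ?_, hsub.trans (Set.union_subset hφ.2.2 hψ.2.2)⟩
  exact (hφ.2.1.isCompact.union hψ.2.1.isCompact).of_isClosed_subset (isClosed_tsupport _) hsub

theorem gradient_add_mul {φ ψ : Plane → ℝ} (hφ : Differentiable ℝ φ) (hψ : Differentiable ℝ ψ)
    (c : ℝ) (x : Plane) :
    gradient (fun x => φ x + c * ψ x) x = gradient φ x + c • gradient ψ x := by
  ext i
  rw [gradient_apply, PiLp.add_apply, PiLp.smul_apply, gradient_apply, gradient_apply,
    fderiv_fun_add (hφ x) ((hψ x).const_mul c), fderiv_const_mul (hψ x)]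
  rfl

theorem IsTestFunction.memLp {Ω : Set Plane} {φ : Plane → ℝ} (hφ : IsTestFunction Ω φ) :
    MemLp φ 2 (volume.restrict Ω) :=
  (hφ.1.continuous.memLp_of_hasCompactSupport hφ.2.1).restrict Ω

theorem IsTestFunction.memLp_fderiv {Ω : Set Plane} {φ : Plane → ℝ} (hφ : IsTestFunction Ω φ)
    (v : Plane) : MemLp (fun x => fderiv ℝ φ x v) 2 (volume.restrict Ω) := by
  have hc : Continuous fun x => fderiv ℝ φ x v := by
    have := hφ.1.continuous_fderiv (by simp)
    fun_prop
  exact (hc.memLp_of_hasCompactSupport (hφ.2.1.fderiv_apply ℝ v)).restrict Ω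

theorem IsTestFunction.memLp_gradient {Ω : Set Plane} {φ : Plane → ℝ} (hφ : IsTestFunction Ω φ) :
    MemLp (gradient φ) 2 (volume.restrict Ω) := by
  have hc : Continuous (gradient φ) := by
    have := hφ.1.continuous_fderiv (by simp)
    unfold gradient
    fun_prop
  refine (hc.memLp_of_hasCompactSupport ?_).restrict Ω
  refine (hφ.2.1.fderiv ℝ).comp_left (g := (InnerProductSpace.toDual ℝ Plane).symm) ?_
  simp

theorem MemLp.apply_plane {μ : Measure Plane} {g : Plane → Plane} (hg : MemLp g 2 μ) (i : Fin 2) :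
    MemLp (fun x => g x i) 2 μ := by
  refine hg.of_le ?_ (Eventually.of_forall fun x => ?_)
  · have hc : Continuous fun y : Plane => y i := by fun_prop
    exact hc.comp_aestronglyMeasurable hg.1
  · exact PiLp.norm_apply_le _ i

theorem memH10_zero (Ω : Set Plane) : MemH10 Ω fun _ => 0 := by
  rw [memH10_iff]
  refine ⟨fun _ => 0, MemLp.zero', MemLp.zero', fun φ _ i => by simp, fun δ hδ =>
      ⟨fun _ => 0, ?_, ?_, ?_⟩⟩
  · refine ⟨contDiff_const, HasCompactSupport.zero, ?_⟩
    simp [tsupport]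
  · simp
  · have : gradient (fun _ : Plane => (0 : ℝ)) = 0 := by ext x i; rw [gradient_apply]; simp
    rw [this]; simp

theorem memH10_add_smul {Ω : Set Plane} {u w : Plane → ℝ} (hu : MemH10 Ω u) (hw : MemH10 Ω w)
    (c : ℝ) : MemH10 Ω fun x => u x + c * w x := by
  rw [memH10_iff] at hu hw ⊢
  obtain ⟨g, hu2, hg2, hug, happ⟩ := hu
  obtain ⟨g', hw2, hg2', hwg, happ'⟩ := hw
  refine ⟨fun x => g x + c • g' x, hu2.add (hw2.const_mul c), hg2.add (hg2'.const_smul c), ?_, ?_⟩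
  · intro φ hφ i
    have h1 := hug φ hφ i
    have h2 := hwg φ hφ i
    have e1 : ∀ x, (u x + c * w x) * fderiv ℝ φ x (unitVec i)
        = u x * fderiv ℝ φ x (unitVec i) + c * (w x * fderiv ℝ φ x (unitVec i)) := by intro x; ring
    have e2 : ∀ x, (g x + c • g' x) i * φ x = g x i * φ x + c * (g' x i * φ x) := by
      intro x; simp only [PiLp.add_apply, PiLp.smul_apply, smul_eq_mul]; ring
    simp only [e1, e2]
    rw [integral_add, integral_add, integral_const_mul, integral_const_mul, h1, h2]
    · ring
    · exact (MemLp.apply_plane hg2 i).integrable_mul hφ.memLp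
    · exact ((MemLp.apply_plane hg2' i).integrable_mul hφ.memLp).const_mul c
    · exact hu2.integrable_mul (hφ.memLp_fderiv _)
    · exact (hw2.integrable_mul (hφ.memLp_fderiv _)).const_mul c
  · intro δ hδ
    have hc : 0 < |c| + 1 := by positivity
    obtain ⟨φ, hφ, hA, hB⟩ := happ (δ / 2) (by positivity)
    obtain ⟨ψ, hψ, hA', hB'⟩ := happ' (δ / 2 / (|c| + 1)) (by positivity)
    have hsum : ENNReal.ofReal (δ / 2) + ‖c‖ₑ * ENNReal.ofReal (δ / 2 / (|c| + 1))
        ≤ ENNReal.ofReal δ := by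
      rw [← ofReal_norm, Real.norm_eq_abs, ← ENNReal.ofReal_mul (abs_nonneg c),
        ← ENNReal.ofReal_add (by positivity) (by positivity)]
      apply ENNReal.ofReal_le_ofReal
      have : |c| * (δ / 2 / (|c| + 1)) ≤ δ / 2 := by
        rw [mul_div_assoc', div_le_iff₀ hc]; nlinarith
      linarith
    refine ⟨fun x => φ x + c * ψ x, hφ.add_smul hψ c, ?_, ?_⟩
    · have e : (fun x => u x + c * w x - (φ x + c * ψ x))
          = (fun x => u x - φ x) + c • fun x => w x - ψ x := by
        ext x; simp only [Pi.add_apply, Pi.smul_apply, smul_eq_mul]; ring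
      rw [e]
      refine (eLpNorm_add_le (hu2.sub hφ.memLp).1 ((hw2.sub hψ.memLp).const_smul c).1
          (by norm_num)).trans ?_
      rw [eLpNorm_const_smul]
      exact (add_le_add hA (mul_le_mul' le_rfl hA')).trans hsum
    · have e : (fun x => g x + c • g' x - gradient (fun x => φ x + c * ψ x) x)
          = (fun x => g x - gradient φ x) + c • fun x => g' x - gradient ψ x := by
        ext1 x
        rw [gradient_add_mul (hφ.1.differentiable (by simp)) (hψ.1.differentiable (by simp))]
        simp only [Pi.add_apply, Pi.smul_apply]; module
      rw [e]
      refine (eLpNorm_add_le (hg2.sub hφ.memLp_gradient).1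
        ((hg2'.sub hψ.memLp_gradient).const_smul c).1 (by norm_num)).trans ?_
      rw [eLpNorm_const_smul]
      exact (add_le_add hB (mul_le_mul' le_rfl hB')).trans hsum

namespace Triangulation

variable {Ω : Set Plane} {T : Triangulation Ω}

/-- The vector field `v` has on each triangle `K` the polynomial components `P i K`. -/
def HasPolys (T : Triangulation Ω) (k : ℕ) (v : Plane → Plane)
    (P : Fin 2 → Finset Plane → MvPolynomial (Fin 2) ℝ) : Prop :=
  ∀ i, ∀ K ∈ T.cells, (P i K).totalDegree ≤ k ∧ ∀ x ∈ interior (hull K), v x i = polyFun (P i K) x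

theorem exists_hasPolys {k : ℕ} {v : Plane → Plane} (hv : v ∈ T.velocitySpace k) :
    ∃ P, T.HasPolys k v P := by
  have h : ∀ i : Fin 2, ∀ K : Finset Plane, ∃ P : MvPolynomial (Fin 2) ℝ, K ∈ T.cells →
      P.totalDegree ≤ k ∧ ∀ x ∈ interior (hull K), v x i = polyFun P x := by
    intro i K
    by_cases hK : K ∈ T.cells
    · obtain ⟨P, h1, h2⟩ := (hv i).1 K hK
      exact ⟨P, fun _ => ⟨h1, h2⟩⟩
    · exact ⟨0, fun h => absurd h hK⟩
  choose P hP using h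
  exact ⟨P, fun i K hK => hP i K hK⟩

theorem HasPolys.add_smul {k : ℕ} {v w : Plane → Plane}
    {P Q : Fin 2 → Finset Plane → MvPolynomial (Fin 2) ℝ} (hv : T.HasPolys k v P)
    (hw : T.HasPolys k w Q) (c : ℝ) :
    T.HasPolys k (v + c • w) (fun i K => P i K + MvPolynomial.C c * Q i K) := by
  intro i K hK
  refine ⟨(MvPolynomial.totalDegree_add _ _).trans (max_le (hv i K hK).1 ?_), fun x hx => ?_⟩
  · refine (MvPolynomial.totalDegree_mul _ _).trans ?_
    rw [MvPolynomial.totalDegree_C, zero_add]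
    exact (hw i K hK).1
  · rw [polyFun_add, ← (hv i K hK).2 x hx]
    have : polyFun (MvPolynomial.C c * Q i K) x = c * polyFun (Q i K) x := by simp [polyFun]
    rw [this, ← (hw i K hK).2 x hx]
    rfl

theorem velocitySpace_add_smul {k : ℕ} {v w : Plane → Plane} (hv : v ∈ T.velocitySpace k)
    (hw : w ∈ T.velocitySpace k) (c : ℝ) : v + c • w ∈ T.velocitySpace k := by
  obtain ⟨P, hP⟩ := exists_hasPolys hv
  obtain ⟨Q, hQ⟩ := exists_hasPolys hw
  have h := hP.add_smul hQ c
  intro i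
  exact ⟨fun K hK => ⟨_, h i K hK⟩, memH10_add_smul (hv i).2 (hw i).2 c⟩

theorem zero_mem_velocitySpace (k : ℕ) : (0 : Plane → Plane) ∈ T.velocitySpace k :=
  fun _ => ⟨fun _ _ => ⟨0, by simp, fun _ _ => by simp⟩, memH10_zero Ω⟩

theorem partialDeriv_eq {k : ℕ} {v : Plane → Plane}
    {P : Fin 2 → Finset Plane → MvPolynomial (Fin 2) ℝ} (hv : T.HasPolys k v P)
    {K : Finset Plane} (hK : K ∈ T.cells) {x : Plane} (hx : x ∈ interior (hull K)) (i j : Fin 2) :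
    partialDeriv v i j x = polyFun (MvPolynomial.pderiv j (P i K)) x := by
  rw [partialDeriv, ← fderiv_polyFun]
  congr 1
  apply Filter.EventuallyEq.fderiv_eq
  filter_upwards [isOpen_interior.mem_nhds hx] with y hy using (hv i K hK).2 y hy

/-- The divergence, on the triangle `K`, of the vector field with components `P i K`. -/
def divPoly (P : Fin 2 → Finset Plane → MvPolynomial (Fin 2) ℝ) (K : Finset Plane) :
    MvPolynomial (Fin 2) ℝ := ∑ i : Fin 2, MvPolynomial.pderiv i (P i K)

theorem polyFun_sum {ι : Type*} (s : Finset ι) (P : ι → MvPolynomial (Fin 2) ℝ) (x : Plane) :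
    polyFun (∑ i ∈ s, P i) x = ∑ i ∈ s, polyFun (P i) x := by simp [polyFun]

theorem div_eq {k : ℕ} {v : Plane → Plane}
    {P : Fin 2 → Finset Plane → MvPolynomial (Fin 2) ℝ} (hv : T.HasPolys k v P)
    {K : Finset Plane} (hK : K ∈ T.cells) {x : Plane} (hx : x ∈ interior (hull K)) :
    div v x = polyFun (divPoly P K) x := by
  rw [divPoly, polyFun_sum, div]
  exact Finset.sum_congr rfl fun i _ => partialDeriv_eq hv hK hx i i

theorem totalDegree_divPoly_le {k : ℕ} {v : Plane → Plane}
    {P : Fin 2 → Finset Plane → MvPolynomial (Fin 2) ℝ} (hv : T.HasPolys k v P)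
    {K : Finset Plane} (hK : K ∈ T.cells) : (divPoly P K).totalDegree ≤ k - 1 :=
  MvPolynomial.totalDegree_finsetSum_le fun i _ => totalDegree_pderiv_le _ _ (hv i K hK).1

theorem altSum_div_eq {k : ℕ} {v : Plane → Plane}
    {P : Fin 2 → Finset Plane → MvPolynomial (Fin 2) ℝ} (hv : T.HasPolys k v P) {z : Plane}
    (ν : T.Numbering z) :
    ν.altSum (div v) = ∑ j ∈ Finset.range (T.patchCard z),
      (-1 : ℝ) ^ (j + 1) * ∑ i : Fin 2, polyFun (MvPolynomial.pderiv i (P i (ν.cell j))) z := by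
  rw [ν.altSum_eq (div v) (P := divPoly P) fun K hK x hx => div_eq hv hK hx]
  simp only [divPoly, polyFun_sum]

theorem altSum_div_add_smul {k : ℕ} {v w : Plane → Plane} (hv : v ∈ T.velocitySpace k)
    (hw : w ∈ T.velocitySpace k) (c : ℝ) {z : Plane} (ν : T.Numbering z) :
    ν.altSum (div (v + c • w)) = ν.altSum (div v) + c * ν.altSum (div w) := by
  obtain ⟨P, hP⟩ := exists_hasPolys hv
  obtain ⟨Q, hQ⟩ := exists_hasPolys hw
  rw [altSum_div_eq (hP.add_smul hQ c), altSum_div_eq hP, altSum_div_eq hQ, Finset.mul_sum,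
    ← Finset.sum_add_distrib]
  refine Finset.sum_congr rfl fun j _ => ?_
  rw [mul_left_comm c, ← mul_add]
  congr 1
  rw [Finset.mul_sum, ← Finset.sum_add_distrib]
  refine Finset.sum_congr rfl fun i _ => ?_
  rw [map_add, polyFun_add, MvPolynomial.pderiv_C_mul]
  simp [polyFun]

/-- The divergence of a field in the velocity space has mean zero. -/
theorem integral_div_eq_zero (hΩ : IsLipschitzDomain Ω) {k : ℕ} {v : Plane → Plane}
    (hv : v ∈ T.velocitySpace k) : ∫ x in Ω, div v x = 0 := by
  obtain ⟨P, hP⟩ := exists_hasPolys hv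
  obtain ⟨R, hR0, hR⟩ := hΩ.isBounded.subset_ball_lt 0 0
  -- a cut-off function that is `1` on the domain
  let χ : ContDiffBump (0 : Plane) := ⟨R, R + 1, hR0, by linarith⟩
  have hχ : ∀ x ∈ Ω, χ x = 1 := fun x hx =>
    χ.one_of_mem_closedBall (Metric.ball_subset_closedBall (hR hx))
  have h1 : ∀ i, ∑ K ∈ T.cells, ∫ x in interior (hull K), polyFun (MvPolynomial.pderiv i (P i K)) x
      = 0 := by
    intro i
    rw [← sum_integral_fderiv_mul hΩ (hv i).2 (fun K hK => (hP i K hK).2) χ.contDiff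
      χ.hasCompactSupport i]
    refine Finset.sum_congr rfl fun K hK =>
      setIntegral_congr_fun isOpen_interior.measurableSet fun x hx => ?_
    have : (fun y => polyFun (P i K) y * χ y) =ᶠ[𝓝 x] polyFun (P i K) := by
      filter_upwards [isOpen_interior.mem_nhds hx] with y hy
      rw [hχ y (interior_hull_subset hΩ hK hy), mul_one]
    simp only [this.fderiv_eq, fderiv_polyFun]
  rw [integral_eq_sum (T := T) hΩ fun K hK => integrableOn_interior_of_eq (continuous_polyFun _)
    fun x hx => div_eq hP hK hx]
  have h2 : ∀ K ∈ T.cells, ∫ x in interior (hull K), div v x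
      = ∑ i : Fin 2, ∫ x in interior (hull K), polyFun (MvPolynomial.pderiv i (P i K)) x := by
    intro K hK
    rw [← integral_finsetSum _ fun i _ => integrableOn_interior_of_eq (continuous_polyFun _)
      fun x _ => rfl]
    refine setIntegral_congr_fun isOpen_interior.measurableSet fun x hx => ?_
    simp only [div_eq hP hK hx, divPoly, polyFun_sum]
  rw [Finset.sum_congr rfl h2, Finset.sum_comm]
  exact Finset.sum_eq_zero fun i _ => h1 i

/-- The square of the `L²` norm on the triangle `K` of the gradient of the vector field with
components `P i K`. -/
def energy (P : Fin 2 → Finset Plane → MvPolynomial (Fin 2) ℝ) (K : Finset Plane) : ℝ :=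
  ∫ x in interior (hull K), ∑ i : Fin 2, ∑ j : Fin 2, polyFun (MvPolynomial.pderiv j (P i K)) x ^ 2

theorem energy_nonneg (P : Fin 2 → Finset Plane → MvPolynomial (Fin 2) ℝ) (K : Finset Plane) :
    0 ≤ energy P K := integral_nonneg fun _ => by positivity

theorem integral_grad_sq (hΩ : IsLipschitzDomain Ω) {k : ℕ} {v : Plane → Plane}
    {P : Fin 2 → Finset Plane → MvPolynomial (Fin 2) ℝ} (hv : T.HasPolys k v P) :
    ∫ x in Ω, ∑ i : Fin 2, ∑ j : Fin 2, partialDeriv v i j x ^ 2 = ∑ K ∈ T.cells, energy P K := by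
  have h : ∀ K ∈ T.cells, ∀ x ∈ interior (hull K),
      ∑ i : Fin 2, ∑ j : Fin 2, partialDeriv v i j x ^ 2
        = ∑ i : Fin 2, ∑ j : Fin 2, polyFun (MvPolynomial.pderiv j (P i K)) x ^ 2 := by
    intro K hK x hx
    simp only [partialDeriv_eq hv hK hx]
  rw [integral_eq_sum (T := T) hΩ fun K hK => integrableOn_interior_of_eq (by fun_prop) (h K hK)]
  exact Finset.sum_congr rfl fun K hK =>
    setIntegral_congr_fun isOpen_interior.measurableSet (h K hK)


/-! ### Existence of the minimizer -/

/-- The space of families of polynomials, one for each component and each triangle. The index ranges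
over all finite sets of points; only the entries at the triangles of a triangulation matter. -/
abbrev PolyFamily : Type := Fin 2 → Finset Plane → MvPolynomial (Fin 2) ℝ

/-- The matrices `(∂_j v_i)`, with the Euclidean (that is, Frobenius) norm. -/
abbrev GradMatrix : Type := EuclideanSpace ℝ (Fin 2 × Fin 2)

/-- The piecewise gradient of the vector field with the polynomial components `P i K` on the
triangles `K`, set to zero off the open triangles. -/
def piecewiseGrad (T : Triangulation Ω) (P : PolyFamily) (x : Plane) : GradMatrix :=
  WithLp.toLp 2 fun ij => ∑ K ∈ T.cells, (interior (hull K)).indicator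
    (polyFun (MvPolynomial.pderiv ij.2 (P ij.1 K))) x

theorem piecewiseGrad_apply (P : PolyFamily) {K : Finset Plane} (hK : K ∈ T.cells) {x : Plane}
    (hx : x ∈ interior (hull K)) (ij : Fin 2 × Fin 2) :
    T.piecewiseGrad P x ij = polyFun (MvPolynomial.pderiv ij.2 (P ij.1 K)) x := by
  change ∑ L ∈ T.cells, (interior (hull L)).indicator
    (polyFun (MvPolynomial.pderiv ij.2 (P ij.1 L))) x = _
  rw [Finset.sum_eq_single_of_mem K hK, Set.indicator_of_mem hx]
  intro L hL hLK
  exact Set.indicator_of_notMem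
    (fun hxL => Set.disjoint_left.1 (T.pairwise_disjoint_interior hL hK hLK) hxL hx) _

theorem norm_sq_piecewiseGrad (P : PolyFamily) {K : Finset Plane} (hK : K ∈ T.cells) {x : Plane}
    (hx : x ∈ interior (hull K)) :
    ‖T.piecewiseGrad P x‖ ^ 2
      = ∑ i : Fin 2, ∑ j : Fin 2, polyFun (MvPolynomial.pderiv j (P i K)) x ^ 2 := by
  rw [EuclideanSpace.norm_sq_eq, Fintype.sum_prod_type]
  simp only [piecewiseGrad_apply P hK hx, Real.norm_eq_abs, sq_abs]

theorem integral_norm_sq_piecewiseGrad (hΩ : IsLipschitzDomain Ω) (P : PolyFamily) :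
    ∫ x in Ω, ‖T.piecewiseGrad P x‖ ^ 2 = ∑ K ∈ T.cells, energy P K := by
  rw [integral_eq_sum (T := T) hΩ fun K hK => integrableOn_interior_of_eq (by fun_prop)
    fun x hx => norm_sq_piecewiseGrad P hK hx]
  exact Finset.sum_congr rfl fun K hK =>
    setIntegral_congr_fun isOpen_interior.measurableSet fun x hx => norm_sq_piecewiseGrad P hK hx

theorem memLp_piecewiseGrad (hΩ : IsLipschitzDomain Ω) (P : PolyFamily) :
    MemLp (T.piecewiseGrad P) 2 (volume.restrict Ω) := by
  have hm : Measurable (T.piecewiseGrad P) := by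
    refine (PiLp.continuous_toLp 2 fun _ : Fin 2 × Fin 2 => ℝ).measurable.comp
      (measurable_pi_lambda _ fun ij => ?_)
    exact Finset.measurable_fun_sum _ fun K _ =>
      (continuous_polyFun _).measurable.indicator isOpen_interior.measurableSet
  rw [memLp_two_iff_integrable_sq_norm hm.aestronglyMeasurable]
  exact integrableOn_domain (T := T) hΩ fun K hK => integrableOn_interior_of_eq (by fun_prop)
    fun x hx => norm_sq_piecewiseGrad P hK hx

/-- The piecewise gradient as a linear map into `L²(Ω)`. -/
def gradLp (T : Triangulation Ω) (hΩ : IsLipschitzDomain Ω) :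
    PolyFamily →ₗ[ℝ] Lp GradMatrix 2 (volume.restrict Ω) where
  toFun P := (memLp_piecewiseGrad (T := T) hΩ P).toLp _
  map_add' P Q := by
    rw [← MemLp.toLp_add]
    refine MemLp.toLp_congr _ _ (Eventually.of_forall fun x => ?_)
    ext ij
    simp only [piecewiseGrad, Pi.add_apply, PiLp.add_apply, map_add, ← Finset.sum_add_distrib]
    refine Finset.sum_congr rfl fun K _ => ?_
    by_cases hx : x ∈ interior (hull K)
    · simp only [Set.indicator_of_mem hx, polyFun_add]
    · simp only [Set.indicator_of_notMem hx, add_zero]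
  map_smul' c P := by
    rw [RingHom.id_apply, ← MemLp.toLp_const_smul]
    refine MemLp.toLp_congr _ _ (Eventually.of_forall fun x => ?_)
    ext ij
    simp only [piecewiseGrad, Pi.smul_apply, PiLp.smul_apply, Derivation.map_smul, smul_eq_mul,
      Finset.mul_sum]
    refine Finset.sum_congr rfl fun K _ => ?_
    by_cases hx : x ∈ interior (hull K)
    · simp only [Set.indicator_of_mem hx, polyFun, MvPolynomial.smul_eval]
    · simp only [Set.indicator_of_notMem hx, mul_zero]

theorem norm_gradLp (hΩ : IsLipschitzDomain Ω) (P : PolyFamily) :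
    ‖T.gradLp hΩ P‖ = Real.sqrt (∑ K ∈ T.cells, energy P K) := by
  rw [← integral_norm_sq_piecewiseGrad hΩ P, ← Real.sqrt_sq (norm_nonneg (T.gradLp hΩ P)),
    ← real_inner_self_eq_norm_sq, L2.inner_def]
  congr 1
  refine integral_congr_ae ?_
  filter_upwards [(memLp_piecewiseGrad (T := T) hΩ P).coeFn_toLp] with x hx
  rw [real_inner_self_eq_norm_sq]
  exact congrArg (fun y : GradMatrix => ‖y‖ ^ 2) hx

theorem gradLp_congr (hΩ : IsLipschitzDomain Ω) {P Q : PolyFamily}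
    (h : ∀ i, ∀ K ∈ T.cells, P i K = Q i K) : T.gradLp hΩ P = T.gradLp hΩ Q := by
  refine MemLp.toLp_congr (memLp_piecewiseGrad hΩ P) (memLp_piecewiseGrad hΩ Q)
    (Eventually.of_forall fun x => ?_)
  ext ij
  exact Finset.sum_congr rfl fun K hK => by rw [h _ K hK]

theorem normGradL2_eq_norm_gradLp (hΩ : IsLipschitzDomain Ω) {k : ℕ} {v : Plane → Plane}
    {P : PolyFamily} (hv : T.HasPolys k v P) : normGradL2 Ω v = ‖T.gradLp hΩ P‖ := by
  rw [norm_gradLp, normGradL2, integral_grad_sq hΩ hv]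

open Classical in
/-- Extension by zero of a family of polynomials of degree at most `k` on the triangles. -/
def extendFamily (T : Triangulation Ω) (k : ℕ) :
    (Fin 2 → T.cells → MvPolynomial.restrictTotalDegree (Fin 2) ℝ k) →ₗ[ℝ] PolyFamily :=
  LinearMap.pi fun i => LinearMap.pi fun K =>
    if h : K ∈ T.cells then
      (MvPolynomial.restrictTotalDegree (Fin 2) ℝ k).subtype ∘ₗ LinearMap.proj ⟨K, h⟩ ∘ₗ
        LinearMap.proj i
    else 0

theorem gradLp_mem_range (hΩ : IsLipschitzDomain Ω) {k : ℕ} {v : Plane → Plane} {P : PolyFamily}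
    (hv : T.HasPolys k v P) :
    T.gradLp hΩ P ∈ LinearMap.range (T.gradLp hΩ ∘ₗ T.extendFamily k) := by
  refine ⟨fun i K => ⟨P i K, (MvPolynomial.mem_restrictTotalDegree _ _ _).2 (hv i K K.2).1⟩, ?_⟩
  rw [LinearMap.comp_apply]
  refine gradLp_congr hΩ fun i K hK => ?_
  simp [extendFamily, hK]

theorem zero_hasPolys (k : ℕ) : T.HasPolys k 0 0 := fun i K _ => by
  simp [polyFun]

theorem zero_mem_wiredSpace {ν : ∀ z : T.vertices, T.Numbering z} {η : ℝ} (k : ℕ) :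
    (0 : Plane → Plane) ∈ T.wiredSpace ν η k := by
  refine ⟨zero_mem_velocitySpace k, fun z _ => ?_⟩
  rw [altSum_div_eq (zero_hasPolys k)]
  simp [polyFun]

theorem wiredSpace_add_smul {ν : ∀ z : T.vertices, T.Numbering z} {η : ℝ} {k : ℕ}
    {v w : Plane → Plane} (hv : v ∈ T.wiredSpace ν η k) (hw : w ∈ T.wiredSpace ν η k) (c : ℝ) :
    v + c • w ∈ T.wiredSpace ν η k := by
  refine ⟨velocitySpace_add_smul hv.1 hw.1 c, fun z hz => ?_⟩
  rw [altSum_div_add_smul hv.1 hw.1, hv.2 z hz, hw.2 z hz, mul_zero, add_zero]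

theorem gradLp_add_smul (hΩ : IsLipschitzDomain Ω) (P Q : PolyFamily) (c : ℝ) :
    T.gradLp hΩ (fun i K => P i K + MvPolynomial.C c * Q i K)
      = T.gradLp hΩ P + c • T.gradLp hΩ Q := by
  rw [← map_smul, ← map_add]
  refine gradLp_congr hΩ fun i K _ => ?_
  simp [MvPolynomial.smul_eq_C_mul]

/-- The distance in the energy seminorm from a discrete field to the subspace `X_η(T)` is attained:
the gradients of the fields in that subspace form a finite-dimensional subspace of `L²(Ω)`. -/
theorem exists_isLeast_normGradL2 (hΩ : IsLipschitzDomain Ω) (ν : ∀ z : T.vertices, T.Numbering z)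
    (η : ℝ) {k : ℕ} {v : Plane → Plane} (hv : v ∈ T.velocitySpace k) :
    ∃ m, IsLeast ((fun w => normGradL2 Ω (v - w)) '' T.wiredSpace ν η k) m := by
  obtain ⟨P, hP⟩ := exists_hasPolys hv
  let W : Submodule ℝ (Lp GradMatrix 2 (volume.restrict Ω)) :=
    { carrier := {s | ∃ w ∈ T.wiredSpace ν η k, ∃ Q, T.HasPolys k w Q ∧ T.gradLp hΩ Q = s}
      add_mem' := by
        rintro _ _ ⟨w, hw, Q, hQ, rfl⟩ ⟨w', hw', Q', hQ', rfl⟩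
        refine ⟨_, wiredSpace_add_smul hw hw' 1, _, hQ.add_smul hQ' 1, ?_⟩
        rw [gradLp_add_smul, one_smul]
      zero_mem' := ⟨0, zero_mem_wiredSpace k, 0, zero_hasPolys k, map_zero _⟩
      smul_mem' := by
        rintro c _ ⟨w, hw, Q, hQ, rfl⟩
        refine ⟨_, wiredSpace_add_smul (zero_mem_wiredSpace k) hw c, _,
          (zero_hasPolys k).add_smul hQ c, ?_⟩
        rw [gradLp_add_smul, map_zero, zero_add] }
  have hfin : FiniteDimensional ℝ W := by
    refine Submodule.finiteDimensional_of_le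
      (S₂ := LinearMap.range (T.gradLp hΩ ∘ₗ T.extendFamily k)) ?_
    rintro _ ⟨w, _, Q, hQ, rfl⟩
    exact gradLp_mem_range hΩ hQ
  have hdist : ∀ {w : Plane → Plane} {Q : PolyFamily}, T.HasPolys k w Q →
      normGradL2 Ω (v - w) = ‖T.gradLp hΩ P - T.gradLp hΩ Q‖ := by
    intro w Q hQ
    have h := normGradL2_eq_norm_gradLp hΩ (hP.add_smul hQ (-1))
    rwa [gradLp_add_smul, neg_one_smul, neg_one_smul, ← sub_eq_add_neg, ← sub_eq_add_neg] at h
  obtain ⟨s, ⟨w, hw, Q, hQ, rfl⟩, hs⟩ :=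
    W.exists_norm_eq_iInf_of_complete_subspace W.complete_of_finiteDimensional (T.gradLp hΩ P)
  refine ⟨normGradL2 Ω (v - w), ⟨w, hw, rfl⟩, ?_⟩
  rintro _ ⟨w', hw', rfl⟩
  obtain ⟨Q', hQ'⟩ := exists_hasPolys hw'.1
  change normGradL2 Ω (v - w) ≤ normGradL2 Ω (v - w')
  rw [hdist hQ, hdist hQ', hs]
  have hbdd : BddBelow (Set.range fun s : (W : Set (Lp GradMatrix 2 (volume.restrict Ω))) =>
      ‖T.gradLp hΩ P - s‖) := ⟨0, by rintro _ ⟨s, rfl⟩; exact norm_nonneg _⟩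
  exact ciInf_le hbdd ⟨T.gradLp hΩ Q', w', hw', Q', hQ', rfl⟩


/-! ### Vertex bubbles and the divergence estimate -/

/-- A polynomial bubble at a vertex `z`. It lives on the smallest triangle `K` of the patch, so that
its `L²` norm is controlled by the areas of all the triangles of the patch. Extended by zero, it
has mean zero, `A_z` takes the value one on it, and `A_{z'}` vanishes for all other vertices. -/
theorem exists_vertex_bubble {z : Plane} (hz : z ∈ T.vertices) (ν : T.Numbering z) {n : ℕ}
    (hn : 3 ≤ n) :
    ∃ K ∈ T.cells, z ∈ K ∧ ∃ B : MvPolynomial (Fin 2) ℝ, B.totalDegree ≤ n ∧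
      (∑ j ∈ Finset.range (T.patchCard z), if ν.cell j = K then (-1 : ℝ) ^ (j + 1) * polyFun B z
        else 0) = 1 ∧
      (∀ y ∈ K, y ≠ z → polyFun B y = 0) ∧
      ∫ x in interior (hull K), polyFun B x = 0 ∧
      ∀ j < T.patchCard z, kernelConst n * ∫ x in interior (hull K), polyFun B x ^ 2
        ≤ 4 * cross (ν.p j - z) (ν.p (j + 1) - z) := by
  classical
  have hN := Numbering.patchCard_pos hz
  obtain ⟨i, hi, hmin⟩ := Finset.exists_min_image (Finset.range (T.patchCard z))
    (fun j => cross (ν.p j - z) (ν.p (j + 1) - z)) ⟨0, Finset.mem_range.2 hN⟩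
  rw [Finset.mem_range] at hi
  obtain ⟨B, hdeg, hBz, hBa, hBb, hint, hsq⟩ := exists_bubble (ν.ccw i hi) hn
  have hopen : interior (hull (ν.cell i)) = openTri z (ν.p i) (ν.p (i + 1)) :=
      interior_hull (ν.ccw i hi)
  have hs : (-1 : ℝ) ^ (i + 1) * (-1 : ℝ) ^ (i + 1) = 1 := by
    rw [← mul_pow]; norm_num
  have hev : ∀ x, polyFun (MvPolynomial.C ((-1 : ℝ) ^ (i + 1)) * B) x
      = (-1 : ℝ) ^ (i + 1) * polyFun B x := fun x => by simp [polyFun]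
  refine ⟨ν.cell i, ν.cell_mem hi, ν.mem_cell i, MvPolynomial.C ((-1 : ℝ) ^ (i + 1)) * B,
    ?_, ?_, ?_, ?_, ?_⟩
  · refine (MvPolynomial.totalDegree_mul _ _).trans ?_
    rwa [MvPolynomial.totalDegree_C, zero_add]
  · rw [Finset.sum_eq_single_of_mem i (Finset.mem_range.2 hi)]
    · rw [if_pos rfl, hev, hBz, mul_one, hs]
    · intro j hj hji
      exact if_neg fun h => hji (ν.cell_inj (Finset.mem_range.1 hj) hi h)
  · intro y hy hyz
    have hy' : y = z ∨ y = ν.p i ∨ y = ν.p (i + 1) := by simpa [Numbering.cell] using hy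
    rw [hev]
    rcases hy' with rfl | rfl | rfl
    · exact absurd rfl hyz
    · rw [hBa, mul_zero]
    · rw [hBb, mul_zero]
  · simp only [hev]
    rw [hopen, integral_const_mul, hint, mul_zero]
  · intro j hj
    have h1 : ∀ x, polyFun (MvPolynomial.C ((-1 : ℝ) ^ (i + 1)) * B) x ^ 2 = polyFun B x ^ 2 := by
      intro x
      rw [hev, mul_pow, sq ((-1 : ℝ) ^ (i + 1)), hs, one_mul]
    simp only [h1]
    rw [hopen]
    have := hmin j (Finset.mem_range.2 hj)
    linarith

/-- The inverse inequality for the gradient at a vertex. -/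
theorem cross_mul_sq_jacNorm_le {z : Plane} (ν : T.Numbering z) {k : ℕ} {v : Plane → Plane}
    {P : PolyFamily} (hv : T.HasPolys k v P) {j : ℕ} (hj : j < T.patchCard z) :
    cross (ν.p j - z) (ν.p (j + 1) - z) * jacNorm (fun i => P i (ν.cell j)) z ^ 2
      ≤ kernelConst (k - 1) * energy P (ν.cell j) := by
  have hopen : interior (hull (ν.cell j)) = openTri z (ν.p j) (ν.p (j + 1)) :=
      interior_hull (ν.ccw j hj)
  have hI : ∀ i l : Fin 2, IntegrableOn
      (fun x => polyFun (MvPolynomial.pderiv l (P i (ν.cell j))) x ^ 2)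
      (interior (hull (ν.cell j))) := fun i l =>
    integrableOn_interior_of_eq (by fun_prop) fun x _ => rfl
  have hE : energy P (ν.cell j) = ∑ i : Fin 2, ∑ l : Fin 2, ∫ x in interior (hull (ν.cell j)),
      polyFun (MvPolynomial.pderiv l (P i (ν.cell j))) x ^ 2 := by
    rw [energy, integral_finsetSum _ fun i _ => integrable_finsetSum _ fun l _ => hI i l]
    exact Finset.sum_congr rfl fun i _ => integral_finsetSum _ fun l _ => hI i l
  rw [jacNorm, Real.sq_sqrt (by positivity), hE]
  simp only [Finset.mul_sum]
  refine Finset.sum_le_sum fun i _ => Finset.sum_le_sum fun l _ => ?_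
  rw [hopen]
  exact sq_polyFun_vertex_le (ν.ccw j hj) (totalDegree_pderiv_le _ _ (hv i _ (ν.cell_mem hj)).1)

theorem sum_energy_cell {z : Plane} (ν : T.Numbering z) (P : PolyFamily) :
    ∑ j ∈ Finset.range (T.patchCard z), energy P (ν.cell j) = ∑ K ∈ T.patch z, energy P K := by
  refine Finset.sum_bij (fun j _ => ν.cell j) (fun j hj => ν.cell_mem_patch (Finset.mem_range.1 hj))
    (fun i hi j hj h => ν.cell_inj (Finset.mem_range.1 hi) (Finset.mem_range.1 hj) h) ?_
    fun j _ => rfl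
  intro K hK
  obtain ⟨j, hj, h⟩ := ν.bijOn.surjOn (Finset.mem_coe.2 hK)
  exact ⟨j, Finset.mem_range.2 hj, h⟩

/-- Each triangle belongs to the patches of its three vertices. -/
theorem sum_sum_patch (f : Finset Plane → ℝ) :
    ∑ z : T.vertices, ∑ K ∈ T.patch z, f K = 3 * ∑ K ∈ T.cells, f K := by
  classical
  rw [Finset.sum_coe_sort T.vertices fun z => ∑ K ∈ T.patch z, f K]
  have h : ∀ z, ∑ K ∈ T.patch z, f K = ∑ K ∈ T.cells, if z ∈ K then f K else 0 := by
    intro z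
    rw [← Finset.sum_filter]
    refine Finset.sum_congr ?_ fun _ _ => rfl
    ext K; simp [patch]
  simp only [h]
  rw [Finset.sum_comm, Finset.mul_sum]
  refine Finset.sum_congr rfl fun K hK => ?_
  rw [← Finset.sum_filter]
  have : T.vertices.filter (fun z => z ∈ K) = K := by
    ext z
    rw [Finset.mem_filter, vertices, Finset.mem_biUnion]
    exact ⟨fun h => h.2, fun h => ⟨⟨K, hK, h⟩, h⟩⟩
  rw [this, Finset.sum_const, T.card_eq K hK, nsmul_eq_mul]
  norm_num

/-- At an `η`-critical vertex, the functional `A_z` of a divergence is of order `η`. The number `S`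
stands for the square of the norm of the bubble; the factor `kernelConst (k - 1)` in the hypothesis
on `S` cancels the one in the inverse inequality. -/
theorem sq_altSum_div_mul_le (hΩ : IsLipschitzDomain Ω) {k : ℕ} {v : Plane → Plane}
    (hv : v ∈ T.velocitySpace k) {P : PolyFamily} (hP : T.HasPolys k v P) {z : Plane}
    (hz : z ∈ T.vertices) (ν : T.Numbering z) {γ η : ℝ} (hγ : T.shapeRegularity ≤ γ) (hη0 : 0 ≤ η)
    (hη₁ : η * γ < 1) (hη₂ : 64 * γ ^ 2 * η < 1) (hs : ν.singularity ≤ η) {S : ℝ} (hS0 : 0 ≤ S)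
    (hS : ∀ j < T.patchCard z, kernelConst (k - 1) * S ≤ 4 * cross (ν.p j - z) (ν.p (j + 1) - z)) :
    ν.altSum (div v) ^ 2 * S ≤ 256 * η ^ 2 * γ ^ 6 * ∑ K ∈ T.patch z, energy P K := by
  have hN := Numbering.patchCard_pos hz
  have hγ1 := ν.one_le_of_shape hγ hN
  have hcard := ν.patchCard_le hγ hN
  have hA := ν.abs_altSum_div_le hΩ (fun i => (hv i).2) (fun i K hK => (hP i K hK).2) hz hγ hη0
    hη₁ hη₂ hs
  rw [← altSum_div_eq hP] at hA
  set F : ℕ → ℝ := fun j => jacNorm (fun i => P i (ν.cell j)) z with hF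
  have hcs : (∑ j ∈ Finset.range (T.patchCard z), F j) ^ 2
      ≤ T.patchCard z * ∑ j ∈ Finset.range (T.patchCard z), F j ^ 2 := by
    simpa using sq_sum_le_card_mul_sum_sq (s := Finset.range (T.patchCard z)) (f := F)
  have hF2 : (∑ j ∈ Finset.range (T.patchCard z), F j ^ 2) * S
      ≤ 4 * ∑ K ∈ T.patch z, energy P K := by
    rw [← sum_energy_cell ν, Finset.sum_mul, Finset.mul_sum]
    refine Finset.sum_le_sum fun j hj => ?_
    rw [Finset.mem_range] at hj
    have h1 := cross_mul_sq_jacNorm_le ν hP hj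
    have h2 := mul_le_mul_of_nonneg_right (hS j hj) (sq_nonneg (F j))
    have h3 := kernelConst_pos (k - 1)
    refine le_of_mul_le_mul_left ?_ h3
    change cross (ν.p j - z) (ν.p (j + 1) - z) * F j ^ 2 ≤ _ at h1
    linarith
  have hE : 0 ≤ ∑ K ∈ T.patch z, energy P K := Finset.sum_nonneg fun K _ => energy_nonneg P K
  calc ν.altSum (div v) ^ 2 * S
      ≤ (η * γ ^ 2 * ∑ j ∈ Finset.range (T.patchCard z), F j) ^ 2 * S :=
        mul_le_mul_of_nonneg_right (by rw [← sq_abs]; exact pow_le_pow_left₀ (abs_nonneg _) hA 2)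
            hS0
    _ = η ^ 2 * γ ^ 4 * ((∑ j ∈ Finset.range (T.patchCard z), F j) ^ 2 * S) := by ring
    _ ≤ η ^ 2 * γ ^ 4 *
          ((T.patchCard z * ∑ j ∈ Finset.range (T.patchCard z), F j ^ 2) * S) := by gcongr
    _ = η ^ 2 * γ ^ 4 *
          (T.patchCard z * ((∑ j ∈ Finset.range (T.patchCard z), F j ^ 2) * S)) := by ring
    _ ≤ η ^ 2 * γ ^ 4 * (64 * γ ^ 2 * (4 * ∑ K ∈ T.patch z, energy P K)) := by gcongr
    _ = 256 * η ^ 2 * γ ^ 6 * ∑ K ∈ T.patch z, energy P K := by ring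

/-- Young's inequality for at most three summands. -/
theorem mul_sum_le_of_card_le_three {ι : Type*} {s : Finset ι}
    (hs : s.card ≤ 3) (d : ℝ) (b : ι → ℝ) :
    d * ∑ i ∈ s, b i ≤ 1 / 2 * d ^ 2 + 3 / 2 * ∑ i ∈ s, b i ^ 2 := by
  have h : ∀ i ∈ s, d * b i ≤ 1 / 6 * d ^ 2 + 3 / 2 * b i ^ 2 := fun i _ => by
    nlinarith [sq_nonneg (d - 3 * b i)]
  have h2 := Finset.sum_le_sum h
  rw [Finset.sum_add_distrib, Finset.sum_const, nsmul_eq_mul, ← Finset.mul_sum,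
      ← Finset.mul_sum] at h2
  have h3 : (s.card : ℝ) ≤ 3 := by exact_mod_cast hs
  nlinarith [mul_le_mul_of_nonneg_right h3 (sq_nonneg d)]

/-- If `div v` is orthogonal to the pressures, its norm is controlled by the values `A_z (div v)`
at the critical vertices: subtracting from `div v` the vertex bubbles `B z`, each on its triangle
`K z`, with these coefficients gives an admissible pressure. -/
theorem integral_sq_div_le (hΩ : IsLipschitzDomain Ω) (ν : ∀ z : T.vertices, T.Numbering z)
    {η : ℝ} {k : ℕ} {v : Plane → Plane} (hv : v ∈ T.velocitySpace k)
    (horth : ∀ q ∈ T.pressureSpace ν η (k - 1), ∫ x in Ω, div v x * q x = 0)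
    {s : Finset T.vertices} (hs : ∀ z, z ∈ s ↔ z ∈ T.critical ν η)
    {K : T.vertices → Finset Plane} {B : T.vertices → MvPolynomial (Fin 2) ℝ}
    (hK : ∀ z, K z ∈ T.cells) (hzK : ∀ z, (z : Plane) ∈ K z)
    (hdeg : ∀ z, (B z).totalDegree ≤ k - 1)
    (hone : ∀ z : T.vertices, (∑ j ∈ Finset.range (T.patchCard z), if (ν z).cell j = K z then
      (-1 : ℝ) ^ (j + 1) * polyFun (B z) z else 0) = 1)
    (hzero : ∀ z, ∀ y ∈ K z, y ≠ z → polyFun (B z) y = 0)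
    (hmean : ∀ z, ∫ x in interior (hull (K z)), polyFun (B z) x = 0) :
    ∫ x in Ω, div v x ^ 2
      ≤ 3 * ∑ z ∈ s, (ν z).altSum (div v) ^ 2 * ∫ x in interior (hull (K z)),
          polyFun (B z) x ^ 2 := by
  classical
  obtain ⟨P, hP⟩ := exists_hasPolys hv
  set a : T.vertices → ℝ := fun z => (ν z).altSum (div v) with ha
  -- the correction of the divergence on a triangle
  set R : Finset Plane → MvPolynomial (Fin 2) ℝ := fun L =>
    ∑ z ∈ s.filter (fun z => K z = L), MvPolynomial.C (a z) * B z with hR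
  -- the admissible pressure used as test function
  set q : Plane → ℝ := fun x => div v x - ∑ L ∈ T.cells,
      (interior (hull L)).indicator (polyFun (R L)) x
    with hq
  have hRev : ∀ L x, polyFun (R L) x = ∑ z ∈ s.filter (fun z => K z = L),
      a z * polyFun (B z) x := by
    intro L x
    rw [hR, polyFun_sum]
    simp [polyFun]
  have hqL : ∀ L ∈ T.cells, ∀ x ∈ interior (hull L), q x = polyFun (divPoly P L - R L) x := by
    intro L hL x hx
    have : ∑ M ∈ T.cells, (interior (hull M)).indicator (polyFun (R M)) x = polyFun (R L) x := by
      rw [Finset.sum_eq_single_of_mem L hL, Set.indicator_of_mem hx]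
      intro M hM hML
      exact Set.indicator_of_notMem
        (fun hxM => Set.disjoint_left.1 (T.pairwise_disjoint_interior hM hL hML) hxM hx) _
    rw [hq, polyFun_sub, ← div_eq hP hL hx, ← this]
  have hmeanR : ∀ L, ∫ x in interior (hull L), polyFun (R L) x = 0 := by
    intro L
    simp only [hRev]
    rw [integral_finsetSum _ fun z _ => (integrableOn_interior_of_eq (continuous_polyFun (B z))
      fun x _ => rfl).const_mul (a z)]
    refine Finset.sum_eq_zero fun z hz => ?_
    rw [integral_const_mul, ← (Finset.mem_filter.1 hz).2, hmean, mul_zero]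
  have hqmem : q ∈ T.pressureSpace ν η (k - 1) := by
    refine ⟨fun L hL => ⟨divPoly P L - R L, ?_, hqL L hL⟩, ?_, fun z hz => ?_⟩
    · refine (MvPolynomial.totalDegree_sub _ _).trans (max_le (totalDegree_divPoly_le hP hL) ?_)
      refine MvPolynomial.totalDegree_finsetSum_le fun z _ =>
        (MvPolynomial.totalDegree_mul _ _).trans ?_
      rw [MvPolynomial.totalDegree_C, zero_add]
      exact hdeg z
    · rw [← integral_div_eq_zero hΩ hv, integral_eq_sum (T := T) hΩ fun L hL =>
        integrableOn_interior_of_eq (continuous_polyFun _) (hqL L hL),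
        integral_eq_sum (T := T) hΩ fun L hL =>
        integrableOn_interior_of_eq (continuous_polyFun _) fun x hx => div_eq hP hL hx]
      refine Finset.sum_congr rfl fun L hL => ?_
      rw [setIntegral_congr_fun isOpen_interior.measurableSet (hqL L hL),
        setIntegral_congr_fun isOpen_interior.measurableSet fun x hx => div_eq hP hL hx]
      simp only [polyFun_sub]
      rw [integral_sub, hmeanR, sub_zero]
      · exact integrableOn_interior_of_eq (continuous_polyFun _) fun x _ => rfl
      · exact integrableOn_interior_of_eq (continuous_polyFun _) fun x _ => rfl
    · rw [(ν z).altSum_eq q hqL]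
      simp only [polyFun_sub, mul_sub, Finset.sum_sub_distrib]
      rw [← (ν z).altSum_eq (div v) fun L hL x hx => div_eq hP hL hx, sub_eq_zero]
      -- only the bubble at `z` itself has a nonzero value at `z`
      have h1 : ∀ j ∈ Finset.range (T.patchCard z),
          (-1 : ℝ) ^ (j + 1) * polyFun (R ((ν z).cell j)) z
          = a z * if (ν z).cell j = K z then (-1 : ℝ) ^ (j + 1) * polyFun (B z) z else 0 := by
        intro j _
        have h2 : ∀ y ∈ s.filter (fun y => K y = (ν z).cell j), y ≠ z →
            a y * polyFun (B y) z = 0 := by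
          intro y hy hyz
          rw [hzero y z (by rw [(Finset.mem_filter.1 hy).2]; exact (ν z).mem_cell j)
            fun h => hyz (Subtype.ext h).symm, mul_zero]
        rw [hRev]
        split_ifs with h
        · rw [Finset.sum_eq_single_of_mem z (Finset.mem_filter.2 ⟨(hs z).2 hz, h.symm⟩) h2]
          ring
        · rw [Finset.sum_eq_zero, mul_zero, mul_zero]
          intro y hy
          refine h2 y hy ?_
          rintro rfl
          exact h (Finset.mem_filter.1 hy).2.symm
      rw [Finset.sum_congr rfl h1, ← Finset.mul_sum, hone, mul_one]
  have hcont : ∀ L, Continuous fun x => polyFun (divPoly P L) x * polyFun (divPoly P L - R L) x :=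
    fun L => (continuous_polyFun _).mul (continuous_polyFun _)
  have hint : ∀ {f : Plane → ℝ}, Continuous f → ∀ L, IntegrableOn f (interior (hull L)) :=
    fun hf L => integrableOn_interior_of_eq hf fun x _ => rfl
  have h0 := horth q hqmem
  have hdq : ∀ L ∈ T.cells, ∀ x ∈ interior (hull L),
      div v x * q x = polyFun (divPoly P L) x * polyFun (divPoly P L - R L) x := fun L hL x hx => by
    rw [div_eq hP hL hx, hqL L hL x hx]
  have hdd : ∀ L ∈ T.cells, ∀ x ∈ interior (hull L), div v x ^ 2 = polyFun (divPoly P L) x ^ 2 :=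
    fun L hL x hx => by rw [div_eq hP hL hx]
  rw [integral_eq_sum (T := T) hΩ fun L hL =>
      integrableOn_interior_of_eq (hcont L) (hdq L hL)] at h0
  have hX : ∫ x in Ω, div v x ^ 2
      = ∑ L ∈ T.cells, ∫ x in interior (hull L), polyFun (divPoly P L) x ^ 2 := by
    rw [integral_eq_sum (T := T) hΩ fun L hL =>
        integrableOn_interior_of_eq (by fun_prop) (hdd L hL)]
    exact Finset.sum_congr rfl fun L hL =>
      setIntegral_congr_fun isOpen_interior.measurableSet (hdd L hL)
  -- Young's inequality on each triangle, for the at most three bubbles that live there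
  have hcell : ∀ L ∈ T.cells, ∫ x in interior (hull L), polyFun (divPoly P L) x ^ 2
      ≤ (∫ x in interior (hull L), div v x * q x)
        + (1 / 2 * (∫ x in interior (hull L), polyFun (divPoly P L) x ^ 2)
          + 3 / 2 * ∑ z ∈ s.filter (fun z => K z = L),
            a z ^ 2 * ∫ x in interior (hull (K z)), polyFun (B z) x ^ 2) := by
    intro L hL
    have hcard : (s.filter (fun z => K z = L)).card ≤ 3 := by
      rw [← T.card_eq L hL]
      refine Finset.card_le_card_of_injOn (fun z => (z : Plane)) (fun z hz => ?_)
        fun _ _ _ _ h => Subtype.ext h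
      have := hzK z
      rwa [(Finset.mem_filter.1 hz).2] at this
    have hsum : ∑ z ∈ s.filter (fun z => K z = L),
        a z ^ 2 * ∫ x in interior (hull (K z)), polyFun (B z) x ^ 2
        = ∫ x in interior (hull L), ∑ z ∈ s.filter (fun z => K z = L),
            (a z * polyFun (B z) x) ^ 2 := by
      rw [integral_finsetSum _ fun z _ => hint (by fun_prop) L]
      refine Finset.sum_congr rfl fun z hz => ?_
      simp only [mul_pow]
      rw [integral_const_mul, (Finset.mem_filter.1 hz).2]
    rw [hsum, ← integral_const_mul, ← integral_const_mul,
      ← integral_add (hint (by fun_prop) L) (hint (by fun_prop) L),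
      setIntegral_congr_fun isOpen_interior.measurableSet (hdq L hL),
      ← integral_add (hint (hcont L) L) (hint (by fun_prop) L)]
    refine integral_mono (hint (by fun_prop) L) (hint ((hcont L).add (by fun_prop)) L) fun x => ?_
    have h := mul_sum_le_of_card_le_three hcard (polyFun (divPoly P L) x) fun z =>
        a z * polyFun (B z) x
    rw [← hRev] at h
    change polyFun (divPoly P L) x ^ 2 ≤ polyFun (divPoly P L) x * polyFun (divPoly P L - R L) x + _
    rw [polyFun_sub]
    linarith
  have hsum := Finset.sum_le_sum hcell
  rw [Finset.sum_add_distrib, h0, zero_add, Finset.sum_add_distrib, ← Finset.mul_sum,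
    ← Finset.mul_sum, Finset.sum_fiberwise_of_maps_to fun z _ => hK z, ← hX] at hsum
  linarith

/-- The divergence estimate against an arbitrary field `w` in the wired space. -/
theorem normL2_div_le (hΩ : IsLipschitzDomain Ω) (ν : ∀ z : T.vertices, T.Numbering z) {γ η : ℝ}
    (hγ : T.shapeRegularity ≤ γ) (hη0 : 0 ≤ η) (hη₁ : η * γ < 1) (hη₂ : 64 * γ ^ 2 * η < 1)
    {k : ℕ} (hk : 4 ≤ k) {v w : Plane → Plane} (hv : v ∈ T.velocitySpace k)
    (horth : ∀ q ∈ T.pressureSpace ν η (k - 1), ∫ x in Ω, div v x * q x = 0)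
    (hw : w ∈ T.wiredSpace ν η k) :
    normL2 Ω (div v) ≤ 48 * |γ| ^ 3 * η * normGradL2 Ω (v - w) := by
  classical
  have hvw : v + (-1 : ℝ) • w ∈ T.velocitySpace k := velocitySpace_add_smul hv hw.1 (-1)
  have hvw' : v + (-1 : ℝ) • w = v - w := by rw [neg_one_smul, sub_eq_add_neg]
  obtain ⟨P, hP⟩ := exists_hasPolys hvw
  choose K hK hzK B hdeg hone hzero hmean hS using fun z : T.vertices =>
    exists_vertex_bubble z.2 (ν z) (n := k - 1) (by omega)
  set s : Finset T.vertices := Finset.univ.filter fun z => z ∈ T.critical ν η with hs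
  have h1 := integral_sq_div_le hΩ ν hv horth (s := s) (by simp [hs]) hK hzK hdeg hone hzero hmean
  have h2 : ∀ z ∈ s, (ν z).altSum (div v) ^ 2 * ∫ x in interior (hull (K z)), polyFun (B z) x ^ 2
      ≤ 256 * η ^ 2 * γ ^ 6 * ∑ L ∈ T.patch z, energy P L := by
    intro z hz
    have hzη : z ∈ T.critical ν η := (Finset.mem_filter.1 hz).2
    have hS0 : 0 ≤ ∫ x in interior (hull (K z)), polyFun (B z) x ^ 2 :=
      integral_nonneg fun _ => sq_nonneg _
    by_cases hz0 : z ∈ T.critical ν 0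
    · -- at an exactly singular vertex every discrete divergence has vanishing alternating sum
      obtain ⟨Q, hQ⟩ := exists_hasPolys hv
      have hA := (ν z).abs_altSum_div_le hΩ (fun i => (hv i).2) (fun i L hL => (hQ i L hL).2) z.2 hγ
        le_rfl (by norm_num) (by norm_num) hz0
      rw [← altSum_div_eq hQ, zero_mul, zero_mul] at hA
      rw [abs_nonpos_iff.1 hA]
      have hE : 0 ≤ ∑ L ∈ T.patch z, energy P L := Finset.sum_nonneg fun L _ => energy_nonneg P L
      rw [zero_pow two_ne_zero, zero_mul]
      exact mul_nonneg (by positivity) hE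
    · have h3 := sq_altSum_div_mul_le hΩ hvw hP z.2 (ν z) hγ hη0 hη₁ hη₂ hzη hS0 (hS z)
      rwa [altSum_div_add_smul hv hw.1, hw.2 z ⟨hzη, hz0⟩, mul_zero, add_zero] at h3
  have h3 : ∑ z ∈ s, (ν z).altSum (div v) ^ 2 * ∫ x in interior (hull (K z)), polyFun (B z) x ^ 2
      ≤ 256 * η ^ 2 * γ ^ 6 * (3 * ∑ L ∈ T.cells, energy P L) := by
    refine (Finset.sum_le_sum h2).trans ?_
    rw [← Finset.mul_sum, ← sum_sum_patch (energy P)]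
    refine mul_le_mul_of_nonneg_left ?_ (by positivity)
    exact Finset.sum_le_sum_of_subset_of_nonneg (Finset.subset_univ _) fun z _ _ =>
      Finset.sum_nonneg fun L _ => energy_nonneg P L
  have hG : normGradL2 Ω (v - w) ^ 2 = ∑ L ∈ T.cells, energy P L := by
    rw [← hvw', normGradL2, integral_grad_sq hΩ hP,
      Real.sq_sqrt (Finset.sum_nonneg fun L _ => energy_nonneg P L)]
  have hG0 : 0 ≤ normGradL2 Ω (v - w) := Real.sqrt_nonneg _
  rw [normL2]
  refine Real.sqrt_le_iff.2 ⟨by positivity, ?_⟩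
  have hγ6 : |γ| ^ 6 = γ ^ 6 := by
    rw [show 6 = 2 * 3 by norm_num, pow_mul, sq_abs, ← pow_mul]
  calc ∫ x in Ω, div v x ^ 2 ≤ 3 * (256 * η ^ 2 * γ ^ 6 * (3 * ∑ L ∈ T.cells, energy P L)) := by
        linarith
    _ = (48 * |γ| ^ 3 * η * normGradL2 Ω (v - w)) ^ 2 := by
        rw [← hG, ← hγ6]; ring

end Triangulation

end PressureWired

end

theorem mainTheorem4 (γ : ℝ) :
    ∃ C : ℝ, 0 < C ∧ ∀ α : ℝ, 0 < α → ∃ η₀ : ℝ, 0 < η₀ ∧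
      ∀ (Ω : Set PressureWired.Plane), PressureWired.IsLipschitzDomain Ω →
      ∀ (T : PressureWired.Triangulation Ω) (ν : ∀ z : T.vertices, T.Numbering z),
        T.shapeRegularity ≤ γ → α ≤ T.minOuterAngle ν →
      ∀ (k : ℕ) (η : ℝ), 4 ≤ k → 0 ≤ η → η < η₀ →
      ∀ v ∈ T.velocitySpace k,
        (∀ q ∈ T.pressureSpace ν η (k - 1), ∫ x in Ω, PressureWired.div v x * q x = 0) →
        ∃ m : ℝ,
          IsLeast ((fun w => PressureWired.normGradL2 Ω (v - w)) '' T.wiredSpace ν η k) m ∧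
          PressureWired.normL2 Ω (PressureWired.div v) ≤ C * η * m := by
  have hden : 0 < 64 * γ ^ 2 + |γ| + 1 := by positivity
  -- `48 |γ| ^ 3` would be enough but need not be positive; the choice of `η₀` ensures `η γ < 1` and
  -- `64 γ ^ 2 η < 1` for every real `γ`
  refine ⟨48 * |γ| ^ 3 + 1, by positivity, fun α _ =>
      ⟨1 / (64 * γ ^ 2 + |γ| + 1), by positivity, ?_⟩⟩
  intro Ω hΩ T ν hγ _ k η hk hη0 hη v hv horth
  rw [lt_div_iff₀ hden] at hη
  have h1 : η * γ ≤ η * |γ| := mul_le_mul_of_nonneg_left (le_abs_self γ) hη0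
  have h2 : 0 ≤ η * |γ| := by positivity
  have h3 : 0 ≤ η * γ ^ 2 := by positivity
  obtain ⟨m, hm⟩ := PressureWired.Triangulation.exists_isLeast_normGradL2 hΩ ν η hv
  refine ⟨m, hm, ?_⟩
  obtain ⟨w, hw, rfl⟩ := hm.1
  refine (PressureWired.Triangulation.normL2_div_le hΩ ν hγ hη0 (by nlinarith) (by nlinarith) hk hv
    horth hw).trans ?_
  have h4 : 0 ≤ PressureWired.normGradL2 Ω (v - w) := Real.sqrt_nonneg _
  have h5 : 0 ≤ η * PressureWired.normGradL2 Ω (v - w) := by positivity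
  change _ ≤ (48 * |γ| ^ 3 + 1) * η * PressureWired.normGradL2 Ω (v - w)
  nlinarith
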